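/- Let $p\ge 3$ be a prime and fix $\rho\in\mathbb{Z}_p^*$ which is not a square modulo $p$. Put $\delta_p=(p-1)/2$. **Definitions.** An $n$-dimensional $\mathbb{Z}_p$-Lie lattice is a Lie algebra over $\mathbb{Z}_p$ whose underlying module is free of rank $n$. A *virtual endomorphism* of index $d$ of such a lattice $L$ is a Lie algebra morphism $\varphi:M\to L$, where $M\subseteq L$ is a subalgebra of dimension $n$ and $d=[L:M]$; it is *simple* if the only ideal $I$ of $L$ with $I\subseteq M$ and $\varphi(I)\subseteq I$ is $I=0$. $L$ is *self-similar of index $d$* ($d\ge 1$) if it admits a simple virtual endomorphism of index $d$, and *self-similar* if it is so for some $d$. The self-similarity index $\sigma(L)$ is the least such $d$ ($\sigma(L)=\infty$ if there is none). For $a_0,a_1,a_2\in\mathbb{Z}_p$ let $(a_0,a_1,a_2)$ denote the $\mathbb{Z}_p$-Lie lattice with basis $x_0,x_1,x_2$ and bracket $[x_1,x_2]=a_0x_0$, $[x_2,x_0]=a_1x_1$, $[x_0,x_1]=a_2x_2$. **Theorem.** Let $L$ be a 3-dimensional unsolvable $\mathbb{Z}_p$-Lie lattice with $L\otimes_{\mathbb{Z}_p}\mathbb{Q}_p\simeq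 sl_2(\mathbb{Q}_p)$. Then $L$ is self-similar. Moreover, $L$ is isomorphic to exactly one lattice of the following list (exactly one line, and exactly one choice of the parameters in it), and $\sigma=\sigma(L)$ satisfies what is stated in that line. Conversely, every lattice in the list is a 3-dimensional unsolvable $\mathbb{Z}_p$-Lie lattice with $L\otimes_{\mathbb{Z}_p}\mathbb{Q}_p\simeq sl_2(\mathbb{Q}_p)$. The parameters are integers $0\le s_0<s_1<s_2$ and $\varepsilon_1,\varepsilon_2\in\{0,1\}$ (in each line only those that appear there, with the inequalities between them), and $\equiv$ is congruence modulo 2. 1. $(p^{s_0},p^{s_0},p^{s_0})$: $\sigma=p$. 2. $(p^{s_0},p^{s_1},-p^{s_1})$: $\sigma=p$. 3. $(p^{s_0},p^{s_1},-\rho p^{s_1})$, where $s_0\equiv s_1$: $p^2\le\sigma\le p^{s_1-s_0+1}$. 4. $(p^{s_0},-p^{s_0},p^{s_2})$: $\sigma=p$. 5. $(p^{s_0},-\rho p^{s_0},p^{s_2})$, where $s_0\equiv s_2$: $p^2\le\sigma\le p^{\frac{s_2-s_0}{2}+1}$. 6. $(p^{s_0},\rho^{\varepsilon_1}p^{s_1},\rho^{\varepsilon_2}p^{s_2})$,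 where $s_0\equiv s_1\equiv s_2$: $p^2\le\sigma\le p^{\frac{s_1-s_0}{2}+\frac{s_2-s_0}{2}+1}$. 7. $(p^{s_0},\rho^{\varepsilon_1}p^{s_1},\rho^{\varepsilon_2}p^{s_2})$, where $s_0\equiv s_1\not\equiv s_2$ and $\varepsilon_1+\delta_p\equiv 0$: $p^2\le\sigma\le p^{\frac{s_1-s_0}{2}+1}$. 8. $(p^{s_0},\rho^{\varepsilon_1}p^{s_1},\rho^{\varepsilon_2}p^{s_2})$, where $s_1\equiv s_2\not\equiv s_0$ and $\varepsilon_1+\varepsilon_2+\delta_p\equiv 0$: $p^2\le\sigma\le p^{\frac{s_2-s_1}{2}+1}$. 9. $(p^{s_0},\rho^{\varepsilon_1}p^{s_1},\rho^{\varepsilon_2}p^{s_2})$, where $s_0\equiv s_2\not\equiv s_1$ and $\varepsilon_2+\delta_p\equiv 0$: $p^2\le\sigma\le p^{\frac{s_2-s_0}{2}+1}$. -/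

import Mathlib

open scoped TensorProduct Matrix

universe u

noncomputable section

/-! ### Virtual endomorphisms and self-similarity of Lie lattices -/

/-- A virtual endomorphism of a `ℤ_[p]`-Lie lattice `L`: a Lie algebra morphism `M → L`,
where `M` is a subalgebra of `L` of the same dimension as `L`. -/
structure VirtualEndomorphism (p : ℕ) [Fact p.Prime] (L : Type*) [LieRing L]
    [LieAlgebra ℤ_[p] L] where
  domain : LieSubalgebra ℤ_[p] L
  finrank_domain : Module.finrank ℤ_[p] domain = Module.finrank ℤ_[p] L
  toHom : domain →ₗ⁅ℤ_[p]⁆ L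

namespace VirtualEndomorphism

variable {p : ℕ} [Fact p.Prime] {L : Type*} [LieRing L] [LieAlgebra ℤ_[p] L]

/-- The index `[L : M]` of the domain `M`, as additive groups. -/
def index (φ : VirtualEndomorphism p L) : ℕ :=
  φ.domain.toSubmodule.toAddSubgroup.index

/-- An ideal `I` of `L` is `φ`-invariant if `I ⊆ M` and `φ(I) ⊆ I`. -/
def IsInvariant (φ : VirtualEndomorphism p L) (I : LieIdeal ℤ_[p] L) : Prop :=
  ∀ x ∈ I, ∃ h : x ∈ φ.domain, φ.toHom ⟨x, h⟩ ∈ I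

/-- `φ` is simple if the only `φ`-invariant ideal of `L` is the zero ideal. -/
def IsSimple (φ : VirtualEndomorphism p L) : Prop :=
  ∀ I : LieIdeal ℤ_[p] L, φ.IsInvariant I → I = ⊥

end VirtualEndomorphism

/-- `L` is self-similar of index `d ≥ 1` if it has a simple virtual endomorphism of index `d`. -/
def IsSelfSimilarOfIndex (p : ℕ) [Fact p.Prime] (L : Type*) [LieRing L] [LieAlgebra ℤ_[p] L]
    (d : ℕ) : Prop :=
  1 ≤ d ∧ ∃ φ : VirtualEndomorphism p L, φ.index = d ∧ φ.IsSimple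

/-- `L` is self-similar if it is self-similar of some index. -/
def IsSelfSimilar (p : ℕ) [Fact p.Prime] (L : Type*) [LieRing L] [LieAlgebra ℤ_[p] L] : Prop :=
  ∃ d : ℕ, IsSelfSimilarOfIndex p L d

/-- The self-similarity index `σ(L)`: the least `d` such that `L` is self-similar of index `d`,
and `∞` (that is `⊤`, the infimum of the empty set) if `L` is not self-similar. -/
def selfSimilarityIndex (p : ℕ) [Fact p.Prime] (L : Type*) [LieRing L] [LieAlgebra ℤ_[p] L] :
    ℕ∞ :=
  sInf {n : ℕ∞ | ∃ d : ℕ, IsSelfSimilarOfIndex p L d ∧ (d : ℕ∞) = n}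

/-! ### The lattices under consideration -/

/-- `L` is a 3-dimensional unsolvable `ℤ_[p]`-Lie lattice such that `L ⊗ ℚ_p` is isomorphic to
`sl₂(ℚ_p)` as a Lie algebra over `ℚ_p`. -/
structure IsUnsolvableSl2Lattice (p : ℕ) [Fact p.Prime] (L : Type*) [LieRing L]
    [LieAlgebra ℤ_[p] L] : Prop where
  free : Module.Free ℤ_[p] L
  finrank_eq : Module.finrank ℤ_[p] L = 3
  unsolvable : ¬ LieAlgebra.IsSolvable L
  tensor_equiv : Nonempty
    ((ℚ_[p] ⊗[ℤ_[p]] L) ≃ₗ⁅ℚ_[p]⁆ LieAlgebra.SpecialLinear.sl (Fin 2) ℚ_[p])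

/-- The Lie lattice `R³` associated with the matrix `diag(a₀, a₁, a₂)`. On the canonical basis
`x₀, x₁, x₂` the bracket is `[x₁, x₂] = a₀ x₀`, `[x₂, x₀] = a₁ x₁`, `[x₀, x₁] = a₂ x₂`. -/
def DiagLie {R : Type*} (_a : Fin 3 → R) : Type _ := Fin 3 → R

namespace DiagLie

variable {R : Type*} [CommRing R] (a : Fin 3 → R)

instance : AddCommGroup (DiagLie a) := inferInstanceAs (AddCommGroup (Fin 3 → R))

instance : Module R (DiagLie a) := inferInstanceAs (Module R (Fin 3 → R))

/-- The bracket is the cross product of coordinate vectors, scaled coordinatewise by `a`. -/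
def bracket (x y : Fin 3 → R) : Fin 3 → R := fun i => a i * (x ⨯₃ y) i

theorem bracket_eq (x y : Fin 3 → R) :
    bracket a x y = ![a 0 * (x 1 * y 2 - x 2 * y 1), a 1 * (x 2 * y 0 - x 0 * y 2),
      a 2 * (x 0 * y 1 - x 1 * y 0)] := by
  funext i
  fin_cases i <;> simp [bracket, cross_apply]

theorem bracket_add_left (x y z : Fin 3 → R) :
    bracket a (x + y) z = bracket a x z + bracket a y z := by
  funext i
  fin_cases i <;> simp [bracket_eq] <;> ring

theorem bracket_add_right (x y z : Fin 3 → R) :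
    bracket a x (y + z) = bracket a x y + bracket a x z := by
  funext i
  fin_cases i <;> simp [bracket_eq] <;> ring

theorem bracket_self (x : Fin 3 → R) : bracket a x x = 0 := by
  funext i
  fin_cases i <;> simp [bracket_eq] <;> ring

theorem bracket_jacobi (x y z : Fin 3 → R) :
    bracket a x (bracket a y z) =
      bracket a (bracket a x y) z + bracket a y (bracket a x z) := by
  funext i
  fin_cases i <;> simp [bracket_eq] <;> ring

theorem bracket_smul (t : R) (x y : Fin 3 → R) :
    bracket a x (t • y) = t • bracket a x y := by
  funext i
  fin_cases i <;> simp [bracket_eq] <;> ring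

instance : LieRing (DiagLie a) where
  bracket := bracket a
  add_lie := bracket_add_left a
  lie_add := bracket_add_right a
  lie_self := bracket_self a
  leibniz_lie := bracket_jacobi a

instance : LieAlgebra R (DiagLie a) where
  lie_smul := bracket_smul a

end DiagLie

/-! ### The table -/

/-- The nine lines of the table with their parameters; `ε₁, ε₂ ∈ {0, 1}`. -/
inductive TableEntry : Type
  | line1 (s₀ : ℕ)
  | line2 (s₀ s₁ : ℕ)
  | line3 (s₀ s₁ : ℕ)
  | line4 (s₀ s₂ : ℕ)
  | line5 (s₀ s₂ : ℕ)
  | line6 (s₀ s₁ s₂ : ℕ) (ε₁ ε₂ : Fin 2)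
  | line7 (s₀ s₁ s₂ : ℕ) (ε₁ ε₂ : Fin 2)
  | line8 (s₀ s₁ s₂ : ℕ) (ε₁ ε₂ : Fin 2)
  | line9 (s₀ s₁ s₂ : ℕ) (ε₁ ε₂ : Fin 2)

namespace TableEntry

/-- The conditions on the parameters of each line, where `δ_p = (p - 1) / 2`. -/
def Valid (p : ℕ) : TableEntry → Prop
  | line1 _ => True
  | line2 s₀ s₁ => s₀ < s₁
  | line3 s₀ s₁ => s₀ < s₁ ∧ s₀ ≡ s₁ [MOD 2]
  | line4 s₀ s₂ => s₀ < s₂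
  | line5 s₀ s₂ => s₀ < s₂ ∧ s₀ ≡ s₂ [MOD 2]
  | line6 s₀ s₁ s₂ _ _ => s₀ < s₁ ∧ s₁ < s₂ ∧ s₀ ≡ s₁ [MOD 2] ∧ s₁ ≡ s₂ [MOD 2]
  | line7 s₀ s₁ s₂ ε₁ _ => s₀ < s₁ ∧ s₁ < s₂ ∧ s₀ ≡ s₁ [MOD 2] ∧ ¬ s₁ ≡ s₂ [MOD 2] ∧
      ε₁.val + (p - 1) / 2 ≡ 0 [MOD 2]
  | line8 s₀ s₁ s₂ ε₁ ε₂ => s₀ < s₁ ∧ s₁ < s₂ ∧ s₁ ≡ s₂ [MOD 2] ∧ ¬ s₂ ≡ s₀ [MOD 2] ∧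
      ε₁.val + ε₂.val + (p - 1) / 2 ≡ 0 [MOD 2]
  | line9 s₀ s₁ s₂ _ ε₂ => s₀ < s₁ ∧ s₁ < s₂ ∧ s₀ ≡ s₂ [MOD 2] ∧ ¬ s₂ ≡ s₁ [MOD 2] ∧
      ε₂.val + (p - 1) / 2 ≡ 0 [MOD 2]

/-- The diagonal entries of the matrix of the canonical presentation. -/
def diag {p : ℕ} [Fact p.Prime] (ρ : ℤ_[p]) : TableEntry → Fin 3 → ℤ_[p]
  | line1 s₀ => ![p ^ s₀, p ^ s₀, p ^ s₀]
  | line2 s₀ s₁ => ![p ^ s₀, p ^ s₁, -p ^ s₁]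
  | line3 s₀ s₁ => ![p ^ s₀, p ^ s₁, -ρ * p ^ s₁]
  | line4 s₀ s₂ => ![p ^ s₀, -p ^ s₀, p ^ s₂]
  | line5 s₀ s₂ => ![p ^ s₀, -ρ * p ^ s₀, p ^ s₂]
  | line6 s₀ s₁ s₂ ε₁ ε₂ => ![p ^ s₀, ρ ^ ε₁.val * p ^ s₁, ρ ^ ε₂.val * p ^ s₂]
  | line7 s₀ s₁ s₂ ε₁ ε₂ => ![p ^ s₀, ρ ^ ε₁.val * p ^ s₁, ρ ^ ε₂.val * p ^ s₂]
  | line8 s₀ s₁ s₂ ε₁ ε₂ => ![p ^ s₀, ρ ^ ε₁.val * p ^ s₁, ρ ^ ε₂.val * p ^ s₂]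
  | line9 s₀ s₁ s₂ ε₁ ε₂ => ![p ^ s₀, ρ ^ ε₁.val * p ^ s₁, ρ ^ ε₂.val * p ^ s₂]

/-- The Lie lattice presented by an entry of the table. -/
abbrev Lattice {p : ℕ} [Fact p.Prime] (ρ : ℤ_[p]) (t : TableEntry) : Type :=
  DiagLie (t.diag ρ)

/-- The value of, or the estimate for, the self-similarity index `σ` given by each line.
For parameters satisfying `Valid` all the differences and halves are exact. -/
def Estimate (p : ℕ) (σ : ℕ∞) : TableEntry → Prop
  | line1 _ => σ = p
  | line2 _ _ => σ = p
  | line3 s₀ s₁ => (p : ℕ∞) ^ 2 ≤ σ ∧ σ ≤ (p : ℕ∞) ^ (s₁ - s₀ + 1)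
  | line4 _ _ => σ = p
  | line5 s₀ s₂ => (p : ℕ∞) ^ 2 ≤ σ ∧ σ ≤ (p : ℕ∞) ^ ((s₂ - s₀) / 2 + 1)
  | line6 s₀ s₁ s₂ _ _ =>
      (p : ℕ∞) ^ 2 ≤ σ ∧ σ ≤ (p : ℕ∞) ^ ((s₁ - s₀) / 2 + (s₂ - s₀) / 2 + 1)
  | line7 s₀ s₁ _ _ _ => (p : ℕ∞) ^ 2 ≤ σ ∧ σ ≤ (p : ℕ∞) ^ ((s₁ - s₀) / 2 + 1)
  | line8 _ s₁ s₂ _ _ => (p : ℕ∞) ^ 2 ≤ σ ∧ σ ≤ (p : ℕ∞) ^ ((s₂ - s₁) / 2 + 1)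
  | line9 s₀ _ s₂ _ _ => (p : ℕ∞) ^ 2 ≤ σ ∧ σ ≤ (p : ℕ∞) ^ ((s₂ - s₀) / 2 + 1)

end TableEntry

end

/-! ### Units, squares and binary forms over `ℤ_[p]`. -/

namespace PadicInt

variable {p : ℕ} [Fact p.Prime]

/-! Classification. The trace form of sl₂ pulls back to a nondegenerate invariant symmetric form on
L. As p is odd it has an orthogonal basis over `ℤ_[p]`, and invariance makes the bracket diagonal in
that basis (`IsUnsolvableSl2Lattice.exists_diagLie`). A matrix U is a morphism of diagonal lattices
exactly when U·diag(a) = diag(b)·cof(U); in particular similar forms give isomorphic lattices. The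
Jordan decomposition of diag(a), up to similarity, then leads to the shapes of the table
(`DiagLie.exists_normalForm`). The rational form is sl₂ precisely when the form with coefficients a
is isotropic over `ℚ_[p]` (`DiagLie.isUnsolvableSl2Lattice_iff`), and this gives the conditions on
parities and square classes. Reducing an isomorphism modulo p recovers the exponents and the square
classes, hence uniqueness (`TableEntry.eq_of_equiv`).

Upper bounds. In a hyperbolic lattice (c, d, -d) put v = x₁ - x₂ and w = x₁ + x₂. On the sublattice
of index p where v is replaced by pv, the map pv ↦ v, w ↦ pw, x₀ ↦ x₀ is a morphism. A nonzero ideal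
contains some pⁿv, so an invariant one would contain v, which is outside the domain: the
endomorphism is simple. Every lattice of the table contains a hyperbolic sublattice spanned by
vectors p^mᵢ xᵢ, and composing the inclusions multiplies the indices
(`DiagLie.exists_isSelfSimilarOfIndex_le`).

Lower bounds. The index of a simple virtual endomorphism is a power of p other than 1. Suppose φ has
index p. Then W = pφ is an integral matrix, of rank at most 1 modulo p, and if it is nonzero then φ
= W/p preserves the diagonal form. Where the table claims p², these facts and the anisotropy of a
suitable binary subform show that φ, extended rationally, preserves the lattice spanned by p^mᵢ xᵢ
with mᵢ = ⌊(sᵢ - s₀)/2⌋ (`DiagLie.pow_dvd_entries`). Its multiple by p is a nonzero invariant ideal,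
so φ is not simple (`DiagLie.not_isSimple_of_pow_dvd`). -/

theorem toZMod_eq_zero_iff (x : ℤ_[p]) : toZMod x = 0 ↔ (p : ℤ_[p]) ∣ x := by
  rw [← RingHom.mem_ker, ker_toZMod, maximalIdeal_eq_span_p, Ideal.mem_span_singleton]

theorem isUnit_iff_toZMod_ne_zero (x : ℤ_[p]) : IsUnit x ↔ toZMod x ≠ 0 := by
  rw [Ne, ← RingHom.mem_ker, ker_toZMod, IsLocalRing.mem_maximalIdeal, mem_nonunits_iff, not_not]

theorem toZMod_surjective : Function.Surjective (toZMod : ℤ_[p] →+* ZMod p) :=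
  ZMod.ringHom_surjective _

theorem p_ne_zero : (p : ℤ_[p]) ≠ 0 := Nat.cast_ne_zero.2 (Fact.out : p.Prime).ne_zero

theorem two_toZMod_ne_zero (hp : 3 ≤ p) : (2 : ZMod p) ≠ 0 := by
  have h : ((2 : ℕ) : ZMod p) ≠ 0 := by
    rw [Ne, ZMod.natCast_eq_zero_iff]
    intro h
    have := Nat.le_of_dvd (by norm_num) h
    omega
  exact_mod_cast h

theorem isUnit_two (hp : 3 ≤ p) : IsUnit (2 : ℤ_[p]) := by
  rw [isUnit_iff_toZMod_ne_zero, map_ofNat]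
  exact two_toZMod_ne_zero hp

/-- A unit whose residue is the square of `y` is the square of a lift of `y`. -/
theorem exists_sq_eq (hp : 3 ≤ p) {u : ℤ_[p]} (hu : IsUnit u) {y : ZMod p}
    (hy : y ^ 2 = toZMod u) : ∃ v : ℤ_[p], v ^ 2 = u ∧ toZMod v = y := by
  obtain ⟨a, rfl⟩ := toZMod_surjective y
  have hu0 := (isUnit_iff_toZMod_ne_zero u).1 hu
  have ha0 : toZMod a ≠ 0 := by
    intro h
    rw [h] at hy
    exact hu0 (by rw [← hy]; ring)
  have ha : IsUnit (2 * a) := (isUnit_two hp).mul ((isUnit_iff_toZMod_ne_zero a).2 ha0)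
  have hd : (Polynomial.X ^ 2 - Polynomial.C u : Polynomial ℤ_[p]).derivative.aeval a = 2 * a := by
    simp [one_add_one_eq_two]
  have hn : ‖(Polynomial.X ^ 2 - Polynomial.C u : Polynomial ℤ_[p]).aeval a‖ <
      ‖(Polynomial.X ^ 2 - Polynomial.C u : Polynomial ℤ_[p]).derivative.aeval a‖ ^ 2 := by
    rw [hd, isUnit_iff.1 ha, one_pow]
    have : toZMod (a ^ 2 - u) = 0 := by simp [hy]
    rw [toZMod_eq_zero_iff, ← norm_lt_one_iff_dvd] at this
    simpa using this
  obtain ⟨z, hz, hza, -, -⟩ := hensels_lemma hn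
  refine ⟨z, ?_, ?_⟩
  · simpa [sub_eq_zero] using hz
  · rw [hd, isUnit_iff.1 ha, norm_lt_one_iff_dvd, ← toZMod_eq_zero_iff, map_sub, sub_eq_zero] at hza
    exact hza

theorem exists_sq_eq_of_isSquare (hp : 3 ≤ p) {u : ℤ_[p]} (hu : IsUnit u)
    (h : IsSquare (toZMod u)) : ∃ v : ℤ_[p], IsUnit v ∧ u = v ^ 2 := by
  obtain ⟨y, hy⟩ := h
  obtain ⟨v, hv, -⟩ := exists_sq_eq hp hu (y := y) (by rw [hy, sq])
  refine ⟨v, ?_, hv.symm⟩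
  rw [← hv] at hu
  exact (isUnit_pow_iff two_ne_zero).1 hu

theorem _root_.ZMod.isSquare_mul_of_not_isSquare {a b : ZMod p} (ha : ¬ IsSquare a)
    (hb : ¬ IsSquare b) : IsSquare (a * b) := by
  have hp2 : ringChar (ZMod p) ≠ 2 := by
    intro h
    exact ha (FiniteField.isSquare_of_char_two h a)
  have ha0 : a ≠ 0 := by rintro rfl; exact ha (IsSquare.zero)
  have hb0 : b ≠ 0 := by rintro rfl; exact hb (IsSquare.zero)
  rw [← quadraticChar_one_iff_isSquare (mul_ne_zero ha0 hb0), map_mul,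
    quadraticChar_neg_one_iff_not_isSquare.2 ha, quadraticChar_neg_one_iff_not_isSquare.2 hb]
  norm_num

/-- The unit square classes of `ℤ_[p]`. -/
theorem exists_eq_pow_mul_sq (hp : 3 ≤ p) {ρ : ℤ_[p]} (hρu : IsUnit ρ)
    (hρ : ¬ IsSquare (toZMod ρ)) {u : ℤ_[p]} (hu : IsUnit u) :
    ∃ (ε : Fin 2) (v : ℤ_[p]), IsUnit v ∧ v ^ 2 * u = ρ ^ ε.val := by
  by_cases h : IsSquare (toZMod u)
  · obtain ⟨v, hv, rfl⟩ := exists_sq_eq_of_isSquare hp hu h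
    obtain ⟨w, rfl⟩ := hv
    refine ⟨0, ↑w⁻¹, Units.isUnit _, ?_⟩
    simp [← mul_pow]
  · obtain ⟨v, hv, e⟩ := exists_sq_eq_of_isSquare hp (hρu.mul hu)
      (by rw [map_mul]; exact ZMod.isSquare_mul_of_not_isSquare hρ h)
    obtain ⟨w, rfl⟩ := hv
    obtain ⟨r, rfl⟩ := hρu
    -- Two nonsquare classes multiply to a square, so ρu = w², and (ρ/w)²u = ρ.
    refine ⟨1, ↑w⁻¹ * ↑r, ((Units.isUnit _).mul (Units.isUnit _)), ?_⟩
    have : (↑w⁻¹ * ↑r : ℤ_[p]) ^ 2 * u = ↑w⁻¹ ^ 2 * ↑r * (↑r * u) := by ring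
    rw [this, e]
    have h1 : (↑w⁻¹ : ℤ_[p]) * ↑w = 1 := w.inv_mul
    calc (↑w⁻¹ : ℤ_[p]) ^ 2 * ↑r * ↑w ^ 2 = (↑w⁻¹ * ↑w) ^ 2 * ↑r := by ring
      _ = _ := by rw [h1]; simp

/-- A binary form with unit coefficients represents every unit. -/
theorem exists_binary_eq (hp : 3 ≤ p) {α β γ : ℤ_[p]} (hα : IsUnit α) (hβ : IsUnit β)
    (hγ : IsUnit γ) : ∃ x y : ℤ_[p], α * x ^ 2 + β * y ^ 2 = γ := by
  have hα0 := (isUnit_iff_toZMod_ne_zero α).1 hα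
  have hβ0 := (isUnit_iff_toZMod_ne_zero β).1 hβ
  have hγ0 := (isUnit_iff_toZMod_ne_zero γ).1 hγ
  have hodd : Fintype.card (ZMod p) % 2 = 1 := by
    rw [ZMod.card]
    rcases (Fact.out : p.Prime).eq_two_or_odd with h | h <;> omega
  obtain ⟨x, y, hxy⟩ := FiniteField.exists_root_sum_quadratic
    (f := Polynomial.C (toZMod α) * Polynomial.X ^ 2)
    (g := Polynomial.C (toZMod β) * Polynomial.X ^ 2 - Polynomial.C (toZMod γ))
    (Polynomial.degree_C_mul_X_pow 2 hα0)
    (by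
      rw [Polynomial.degree_sub_C]
      · exact Polynomial.degree_C_mul_X_pow 2 hβ0
      · rw [Polynomial.degree_C_mul_X_pow 2 hβ0]; norm_num) hodd
  simp only [Polynomial.eval_mul, Polynomial.eval_C, Polynomial.eval_pow, Polynomial.eval_X,
    Polynomial.eval_sub] at hxy
  -- A solution modulo p with a nonzero coordinate lifts: freeze a lift of the other coordinate and
  -- apply Hensel to this one. Since γ is a unit, the two residues cannot both vanish.
  have key : ∀ {α β : ℤ_[p]} {x y : ZMod p}, IsUnit α → x ≠ 0 →
      toZMod α * x ^ 2 + toZMod β * y ^ 2 = toZMod γ →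
      ∃ x y : ℤ_[p], α * x ^ 2 + β * y ^ 2 = γ := by
    intro α β x y hα hx h
    obtain ⟨b, rfl⟩ := toZMod_surjective y
    obtain ⟨a, rfl⟩ := hα
    have hi : toZMod (↑a⁻¹ : ℤ_[p]) * toZMod (↑a : ℤ_[p]) = 1 := by rw [← map_mul]; simp
    have hx2 : x ^ 2 = toZMod ((↑a⁻¹ : ℤ_[p]) * (γ - β * b ^ 2)) := by
      simp only [map_mul, map_sub, map_pow, ← h]
      linear_combination -x ^ 2 * hi
    obtain ⟨v, hv, -⟩ := exists_sq_eq hp ((isUnit_iff_toZMod_ne_zero _).2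
      (hx2 ▸ pow_ne_zero 2 hx)) hx2
    refine ⟨v, b, ?_⟩
    rw [hv]
    simp [← mul_assoc]
  by_cases hx : x = 0
  · have hy : y ≠ 0 := by
      rintro rfl
      rw [hx] at hxy
      apply hγ0
      linear_combination -hxy
    obtain ⟨y', x', h⟩ := key (β := α) (y := x) hβ hy (by linear_combination hxy)
    exact ⟨x', y', by linear_combination h⟩
  · exact key (β := β) (y := y) hα hx (by linear_combination hxy)

theorem coe_unit_norm {α : ℤ_[p]} (hα : IsUnit α) : ‖(α : ℚ_[p])‖ = 1 := by
  rw [← norm_def]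
  exact isUnit_iff.1 hα

theorem coe_unit_ne_zero {α : ℤ_[p]} (hα : IsUnit α) : (α : ℚ_[p]) ≠ 0 := by
  intro h
  have := coe_unit_norm hα
  rw [h, norm_zero] at this
  exact zero_ne_one this

theorem coe_p_ne_zero : (p : ℚ_[p]) ≠ 0 := Nat.cast_ne_zero.2 (Fact.out : p.Prime).ne_zero

end PadicInt

/-! ### Anisotropic binary forms and squares in `ℚ_[p]`. -/

namespace Padic

variable {p : ℕ} [Fact p.Prime]

open PadicInt

/-- Without cancellation, the norm of a sum of two squares with coefficients is a maximum. -/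
theorem norm_binary_eq_max (hp : 3 ≤ p) {a b : ℚ_[p]} (ha : a ≠ 0) (hb : b ≠ 0)
    (hab : ¬ IsSquare (-(a * b))) (x y : ℚ_[p]) :
    ‖a * x ^ 2 + b * y ^ 2‖ = max ‖a * x ^ 2‖ ‖b * y ^ 2‖ := by
  by_cases hne : ‖a * x ^ 2‖ = ‖b * y ^ 2‖
  swap
  · exact Padic.add_eq_max_of_ne hne
  by_cases hy : y = 0
  · simp only [hy, ne_eq, OfNat.ofNat_ne_zero, not_false_eq_true, zero_pow, mul_zero, add_zero,
      norm_zero]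
    exact (max_eq_left (norm_nonneg _)).symm
  have hby : b * y ^ 2 ≠ 0 := mul_ne_zero hb (pow_ne_zero 2 hy)
  refine le_antisymm (Padic.nonarchimedean _ _) (not_lt.1 fun hlt => hab ?_)
  rw [hne, max_self] at hlt
  -- Cancellation between terms of equal norm means that u ≡ 1 modulo p; then u is a square, and so
  -- is -ab.
  set u : ℚ_[p] := -(a * x ^ 2) / (b * y ^ 2) with hu
  have hu1 : ‖u‖ = 1 := by
    rw [hu, norm_div, norm_neg, hne, div_self (norm_ne_zero_iff.2 hby)]
  have hu2 : ‖u - 1‖ < 1 := by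
    have : u - 1 = -(a * x ^ 2 + b * y ^ 2) / (b * y ^ 2) := by rw [hu]; field_simp; ring
    rw [this, norm_div, norm_neg, div_lt_one (norm_pos_iff.2 hby)]
    exact hlt
  let U : ℤ_[p] := ⟨u, hu1.le⟩
  have hU : IsUnit U := PadicInt.isUnit_iff.2 hu1
  have hU1 : toZMod U = 1 := by
    have : ‖U - 1‖ < 1 := hu2
    rw [norm_lt_one_iff_dvd, ← toZMod_eq_zero_iff, map_sub, map_one, sub_eq_zero] at this
    exact this
  obtain ⟨v, hv, hUv⟩ := exists_sq_eq_of_isSquare hp hU (by rw [hU1]; exact IsSquare.one)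
  have huv : u = (v : ℚ_[p]) ^ 2 := by
    have := congrArg (fun z : ℤ_[p] => (z : ℚ_[p])) hUv
    simpa using this
  have hx : x ≠ 0 := by
    rintro rfl
    apply norm_ne_zero_iff.2 hby
    rw [← hne]; simp
  refine ⟨b * y * v / x, ?_⟩
  have h2 : -(a * x ^ 2) = v ^ 2 * (b * y ^ 2) := by
    rw [← huv, hu]; field_simp
  rw [div_mul_div_comm, eq_div_iff (mul_ne_zero hx hx)]
  linear_combination b * h2

theorem not_isSquare_pow_mul_of_odd {α : ℤ_[p]} (hα : IsUnit α) {n : ℕ} (hn : n % 2 = 1) :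
    ¬ IsSquare ((p : ℚ_[p]) ^ n * α) := by
  rintro ⟨r, hr⟩
  have h := congrArg Padic.valuation hr
  have hr0 : r ≠ 0 := by
    rintro rfl
    simp at hr
    rcases hr with h | h
    · exact (Fact.out : p.Prime).ne_zero h.1
    · rw [h] at hα; simp at hα
  have hα0 : (α : ℚ_[p]).valuation = 0 := by
    have := coe_unit_norm hα
    rw [Padic.norm_eq_zpow_neg_valuation (coe_unit_ne_zero hα)] at this
    have hp1 : (1 : ℝ) < p := by exact_mod_cast (Fact.out : p.Prime).one_lt
    have h3 := (zpow_eq_one_iff_right₀ (by positivity) hp1.ne').1 this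
    omega
  rw [Padic.valuation_mul (pow_ne_zero _ coe_p_ne_zero) (coe_unit_ne_zero hα),
    Padic.valuation_pow, Padic.valuation_p, Padic.valuation_mul hr0 hr0, hα0] at h
  omega

theorem isSquare_pow_mul_iff_of_even (hp : 3 ≤ p) {α : ℤ_[p]} (hα : IsUnit α) {n : ℕ}
    (hn : n % 2 = 0) : IsSquare ((p : ℚ_[p]) ^ n * α) ↔ IsSquare (toZMod α) := by
  obtain ⟨m, rfl⟩ : ∃ m, n = 2 * m := ⟨n / 2, by omega⟩
  have hpm : (p : ℚ_[p]) ^ m ≠ 0 := pow_ne_zero _ coe_p_ne_zero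
  constructor
  · rintro ⟨r, hr⟩
    have hs : (α : ℚ_[p]) = (r / p ^ m) ^ 2 := by
      field_simp
      linear_combination hr
    have hn : ‖r / (p : ℚ_[p]) ^ m‖ ≤ 1 := by
      have := coe_unit_norm hα
      rw [hs, norm_pow] at this
      exact ((pow_eq_one_iff_of_nonneg (norm_nonneg _) two_ne_zero).1 this).le
    obtain ⟨z, hz⟩ : ∃ z : ℤ_[p], (z : ℚ_[p]) = r / (p : ℚ_[p]) ^ m := ⟨⟨_, hn⟩, rfl⟩
    refine ⟨toZMod z, ?_⟩
    rw [← map_mul]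
    congr 1
    apply PadicInt.ext
    rw [hs, ← hz, PadicInt.coe_mul, sq]
  · intro h
    obtain ⟨v, -, rfl⟩ := exists_sq_eq_of_isSquare hp hα h
    exact ⟨p ^ m * v, by push_cast; ring⟩

theorem isSquare_pow_mul_iff (hp : 3 ≤ p) {α : ℤ_[p]} (hα : IsUnit α) {n : ℕ} :
    IsSquare ((p : ℚ_[p]) ^ n * α) ↔ n % 2 = 0 ∧ IsSquare (toZMod α) := by
  rcases Nat.mod_two_eq_zero_or_one n with h | h
  · simp [h, isSquare_pow_mul_iff_of_even hp hα h]
  · simp [h, not_isSquare_pow_mul_of_odd hα h]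

end Padic

/-- `-ρ ^ ε` is a square modulo `p` if and only if `ε + (p - 1) / 2` is even. -/
theorem isSquare_neg_pow_iff {p : ℕ} [Fact p.Prime] (hp : 3 ≤ p) {r : ZMod p}
    (hr : ¬ IsSquare r) (n : ℕ) : IsSquare (-r ^ n) ↔ (n + (p - 1) / 2) % 2 = 0 := by
  have hp2 : ringChar (ZMod p) ≠ 2 := by rw [ZMod.ringChar_zmod_n]; omega
  have hr0 : r ≠ 0 := by rintro rfl; exact hr IsSquare.zero
  have h0 : -r ^ n ≠ 0 := neg_ne_zero.2 (pow_ne_zero _ hr0)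
  have hodd : p % 2 = 1 := by
    rcases (Fact.out : p.Prime).eq_two_or_odd with h | h <;> omega
  rw [← quadraticChar_one_iff_isSquare h0, neg_eq_neg_one_mul, map_mul, map_pow,
    quadraticChar_neg_one_iff_not_isSquare.2 hr, quadraticChar_neg_one hp2, ZMod.card,
    ZMod.χ₄_eq_neg_one_pow hodd, ← pow_add, show p / 2 = (p - 1) / 2 by omega,
    neg_one_pow_eq_one_iff_even (by norm_num), Nat.even_iff, add_comm]

/-! ### Morphisms of diagonal lattices and similarity of forms. -/

namespace DiagLie

section Ring

variable {R : Type*} [CommRing R]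

theorem mulVec_cross_mulVec (U : Matrix (Fin 3) (Fin 3) R) (x y : Fin 3 → R) :
    (U *ᵥ x) ⨯₃ (U *ᵥ y) = U.adjugateᵀ *ᵥ (x ⨯₃ y) := by
  rw [Matrix.adjugate_fin_three]
  funext i
  fin_cases i <;>
  · simp [cross_apply, Matrix.mulVec, dotProduct, Fin.sum_univ_three]
    ring

/-- The cross product transforms by the cofactor matrix, so `h`, which reads U·diag(a) =
diag(b)·cof(U), is what compatibility with the brackets amounts to. -/
theorem mulVec_bracket (a b : Fin 3 → R) (U : Matrix (Fin 3) (Fin 3) R)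
    (h : ∀ i j, U i j * a j = b i * U.adjugate j i) (x y : Fin 3 → R) :
    U *ᵥ (bracket a x y) = bracket b (U *ᵥ x) (U *ᵥ y) := by
  funext i
  simp only [bracket, mulVec_cross_mulVec]
  simp only [Matrix.mulVec, dotProduct, Matrix.transpose_apply, Finset.mul_sum]
  refine Finset.sum_congr rfl fun j _ => ?_
  have e : bracket a x y j = a j * (x ⨯₃ y) j := rfl
  rw [e]
  linear_combination (x ⨯₃ y) j * h i j

/-- The homomorphism given by a matrix `U` such that `U · diag a = diag b · cof U`. -/
def homOfMatrix (a b : Fin 3 → R) (U : Matrix (Fin 3) (Fin 3) R)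
    (h : ∀ i j, U i j * a j = b i * U.adjugate j i) : DiagLie a →ₗ⁅R⁆ DiagLie b :=
  { (Matrix.mulVecLin U : (Fin 3 → R) →ₗ[R] (Fin 3 → R)) with
    map_lie' := by
      exact mulVec_bracket a b U h _ _ }

theorem homOfMatrix_apply (a b : Fin 3 → R) (U : Matrix (Fin 3) (Fin 3) R)
    (h : ∀ i j, U i j * a j = b i * U.adjugate j i) (x : DiagLie a) :
    homOfMatrix a b U h x = U *ᵥ (x : Fin 3 → R) := rfl

theorem homOfMatrix_bijective (a b : Fin 3 → R) (U : Matrix (Fin 3) (Fin 3) R)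
    (h : ∀ i j, U i j * a j = b i * U.adjugate j i) (hU : IsUnit U.det) :
    Function.Bijective (homOfMatrix a b U h) := by
  have hU' : IsUnit U := (Matrix.isUnit_iff_isUnit_det U).2 hU
  exact ⟨Matrix.mulVec_injective_of_isUnit hU', Matrix.mulVec_surjective_iff_isUnit.2 hU'⟩

theorem nonempty_equiv_of_matrix (a b : Fin 3 → R) (U : Matrix (Fin 3) (Fin 3) R)
    (h : ∀ i j, U i j * a j = b i * U.adjugate j i) (hU : IsUnit U.det) :
    Nonempty (DiagLie a ≃ₗ⁅R⁆ DiagLie b) :=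
  ⟨LieEquiv.ofBijective _ (homOfMatrix_bijective a b U h hU)⟩

/-- Similar diagonal forms give isomorphic Lie lattices. -/
theorem nonempty_equiv_of_similar (a b : Fin 3 → R) (P : Matrix (Fin 3) (Fin 3) R)
    (hP : IsUnit P.det) (c : R) (hc : IsUnit c)
    (h : ∀ i j, ∑ k, P i k * a k * P j k = if i = j then c * b i else 0) :
    Nonempty (DiagLie a ≃ₗ⁅R⁆ DiagLie b) := by
  obtain ⟨d, hd⟩ := hP
  replace h : P * Matrix.diagonal a * Pᵀ = c • Matrix.diagonal b := by
    ext i j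
    rw [Matrix.mul_apply]
    simp only [Matrix.mul_diagonal, Matrix.transpose_apply, h, Matrix.smul_apply,
      Matrix.diagonal_apply, smul_eq_mul, mul_ite, mul_zero]
  -- Multiplying P·diag(a)·Pᵀ = c·diag(b) on the right by the cofactor matrix replaces Pᵀ by det P,
  -- and the quadratic relation becomes a cofactor relation.
  have h1 : ∀ i j, P.det * (P i j * a j) = c * (b i * P.adjugate j i) := by
    have h2 : P * Matrix.diagonal a * (Pᵀ * P.adjugateᵀ) =
        c • (Matrix.diagonal b * P.adjugateᵀ) := by
      rw [← mul_assoc, h, Matrix.smul_mul]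
    rw [← Matrix.transpose_mul, Matrix.adjugate_mul, Matrix.transpose_smul, Matrix.transpose_one,
      Matrix.mul_smul, mul_one] at h2
    intro i j
    have := congrFun (congrFun h2 i) j
    simpa [Matrix.mul_diagonal, Matrix.diagonal_mul] using this
  have hdi : (↑d⁻¹ : R) * P.det = 1 := by rw [← hd]; simp
  -- Scaling P by λ scales its cofactors by λ², so λ = c / det P absorbs both constants.
  refine nonempty_equiv_of_matrix a b ((c * ↑d⁻¹) • P) (fun i j => ?_) ?_
  · rw [Matrix.adjugate_smul]
    simp only [Matrix.smul_apply, smul_eq_mul, Fintype.card_fin, Nat.add_one_sub_one]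
    linear_combination c * ↑d⁻¹ ^ 2 * h1 i j - c * ↑d⁻¹ * P i j * a j * hdi
  · rw [Matrix.det_smul, ← hd]
    exact ((hc.mul (Units.isUnit _)).pow _).mul d.isUnit

theorem nonempty_equiv_trans {a b c : Fin 3 → R} (h : Nonempty (DiagLie a ≃ₗ⁅R⁆ DiagLie b))
    (h' : Nonempty (DiagLie b ≃ₗ⁅R⁆ DiagLie c)) : Nonempty (DiagLie a ≃ₗ⁅R⁆ DiagLie c) :=
  ⟨h.some.trans h'.some⟩

theorem nonempty_equiv_symm {a b : Fin 3 → R} (h : Nonempty (DiagLie a ≃ₗ⁅R⁆ DiagLie b)) :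
    Nonempty (DiagLie b ≃ₗ⁅R⁆ DiagLie a) :=
  ⟨h.some.symm⟩

theorem nonempty_equiv_scale (a : Fin 3 → R) {c v₀ v₁ v₂ : R} (hc : IsUnit c) (h₀ : IsUnit v₀)
    (h₁ : IsUnit v₁) (h₂ : IsUnit v₂) :
    Nonempty (DiagLie a ≃ₗ⁅R⁆
      DiagLie ![c * v₀ ^ 2 * a 0, c * v₁ ^ 2 * a 1, c * v₂ ^ 2 * a 2]) := by
  obtain ⟨d, rfl⟩ := hc
  refine nonempty_equiv_of_similar _ _ (Matrix.diagonal ![v₀, v₁, v₂]) ?_ (↑d⁻¹ : R)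
    (Units.isUnit _) ?_
  · rw [Matrix.det_diagonal, Fin.prod_univ_three]
    exact (h₀.mul h₁).mul h₂
  · intro i j
    fin_cases i <;> fin_cases j <;> simp [Fin.sum_univ_three, mul_assoc] <;> ring

theorem nonempty_equiv_rotate (a₀ a₁ a₂ : R) :
    Nonempty (DiagLie ![a₀, a₁, a₂] ≃ₗ⁅R⁆ DiagLie ![a₁, a₂, a₀]) := by
  refine nonempty_equiv_of_similar _ _ !![0, 1, 0; 0, 0, 1; 1, 0, 0] ?_ 1 isUnit_one ?_
  · simp [Matrix.det_fin_three]
  · intro i j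
    fin_cases i <;> fin_cases j <;> simp [Fin.sum_univ_three]

/-- A binary form representing `1` is diagonalised with first coefficient `1`. -/
theorem nonempty_equiv_plane (a q : R) {α β x y : R} (h : α * x ^ 2 + β * y ^ 2 = 1) :
    Nonempty (DiagLie ![a, q * α, q * β] ≃ₗ⁅R⁆ DiagLie ![a, q, q * (α * β)]) := by
  -- The last row is orthogonal to (x, y) for the form (α, β) and takes the value αβ·1 there; the
  -- determinant is the value at (x, y), namely 1.
  refine nonempty_equiv_of_similar _ _ !![1, 0, 0; 0, x, y; 0, -(β * y), α * x] ?_ 1 isUnit_one ?_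
  · rw [Matrix.det_fin_three]
    convert isUnit_one using 1
    simp
    linear_combination h
  · intro i j
    fin_cases i <;> fin_cases j <;> simp [Fin.sum_univ_three]
    · linear_combination q * h
    · ring
    · ring
    · linear_combination q * α * β * h

theorem nonempty_equiv_plane' (a q : R) {α β x y : R} (h : α * x ^ 2 + β * y ^ 2 = 1) :
    Nonempty (DiagLie ![q * α, q * β, a] ≃ₗ⁅R⁆ DiagLie ![q, q * (α * β), a]) :=
  nonempty_equiv_trans (nonempty_equiv_symm (nonempty_equiv_rotate _ _ _))
    (nonempty_equiv_trans (nonempty_equiv_plane a q h) (nonempty_equiv_rotate _ _ _))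

end Ring

/-! ### Normal forms of diagonal lattices over `ℤ_[p]`. -/

section Padic

open PadicInt

variable {p : ℕ} [Fact p.Prime]

theorem nonempty_equiv_plane_of_isUnit (hp : 3 ≤ p) (a q : ℤ_[p]) {α β : ℤ_[p]} (hα : IsUnit α)
    (hβ : IsUnit β) : Nonempty (DiagLie ![a, q * α, q * β] ≃ₗ⁅ℤ_[p]⁆ DiagLie ![a, q, q * (α * β)]) :=
  have ⟨_, _, h⟩ := exists_binary_eq hp hα hβ isUnit_one
  nonempty_equiv_plane a q h

theorem nonempty_equiv_plane_of_isUnit' (hp : 3 ≤ p) (a q : ℤ_[p]) {α β : ℤ_[p]} (hα : IsUnit α)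
    (hβ : IsUnit β) : Nonempty (DiagLie ![q * α, q * β, a] ≃ₗ⁅ℤ_[p]⁆ DiagLie ![q, q * (α * β), a]) :=
  have ⟨_, _, h⟩ := exists_binary_eq hp hα hβ isUnit_one
  nonempty_equiv_plane' a q h

/-- All homogeneous unimodular forms are similar. -/
theorem nonempty_equiv_homogeneous (hp : 3 ≤ p) (q : ℤ_[p]) {α β γ : ℤ_[p]} (hα : IsUnit α)
    (hβ : IsUnit β) (hγ : IsUnit γ) :
    Nonempty (DiagLie ![q * α, q * β, q * γ] ≃ₗ⁅ℤ_[p]⁆ DiagLie ![q, q, q]) := by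
  -- In odd rank a similarity can change the discriminant class: scaling by the discriminant d
  -- itself turns it into d⁴. The chain is (α, β, γ) → (1, d, 1) → (d, 1, d) → (1, 1, d²) → (1, 1,
  -- 1), up to rotations and the common factor q.
  obtain ⟨d, hd⟩ := hα.mul (hβ.mul hγ)
  have h1 := nonempty_equiv_plane_of_isUnit hp (q * α) q hβ hγ
  have h2 := nonempty_equiv_rotate (q * α) q (q * (β * γ))
  have h3 := nonempty_equiv_rotate q (q * (β * γ)) (q * α)
  have h4 := nonempty_equiv_plane_of_isUnit' hp q q (hβ.mul hγ) hα
  have h5 := nonempty_equiv_scale ![q, q * (β * γ * α), q] d.isUnit isUnit_one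
    (d⁻¹).isUnit isUnit_one
  have h6 := nonempty_equiv_rotate (q * ↑d) q (q * ↑d)
  have h7 := nonempty_equiv_plane_of_isUnit hp q q d.isUnit d.isUnit
  have h8 := nonempty_equiv_scale ![q, q, q * (↑d * ↑d)] isUnit_one isUnit_one isUnit_one
    (d⁻¹).isUnit
  have hdi : (↑d⁻¹ : ℤ_[p]) * ↑d = 1 := by simp
  have e5 : ![↑d * 1 ^ 2 * ![q, q * (β * γ * α), q] 0, ↑d * (↑d⁻¹ : ℤ_[p]) ^ 2 *
      ![q, q * (β * γ * α), q] 1, ↑d * 1 ^ 2 * ![q, q * (β * γ * α), q] 2] =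
      ![q * ↑d, q, q * ↑d] := by
    have : β * γ * α = ↑d := by rw [hd]; ring
    rw [this]
    funext i
    fin_cases i
    · simp [mul_comm]
    · simp
      linear_combination q * (↑d⁻¹ * ↑d + 1) * hdi
    · simp [mul_comm]
  have e8 : ![1 * 1 ^ 2 * ![q, q, q * (↑d * ↑d)] 0, 1 * 1 ^ 2 * ![q, q, q * (↑d * ↑d)] 1,
      1 * (↑d⁻¹ : ℤ_[p]) ^ 2 * ![q, q, q * (↑d * ↑d)] 2] = ![q, q, q] := by
    funext i
    fin_cases i
    · simp
    · simp
    · simp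
      linear_combination q * (↑d⁻¹ * ↑d + 1) * hdi
  rw [e5] at h5
  rw [e8] at h8
  exact nonempty_equiv_trans h1 <| nonempty_equiv_trans h2 <| nonempty_equiv_trans h3 <|
    nonempty_equiv_trans h4 <| nonempty_equiv_trans h5 <| nonempty_equiv_trans h6 <|
    nonempty_equiv_trans h7 h8

theorem nonempty_equiv_of_eq {a b : Fin 3 → ℤ_[p]} (h : a = b) :
    Nonempty (DiagLie a ≃ₗ⁅ℤ_[p]⁆ DiagLie b) := by
  subst h
  exact ⟨LieEquiv.refl⟩

/-- A plane with unit discriminant is brought to the form `(1, -1)` or `(1, -ρ)`. -/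
theorem exists_sq_mul_eq_neg (hp : 3 ≤ p) {ρ : ℤ_[p]} (hρu : IsUnit ρ)
    (hρ : ¬ IsSquare (toZMod ρ)) {u : ℤ_[p]} (hu : IsUnit u) :
    ∃ v : ℤ_[p], IsUnit v ∧ (v ^ 2 * u = -1 ∨ v ^ 2 * u = -ρ) := by
  obtain ⟨ε, v, hv, h⟩ := exists_eq_pow_mul_sq hp hρu hρ hu.neg
  refine ⟨v, hv, ?_⟩
  fin_cases ε
  · left; simp at h; rw [← h]; ring
  · right; simp at h; rw [← h]; ring

theorem nonempty_equiv_head_one (s₀ : ℕ) (b c : ℤ_[p]) {α : ℤ_[p]} (hα : IsUnit α) :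
    ∃ u : ℤ_[p], IsUnit u ∧ Nonempty (DiagLie ![(p : ℤ_[p]) ^ s₀ * α, b, c] ≃ₗ⁅ℤ_[p]⁆
      DiagLie ![(p : ℤ_[p]) ^ s₀, u * b, u * c]) := by
  obtain ⟨u, rfl⟩ := hα
  refine ⟨(↑u⁻¹ : ℤ_[p]), Units.isUnit _, ?_⟩
  refine nonempty_equiv_trans (nonempty_equiv_scale _ (Units.isUnit u⁻¹) isUnit_one isUnit_one
    isUnit_one) (nonempty_equiv_of_eq ?_)
  funext i
  fin_cases i
  · simp
    rw [mul_left_comm, Units.inv_mul, mul_one]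
  · simp
  · simp

/-- The cases record which exponents coincide. A pair of equal exponents keeps only its discriminant
class, normalised to -1 or -ρ; the freedom of similarity makes the unit of the remaining entry equal
to 1. For three distinct exponents `line6` is a placeholder, since `line7`, `line8` and `line9` have
the same diagonal; validity is settled later by isotropy. -/
theorem exists_normalForm (hp : 3 ≤ p) {ρ : ℤ_[p]} (hρu : IsUnit ρ)
    (hρ : ¬ IsSquare (toZMod ρ)) {s₀ s₁ s₂ : ℕ} (h₁ : s₀ ≤ s₁) (h₂ : s₁ ≤ s₂) {α₀ α₁ α₂ : ℤ_[p]}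
    (u₀ : IsUnit α₀) (u₁ : IsUnit α₁) (u₂ : IsUnit α₂) {b : Fin 3 → ℤ_[p]}
    (hb : b = ![(p : ℤ_[p]) ^ s₀ * α₀, p ^ s₁ * α₁, p ^ s₂ * α₂]) :
    ∃ t : TableEntry, Nonempty (DiagLie b ≃ₗ⁅ℤ_[p]⁆ t.Lattice ρ) ∧
      ((∃ s₀, t = .line1 s₀) ∨
       (∃ s₀ s₁, s₀ < s₁ ∧ (t = .line2 s₀ s₁ ∨ t = .line3 s₀ s₁ ∨ t = .line4 s₀ s₁ ∨
          t = .line5 s₀ s₁)) ∨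
       (∃ s₀ s₁ s₂ ε₁ ε₂, s₀ < s₁ ∧ s₁ < s₂ ∧ t = .line6 s₀ s₁ s₂ ε₁ ε₂)) := by
  subst hb
  rcases h₁.eq_or_lt with rfl | h₁
  · rcases h₂.eq_or_lt with rfl | h₂
    · exact ⟨.line1 s₀, nonempty_equiv_homogeneous hp _ u₀ u₁ u₂, Or.inl ⟨_, rfl⟩⟩
    · have e1 := nonempty_equiv_plane_of_isUnit' hp ((p : ℤ_[p]) ^ s₂ * α₂) ((p : ℤ_[p]) ^ s₀) u₀ u₁
      have e2 := nonempty_equiv_symm (nonempty_equiv_rotate ((p : ℤ_[p]) ^ s₂ * α₂) (p ^ s₀ : ℤ_[p])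
        (p ^ s₀ * (α₀ * α₁)))
      obtain ⟨w, hw, e3⟩ := nonempty_equiv_head_one s₂ ((p : ℤ_[p]) ^ s₀) (p ^ s₀ * (α₀ * α₁)) u₂
      rw [show w * (p : ℤ_[p]) ^ s₀ = p ^ s₀ * w by ring,
        show w * ((p : ℤ_[p]) ^ s₀ * (α₀ * α₁)) = p ^ s₀ * (w * (α₀ * α₁)) by ring] at e3
      have e4 := nonempty_equiv_plane_of_isUnit hp (p ^ s₂) (p ^ s₀) hw (hw.mul (u₀.mul u₁))
      have e5 := nonempty_equiv_rotate (p ^ s₂ : ℤ_[p]) (p ^ s₀)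
        (p ^ s₀ * (w * (w * (α₀ * α₁))))
      obtain ⟨v, hv, h⟩ := exists_sq_mul_eq_neg hp hρu hρ (hw.mul (hw.mul (u₀.mul u₁)))
      have e6 := nonempty_equiv_scale ![(p ^ s₀ : ℤ_[p]), p ^ s₀ * (w * (w * (α₀ * α₁))),
        p ^ s₂] isUnit_one isUnit_one hv isUnit_one
      have e7 := nonempty_equiv_trans e1 <| nonempty_equiv_trans e2 <|
        nonempty_equiv_trans e3 <| nonempty_equiv_trans e4 <| nonempty_equiv_trans e5 e6
      rcases h with h | h
      · refine ⟨.line4 s₀ s₂, nonempty_equiv_trans e7 (nonempty_equiv_of_eq ?_),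
          Or.inr (Or.inl ⟨s₀, s₂, h₂, by simp⟩)⟩
        funext i
        fin_cases i
        · simp [TableEntry.diag]
        · simp [TableEntry.diag]
          linear_combination (p : ℤ_[p]) ^ s₀ * h
        · simp [TableEntry.diag]
      · refine ⟨.line5 s₀ s₂, nonempty_equiv_trans e7 (nonempty_equiv_of_eq ?_),
          Or.inr (Or.inl ⟨s₀, s₂, h₂, by simp⟩)⟩
        funext i
        fin_cases i
        · simp [TableEntry.diag]
        · simp [TableEntry.diag]
          linear_combination (p : ℤ_[p]) ^ s₀ * h
        · simp [TableEntry.diag]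
  · obtain ⟨w, hw, e1⟩ := nonempty_equiv_head_one s₀ ((p : ℤ_[p]) ^ s₁ * α₁) ((p : ℤ_[p]) ^ s₂ * α₂) u₀
    rw [show w * ((p : ℤ_[p]) ^ s₁ * α₁) = p ^ s₁ * (w * α₁) by ring,
      show w * ((p : ℤ_[p]) ^ s₂ * α₂) = p ^ s₂ * (w * α₂) by ring] at e1
    rcases h₂.eq_or_lt with rfl | h₂
    · have e2 := nonempty_equiv_plane_of_isUnit hp (p ^ s₀) (p ^ s₁) (hw.mul u₁) (hw.mul u₂)
      obtain ⟨v, hv, h⟩ := exists_sq_mul_eq_neg hp hρu hρ ((hw.mul u₁).mul (hw.mul u₂))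
      have e3 := nonempty_equiv_scale ![(p ^ s₀ : ℤ_[p]), p ^ s₁, p ^ s₁ * (w * α₁ * (w * α₂))]
        isUnit_one isUnit_one isUnit_one hv
      have e4 := nonempty_equiv_trans e1 <| nonempty_equiv_trans e2 e3
      rcases h with h | h
      · refine ⟨.line2 s₀ s₁, nonempty_equiv_trans e4 (nonempty_equiv_of_eq ?_),
          Or.inr (Or.inl ⟨s₀, s₁, h₁, by simp⟩)⟩
        funext i
        fin_cases i
        · simp [TableEntry.diag]
        · simp [TableEntry.diag]
        · simp [TableEntry.diag]
          linear_combination (p : ℤ_[p]) ^ s₁ * h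
      · refine ⟨.line3 s₀ s₁, nonempty_equiv_trans e4 (nonempty_equiv_of_eq ?_),
          Or.inr (Or.inl ⟨s₀, s₁, h₁, by simp⟩)⟩
        funext i
        fin_cases i
        · simp [TableEntry.diag]
        · simp [TableEntry.diag]
        · simp [TableEntry.diag]
          linear_combination (p : ℤ_[p]) ^ s₁ * h
    · obtain ⟨ε₁, v₁, hv₁, h₁'⟩ := exists_eq_pow_mul_sq hp hρu hρ (hw.mul u₁)
      obtain ⟨ε₂, v₂, hv₂, h₂'⟩ := exists_eq_pow_mul_sq hp hρu hρ (hw.mul u₂)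
      have e2 := nonempty_equiv_scale ![(p : ℤ_[p]) ^ s₀, (p : ℤ_[p]) ^ s₁ * (w * α₁), (p : ℤ_[p]) ^ s₂ * (w * α₂)]
        isUnit_one isUnit_one hv₁ hv₂
      refine ⟨.line6 s₀ s₁ s₂ ε₁ ε₂, nonempty_equiv_trans e1 (nonempty_equiv_trans e2
        (nonempty_equiv_of_eq ?_)), Or.inr (Or.inr ⟨s₀, s₁, s₂, ε₁, ε₂, h₁, h₂, rfl⟩)⟩
      funext i
      fin_cases i
      · simp [TableEntry.diag]
      · simp [TableEntry.diag]
        linear_combination (p : ℤ_[p]) ^ s₁ * h₁'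
      · simp [TableEntry.diag]
        linear_combination (p : ℤ_[p]) ^ s₂ * h₂'

end Padic

end DiagLie

/-! ### Isotropy of the diagonal form and the rational form sl₂. -/

open LieAlgebra.SpecialLinear

namespace DiagLie

section Field

variable {K : Type*} [Field K]

/-- The matrix of the element `x` in the two-dimensional representation attached to a solution of
`a₀ + a₁ s² + a₂ t² = 0`. -/
def sl2Matrix (a : Fin 3 → K) (s t : K) (x : Fin 3 → K) : Matrix (Fin 2) (Fin 2) K :=
  (1 / 2 : K) • !![x 1 * (a 2 * t) - x 2 * (a 1 * s), a 1 * a 2 * (-x 0 + x 1 * s + x 2 * t);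
    x 0 + x 1 * s + x 2 * t, -(x 1 * (a 2 * t) - x 2 * (a 1 * s))]

theorem sl2Matrix_mem (a : Fin 3 → K) (s t : K) (x : Fin 3 → K) :
    sl2Matrix a s t x ∈ sl (Fin 2) K := by
  change Matrix.trace (sl2Matrix a s t x) = 0
  simp [sl2Matrix, Matrix.trace, Fin.sum_univ_two]
  ring

theorem sl2Matrix_add (a : Fin 3 → K) (s t : K) (x y : Fin 3 → K) :
    sl2Matrix a s t (x + y) = sl2Matrix a s t x + sl2Matrix a s t y := by
  ext i j
  fin_cases i <;> fin_cases j <;> simp [sl2Matrix] <;> ring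

theorem sl2Matrix_smul (a : Fin 3 → K) (s t c : K) (x : Fin 3 → K) :
    sl2Matrix a s t (c • x) = c • sl2Matrix a s t x := by
  ext i j
  fin_cases i <;> fin_cases j <;> simp [sl2Matrix] <;> ring

theorem sl2Matrix_bracket (h2 : (2 : K) ≠ 0) (a : Fin 3 → K) (s t : K)
    (h : a 0 + a 1 * s ^ 2 + a 2 * t ^ 2 = 0) (x y : Fin 3 → K) :
    sl2Matrix a s t (bracket a x y) =
      sl2Matrix a s t x * sl2Matrix a s t y - sl2Matrix a s t y * sl2Matrix a s t x := by
  have h0 : a 0 = -(a 1 * s ^ 2 + a 2 * t ^ 2) := by linear_combination h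
  ext i j
  fin_cases i <;> fin_cases j <;>
  · simp [sl2Matrix, bracket_eq, h0]
    field_simp
    ring

/-- The homomorphism to `sl₂` given by `sl2Matrix`. -/
def toSl2 (h2 : (2 : K) ≠ 0) (a : Fin 3 → K) (s t : K)
    (h : a 0 + a 1 * s ^ 2 + a 2 * t ^ 2 = 0) : DiagLie a →ₗ⁅K⁆ sl (Fin 2) K where
  toFun x := ⟨sl2Matrix a s t x, sl2Matrix_mem a s t x⟩
  map_add' x y := by
    apply Subtype.ext
    exact sl2Matrix_add a s t x y
  map_smul' c x := by
    apply Subtype.ext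
    exact sl2Matrix_smul a s t c x
  map_lie' := by
    intro x y
    apply Subtype.ext
    exact sl2Matrix_bracket h2 a s t h x y

theorem toSl2_bijective (h2 : (2 : K) ≠ 0) (a : Fin 3 → K) (ha : ∀ i, a i ≠ 0) (s t : K)
    (h : a 0 + a 1 * s ^ 2 + a 2 * t ^ 2 = 0) : Function.Bijective (toSl2 h2 a s t h) := by
  have h0 : a 0 = -(a 1 * s ^ 2 + a 2 * t ^ 2) := by linear_combination h
  constructor
  · rw [injective_iff_map_eq_zero]
    intro x hx
    have hx' : sl2Matrix a s t x = 0 := congrArg Subtype.val hx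
    have e00 := congrFun (congrFun hx' 0) 0
    have e01 := congrFun (congrFun hx' 0) 1
    have e10 := congrFun (congrFun hx' 1) 0
    simp [sl2Matrix, h2, ha] at e00 e01 e10
    have z0 : x 0 = 0 := by
      have : 2 * x 0 = 0 := by linear_combination e10 - e01
      simpa [h2] using this
    have z1 : x 1 = 0 := by
      have : a 0 * x 1 = 0 := by
        linear_combination x 1 * h - t * e00 - a 1 * s * (e10 - z0)
      simpa [ha] using this
    have z2 : x 2 = 0 := by
      have : a 0 * x 2 = 0 := by
        linear_combination x 2 * h + s * e00 - a 2 * t * (e10 - z0)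
      simpa [ha] using this
    change (x : Fin 3 → K) = 0
    funext i
    fin_cases i
    · exact z0
    · exact z1
    · exact z2
  · rintro ⟨m, hm⟩
    have ht : m 0 0 + m 1 1 = 0 := by
      have : Matrix.trace m = 0 := hm
      simpa [Matrix.trace, Fin.sum_univ_two] using this
    have h11 : m 1 1 = -m 0 0 := by linear_combination ht
    have a0 := ha 0
    have a1 := ha 1
    have a2 := ha 2
    -- The off-diagonal entries of `m` determine `x 0` and x₁s + x₂t. Together with the diagonal
    -- entry, the latter gives a 2×2 system for `x 1` and `x 2` whose determinant is `a 0`, by `h`.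
    refine ⟨(![m 1 0 - m 0 1 / (a 1 * a 2),
      -(a 1 * s * (m 1 0 + m 0 1 / (a 1 * a 2)) + 2 * m 0 0 * t) / a 0,
      -(a 2 * t * (m 1 0 + m 0 1 / (a 1 * a 2)) - 2 * m 0 0 * s) / a 0] : Fin 3 → K), ?_⟩
    apply Subtype.ext
    change sl2Matrix a s t _ = m
    ext i j
    fin_cases i <;> fin_cases j <;> simp [sl2Matrix, h11] <;> field_simp
    · linear_combination (-2) * m 0 0 * h
    · linear_combination -(m 0 1 + a 1 * a 2 * m 1 0) * h
    · linear_combination -(m 0 1 + a 1 * a 2 * m 1 0) * h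
    · linear_combination 2 * m 0 0 * h

/-- An isotropic diagonal form has an isotropic vector with first coordinate `1`. -/
theorem exists_solution_of_isotropic (h2 : (2 : K) ≠ 0) (a : Fin 3 → K) (ha : ∀ i, a i ≠ 0)
    (y : Fin 3 → K) (hy : y ≠ 0) (h : a 0 * y 0 ^ 2 + a 1 * y 1 ^ 2 + a 2 * y 2 ^ 2 = 0) :
    ∃ s t : K, a 0 + a 1 * s ^ 2 + a 2 * t ^ 2 = 0 := by
  have a1 := ha 1
  have a2 := ha 2
  by_cases h0 : y 0 = 0
  · have hy1 : y 1 ≠ 0 := by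
      intro h1
      apply hy
      have h3 : y 2 = 0 := by
        rw [h0, h1] at h
        simpa [a2] using h
      funext i
      fin_cases i <;> assumption
    have h' : a 2 * y 2 ^ 2 = -(a 1 * y 1 ^ 2) := by rw [h0] at h; linear_combination h
    -- The last two coordinates span a hyperbolic plane, where the form can be made a₁(s² - w²).
    -- With s and w equal to (1 ∓ a₀/a₁)/2 it takes the value -a₀.
    refine ⟨(1 - a 0 / a 1) / 2, y 2 / y 1 * ((1 + a 0 / a 1) / 2), ?_⟩
    have e : a 2 * (y 2 / y 1 * ((1 + a 0 / a 1) / 2)) ^ 2 = -a 1 * ((1 + a 0 / a 1) / 2) ^ 2 := by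
      have : a 2 * (y 2 / y 1 * ((1 + a 0 / a 1) / 2)) ^ 2 =
        (a 2 * y 2 ^ 2) / y 1 ^ 2 * ((1 + a 0 / a 1) / 2) ^ 2 := by ring
      rw [this, h']
      field_simp
    rw [e]
    field_simp
    ring
  · refine ⟨y 1 / y 0, y 2 / y 0, ?_⟩
    field_simp
    linear_combination h

theorem nonempty_equiv_sl2 (h2 : (2 : K) ≠ 0) (a : Fin 3 → K) (ha : ∀ i, a i ≠ 0)
    (y : Fin 3 → K) (hy : y ≠ 0) (h : a 0 * y 0 ^ 2 + a 1 * y 1 ^ 2 + a 2 * y 2 ^ 2 = 0) :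
    Nonempty (DiagLie a ≃ₗ⁅K⁆ sl (Fin 2) K) := by
  obtain ⟨s, t, h⟩ := exists_solution_of_isotropic h2 a ha y hy h
  exact ⟨LieEquiv.ofBijective _ (toSl2_bijective h2 a ha s t h)⟩

/-- This is Cayley–Hamilton for ad x, whose trace and determinant vanish. The factor is -a₀a₁a₂·∑
xᵢ²/aᵢ when the aᵢ are nonzero, so nilpotency of ad x detects isotropic vectors. -/
theorem bracket_bracket_bracket (a x y : Fin 3 → K) :
    bracket a x (bracket a x (bracket a x y)) =
      -(a 1 * a 2 * x 0 ^ 2 + a 0 * a 2 * x 1 ^ 2 + a 0 * a 1 * x 2 ^ 2) • bracket a x y := by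
  funext i
  fin_cases i <;> simp [bracket_eq] <;> ring

/-- The nilpotent matrix e satisfies (ad e)³ = 0 but is not central, so its preimage v satisfies ∑
vᵢ²/aᵢ = 0; the substitution yᵢ = vᵢ/aᵢ gives the required zero. -/
theorem isotropic_of_equiv_sl2 (a : Fin 3 → K) (ha : ∀ i, a i ≠ 0)
    (f : DiagLie a ≃ₗ⁅K⁆ sl (Fin 2) K) :
    ∃ y : Fin 3 → K, y ≠ 0 ∧ a 0 * y 0 ^ 2 + a 1 * y 1 ^ 2 + a 2 * y 2 ^ 2 = 0 := by
  have a0 := ha 0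
  have a1 := ha 1
  have a2 := ha 2
  let e : sl (Fin 2) K := ⟨!![0, 1; 0, 0], by
    change Matrix.trace !![(0 : K), 1; 0, 0] = 0
    simp [Matrix.trace, Fin.sum_univ_two]⟩
  let g : sl (Fin 2) K := ⟨!![0, 0; 1, 0], by
    change Matrix.trace !![(0 : K), 0; 1, 0] = 0
    simp [Matrix.trace, Fin.sum_univ_two]⟩
  have he : ∀ z : sl (Fin 2) K, ⁅e, ⁅e, ⁅e, z⁆⁆⁆ = 0 := by
    intro z
    apply Subtype.ext
    simp only [sl_bracket]
    have e2 : (e : Matrix (Fin 2) (Fin 2) K) * e = 0 := by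
      ext i j
      fin_cases i <;> fin_cases j <;> simp [e, Matrix.mul_apply, Fin.sum_univ_two]
    generalize (e : Matrix (Fin 2) (Fin 2) K) = E at *
    generalize (z : Matrix (Fin 2) (Fin 2) K) = Z
    change _ = (0 : Matrix (Fin 2) (Fin 2) K)
    have : E * (E * (E * Z - Z * E) - (E * Z - Z * E) * E) -
        (E * (E * Z - Z * E) - (E * Z - Z * E) * E) * E =
        (E * E) * (E * Z) - 3 • ((E * E) * (Z * E)) + 3 • ((E * Z) * (E * E)) -
          Z * E * (E * E) := by
      noncomm_ring
    rw [this, e2]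
    simp
  have heg : ⁅e, g⁆ ≠ 0 := by
    intro h
    have h' : (e : Matrix (Fin 2) (Fin 2) K) * g - (g : Matrix (Fin 2) (Fin 2) K) * e = 0 :=
      congrArg Subtype.val h
    have h'' := congrFun (congrFun h' 0) 0
    simp [e, g] at h''
  have hv : f (f.symm e) = e := f.apply_symm_apply e
  set v : DiagLie a := f.symm e with hvdef
  have hw : f (f.symm g) = g := f.apply_symm_apply g
  set w : DiagLie a := f.symm g
  have hb : ⁅v, w⁆ ≠ 0 := by
    intro h
    apply heg
    rw [← hv, ← hw, ← LieEquiv.map_lie, h, map_zero]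
  have hbbb : ⁅v, ⁅v, ⁅v, w⁆⁆⁆ = 0 := by
    apply f.injective
    change f _ = f _
    rw [LieEquiv.map_lie, LieEquiv.map_lie, LieEquiv.map_lie, hv, he, map_zero]
  have hq : -(a 1 * a 2 * v 0 ^ 2 + a 0 * a 2 * v 1 ^ 2 + a 0 * a 1 * v 2 ^ 2) •
      (bracket a v w) = 0 := (bracket_bracket_bracket a v w).symm.trans hbbb
  rcases smul_eq_zero.1 hq with hq | hq
  · refine ⟨fun i => v i / a i, ?_, ?_⟩
    · intro h0
      apply hb
      have : v = 0 := by
        funext i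
        have := congrFun h0 i
        rwa [Pi.zero_apply, div_eq_zero_iff, or_iff_left (ha i)] at this
      rw [this, zero_lie]
    · field_simp
      linear_combination -hq
  · exact absurd hq hb

end Field

section BaseChange

variable {R K : Type*} [CommRing R] [Field K] [Algebra R K]

/-- The coordinates of the base change of a diagonal Lie lattice. -/
def baseChangeCoords (a : Fin 3 → R) :
    (K ⊗[R] DiagLie a) ≃ₗ[K] DiagLie (fun i => algebraMap R K (a i)) :=
  (TensorProduct.piScalarRight R K K (Fin 3) : (K ⊗[R] (Fin 3 → R)) ≃ₗ[K] (Fin 3 → K))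

theorem baseChangeCoords_tmul (a : Fin 3 → R) (c : K) (x : Fin 3 → R) :
    (baseChangeCoords a (c ⊗ₜ[R] (x : DiagLie a)) : Fin 3 → K) =
      fun i => algebraMap R K (x i) * c := by
  funext i
  rw [← Algebra.smul_def]
  exact congrFun (TensorProduct.piScalarRightHom_tmul R K K (Fin 3) c x) i

/-- A linear map on a base change is a Lie homomorphism if it is one on the lattice. -/
theorem _root_.LieAlgebra.ExtendScalars.map_lie_of_tmul {L M : Type*} [LieRing L]
    [LieAlgebra R L] [LieRing M] [LieAlgebra K M] (F : (K ⊗[R] L) →ₗ[K] M)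
    (h : ∀ x y : L, F (1 ⊗ₜ ⁅x, y⁆) = ⁅F (1 ⊗ₜ x), F (1 ⊗ₜ y)⁆) (x y : K ⊗[R] L) :
    F ⁅x, y⁆ = ⁅F x, F y⁆ := by
  have h1 : ∀ (c : K) (x : L), F (c ⊗ₜ[R] x) = c • F (1 ⊗ₜ[R] x) := by
    intro c x
    rw [← map_smul, TensorProduct.smul_tmul', smul_eq_mul, mul_one]
  induction x using TensorProduct.induction_on with
  | zero => rw [show ⁅(0 : K ⊗[R] L), y⁆ = 0 from zero_lie y, map_zero, zero_lie]
  | add x x' hx hx' =>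
    rw [show ⁅x + x', y⁆ = ⁅x, y⁆ + ⁅x', y⁆ from add_lie x x' y, map_add, hx, hx', map_add, add_lie]
  | tmul c x =>
    induction y using TensorProduct.induction_on with
    | zero =>
      rw [show ⁅c ⊗ₜ[R] x, (0 : K ⊗[R] L)⁆ = 0 from lie_zero (c ⊗ₜ[R] x : K ⊗[R] L), map_zero,
        lie_zero]
    | add y y' hy hy' =>
      rw [show ⁅c ⊗ₜ[R] x, y + y'⁆ = ⁅c ⊗ₜ[R] x, y⁆ + ⁅c ⊗ₜ[R] x, y'⁆ from lie_add _ y y',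
        map_add, hy, hy', map_add, lie_add]
    | tmul d y =>
      rw [LieAlgebra.ExtendScalars.bracket_tmul, h1, h, h1 c, h1 d, smul_lie, lie_smul, smul_smul]

theorem algebraMap_bracket (a x y : Fin 3 → R) :
    (fun i => algebraMap R K (bracket a x y i) * 1) = bracket (fun i => algebraMap R K (a i))
      (fun i => algebraMap R K (x i) * 1) (fun i => algebraMap R K (y i) * 1) := by
  funext i
  fin_cases i <;> simp [bracket_eq]

theorem baseChangeCoords_lie (a : Fin 3 → R) (x y : K ⊗[R] DiagLie a) :
    baseChangeCoords (K := K) a ⁅x, y⁆ = ⁅baseChangeCoords a x, baseChangeCoords a y⁆ := by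
  refine LieAlgebra.ExtendScalars.map_lie_of_tmul
    (M := DiagLie fun i => algebraMap R K (a i)) (baseChangeCoords a).toLinearMap ?_ x y
  intro x y
  refine (baseChangeCoords_tmul a (1 : K) (bracket a x y)).trans ?_
  refine Eq.trans ?_ (congrArg₂ (bracket fun i => algebraMap R K (a i))
    (baseChangeCoords_tmul a (1 : K) x) (baseChangeCoords_tmul a (1 : K) y)).symm
  exact algebraMap_bracket a x y

/-- The base change of a diagonal Lie lattice. -/
def baseChangeEquiv (a : Fin 3 → R) :
    (K ⊗[R] DiagLie a) ≃ₗ⁅K⁆ DiagLie (fun i => algebraMap R K (a i)) :=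
  { baseChangeCoords a with
    map_lie' := by
      intro x y
      exact baseChangeCoords_lie a x y }

end BaseChange

section Padic

variable {p : ℕ} [Fact p.Prime]

/-- Each member of the standard triple is, up to the invertible factor 2, a bracket of two members,
so the triple survives in every term of the derived series. -/
theorem not_isSolvable_sl2 (K : Type*) [Field K] [CharZero K] :
    ¬ LieAlgebra.IsSolvable (sl (Fin 2) K) := by
  intro hs
  obtain ⟨n, hn⟩ := LieAlgebra.IsSolvable.solvable K (sl (Fin 2) K)
  have hmem : ∀ x y z : K, !![x, y; z, -x] ∈ sl (Fin 2) K := by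
    intro x y z
    change Matrix.trace !![x, y; z, -x] = 0
    simp [Matrix.trace, Fin.sum_univ_two]
  have hlie : ∀ x y z x' y' z' : K, ⁅(⟨_, hmem x y z⟩ : sl (Fin 2) K), (⟨_, hmem x' y' z'⟩ :
      sl (Fin 2) K)⁆ = ⟨_, hmem (y * z' - y' * z) (2 * (x * y' - x' * y))
        (2 * (z * x' - z' * x))⟩ := by
    intro x y z x' y' z'
    apply Subtype.ext
    rw [sl_bracket]
    ext i j
    fin_cases i <;> fin_cases j <;> simp <;> ring
  have key : ∀ n, (⟨_, hmem 1 0 0⟩ : sl (Fin 2) K) ∈ LieAlgebra.derivedSeries K (sl (Fin 2) K) n ∧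
      (⟨_, hmem 0 1 0⟩ : sl (Fin 2) K) ∈ LieAlgebra.derivedSeries K (sl (Fin 2) K) n ∧
      (⟨_, hmem 0 0 1⟩ : sl (Fin 2) K) ∈ LieAlgebra.derivedSeries K (sl (Fin 2) K) n := by
    intro n
    induction n with
    | zero => simp
    | succ n ih =>
      obtain ⟨h1, h2, h3⟩ := ih
      have m1 := LieSubmodule.lie_mem_lie h2 h3
      have m2 := LieSubmodule.lie_mem_lie h1 h2
      have m3 := LieSubmodule.lie_mem_lie h3 h1
      have e1 : (⟨_, hmem 1 0 0⟩ : sl (Fin 2) K) = ⁅(⟨_, hmem 0 1 0⟩ : sl (Fin 2) K),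
          (⟨_, hmem 0 0 1⟩ : sl (Fin 2) K)⁆ := by
        rw [hlie]; apply Subtype.ext; simp
      have e2 : (⟨_, hmem 0 1 0⟩ : sl (Fin 2) K) = (1 / 2 : K) •
          ⁅(⟨_, hmem 1 0 0⟩ : sl (Fin 2) K), (⟨_, hmem 0 1 0⟩ : sl (Fin 2) K)⁆ := by
        rw [hlie]; apply Subtype.ext
        change _ = (1 / 2 : K) • (_ : Matrix (Fin 2) (Fin 2) K)
        simp
      have e3 : (⟨_, hmem 0 0 1⟩ : sl (Fin 2) K) = (1 / 2 : K) •
          ⁅(⟨_, hmem 0 0 1⟩ : sl (Fin 2) K), (⟨_, hmem 1 0 0⟩ : sl (Fin 2) K)⁆ := by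
        rw [hlie]; apply Subtype.ext
        change _ = (1 / 2 : K) • (_ : Matrix (Fin 2) (Fin 2) K)
        simp
      rw [LieAlgebra.derivedSeries_def, LieAlgebra.derivedSeriesOfIdeal_succ]
      refine ⟨?_, ?_, ?_⟩
      · rw [e1]; exact m1
      · rw [e2]; exact SMulMemClass.smul_mem _ m2
      · rw [e3]; exact SMulMemClass.smul_mem _ m3
  have h1 := (key n).1
  rw [hn, LieSubmodule.mem_bot] at h1
  have := congrFun (congrFun (congrArg Subtype.val h1) 0) 0
  simp at this

/-- The diagonal lattices whose rational form is `sl₂` are those with an isotropic form. -/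
theorem isUnsolvableSl2Lattice_iff (a : Fin 3 → ℤ_[p]) (ha : ∀ i, a i ≠ 0) :
    IsUnsolvableSl2Lattice p (DiagLie a) ↔
      ∃ y : Fin 3 → ℚ_[p], y ≠ 0 ∧ (a 0 : ℚ_[p]) * y 0 ^ 2 + a 1 * y 1 ^ 2 + a 2 * y 2 ^ 2 = 0 := by
  have ha' : ∀ i, algebraMap ℤ_[p] ℚ_[p] (a i) ≠ 0 := fun i => by
    rw [Ne, FaithfulSMul.algebraMap_eq_zero_iff]
    exact ha i
  constructor
  · intro h
    obtain ⟨f⟩ := h.tensor_equiv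
    exact isotropic_of_equiv_sl2 _ ha' ((baseChangeEquiv a).symm.trans f)
  · rintro ⟨y, hy, h⟩
    obtain ⟨f⟩ := nonempty_equiv_sl2 (K := ℚ_[p]) two_ne_zero _ ha' y hy h
    refine ⟨inferInstanceAs (Module.Free ℤ_[p] (Fin 3 → ℤ_[p])), ?_, ?_,
      ⟨(baseChangeEquiv a).trans f⟩⟩
    · exact (Module.finrank_fin_fun ℤ_[p] : Module.finrank ℤ_[p] (Fin 3 → ℤ_[p]) = 3)
    · intro hs
      apply not_isSolvable_sl2 ℚ_[p]
      have : LieAlgebra.IsSolvable (ℚ_[p] ⊗[ℤ_[p]] DiagLie a) := inferInstance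
      exact (LieAlgebra.solvable_iff_equiv_solvable ((baseChangeEquiv a).trans f)).1 this

theorem _root_.IsUnsolvableSl2Lattice.of_equiv {L L' : Type*} [LieRing L] [LieAlgebra ℤ_[p] L]
    [LieRing L'] [LieAlgebra ℤ_[p] L'] (h : IsUnsolvableSl2Lattice p L) (e : L ≃ₗ⁅ℤ_[p]⁆ L') :
    IsUnsolvableSl2Lattice p L' where
  free := by
    have := h.free
    exact Module.Free.of_equiv e.toLinearEquiv
  finrank_eq := by rw [← e.toLinearEquiv.finrank_eq, h.finrank_eq]
  unsolvable := by
    rw [← LieAlgebra.solvable_iff_equiv_solvable e]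
    exact h.unsolvable
  tensor_equiv := by
    obtain ⟨f⟩ := h.tensor_equiv
    refine ⟨LieEquiv.trans { (e.symm.toLinearEquiv.baseChange ℤ_[p] ℚ_[p] L' L) with
      map_lie' := ?_ } f⟩
    intro x y
    refine LieAlgebra.ExtendScalars.map_lie_of_tmul
      (e.symm.toLinearEquiv.baseChange ℤ_[p] ℚ_[p] L' L).toLinearMap ?_ x y
    intro x y
    change (1 : ℚ_[p]) ⊗ₜ[ℤ_[p]] e.symm ⁅x, y⁆ =
      ⁅(1 : ℚ_[p]) ⊗ₜ[ℤ_[p]] e.symm x, (1 : ℚ_[p]) ⊗ₜ[ℤ_[p]] e.symm y⁆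
    rw [LieAlgebra.ExtendScalars.bracket_tmul, LieEquiv.map_lie, mul_one]

end Padic

end DiagLie

/-! ### Orthogonal bases and diagonalisation of the bracket. -/

/-- A symmetric bilinear form on a finite free `ℤ_[p]`-module has an orthogonal basis. -/
theorem exists_orthogonal_basis {p : ℕ} [Fact p.Prime] (hp : 3 ≤ p) (n : ℕ) :
    ∀ (M : Type u) [AddCommGroup M] [Module ℤ_[p] M] [Module.Free ℤ_[p] M]
      [Module.Finite ℤ_[p] M], Module.finrank ℤ_[p] M = n →
      ∀ B : M →ₗ[ℤ_[p]] M →ₗ[ℤ_[p]] ℚ_[p], (∀ x y, B x y = B y x) →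
      ∃ b : Module.Basis (Fin n) ℤ_[p] M, ∀ i j, i ≠ j → B (b i) (b j) = 0 := by
  induction n with
  | zero =>
    intro M _ _ _ _ hM B hB
    exact ⟨Module.finBasisOfFinrankEq ℤ_[p] M hM, fun i => i.elim0⟩
  | succ n ih =>
    intro M _ _ _ _ hM B hB
    let b := Module.finBasisOfFinrankEq ℤ_[p] M hM
    obtain ⟨⟨i, j⟩, hij⟩ := Finite.exists_max fun k : Fin (n + 1) × Fin (n + 1) =>
      ‖B (b k.1) (b k.2)‖
    set r := ‖B (b i) (b j)‖ with hr
    have hsmul : ∀ (c : ℤ_[p]) (x : ℚ_[p]), ‖c • x‖ ≤ ‖x‖ := by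
      intro c x
      rw [Algebra.smul_def, norm_mul]
      exact mul_le_of_le_one_left (norm_nonneg _) c.norm_le_one
    have hle : ∀ y z, ‖B y z‖ ≤ r := by
      intro y z
      rw [← b.sum_repr y, ← b.sum_repr z]
      simp only [map_sum, map_smul, LinearMap.sum_apply, LinearMap.smul_apply]
      refine IsUltrametricDist.norm_sum_le_of_forall_le_of_nonneg (norm_nonneg _) fun k _ => ?_
      refine (hsmul _ _).trans ?_
      refine IsUltrametricDist.norm_sum_le_of_forall_le_of_nonneg (norm_nonneg _) fun l _ => ?_
      exact (hsmul _ _).trans (hij (l, k))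
    by_cases hr0 : r = 0
    · refine ⟨b, fun k l _ => ?_⟩
      have := hle (b k) (b l)
      rw [hr0] at this
      exact norm_le_zero_iff.1 this
    -- Because 2 is a unit, polarisation shows that the largest norm of a value of `B` is already
    -- attained on the diagonal.
    have hx : ∃ x, ‖B x x‖ = r := by
      by_contra! hne
      have hlt : ∀ x, ‖B x x‖ < r := fun x => lt_of_le_of_ne (hle x x) (hne x)
      have h2 : ‖(2 : ℚ_[p])‖ = 1 := by
        have := PadicInt.coe_unit_norm (PadicInt.isUnit_two (p := p) hp)
        rwa [show ((2 : ℤ_[p]) : ℚ_[p]) = 2 from map_ofNat PadicInt.Coe.ringHom 2] at this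
      have e : (2 : ℚ_[p]) * B (b i) (b j) = B (b i + b j) (b i + b j) - B (b i) (b i) -
          B (b j) (b j) := by
        simp only [map_add, LinearMap.add_apply]
        rw [hB (b j) (b i)]
        ring
      have : ‖(2 : ℚ_[p]) * B (b i) (b j)‖ < r := by
        rw [e, sub_eq_add_neg, sub_eq_add_neg]
        refine (Padic.nonarchimedean _ _).trans_lt (max_lt ?_ ?_)
        · refine (Padic.nonarchimedean _ _).trans_lt (max_lt (hlt _) ?_)
          rw [norm_neg]
          exact hlt _
        · rw [norm_neg]
          exact hlt _
      rw [norm_mul, h2, one_mul] at this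
      exact lt_irrefl _ this
    obtain ⟨x, hx⟩ := hx
    have hx0 : B x x ≠ 0 := by
      rw [← norm_ne_zero_iff, hx]
      exact hr0
    have hrpos : 0 < r := lt_of_le_of_ne (norm_nonneg _) (Ne.symm hr0)
    -- Maximality of ‖B x x‖ makes the orthogonal projection onto x integral, so M splits as the
    -- line of x plus the kernel of `f`, on which induction applies.
    let f : M →ₗ[ℤ_[p]] ℤ_[p] :=
      { toFun := fun y => ⟨B x y / B x x, by
          rw [norm_div, hx, div_le_one hrpos]
          exact hle x y⟩
        map_add' := fun y z => by
          apply PadicInt.ext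
          change B x (y + z) / B x x = B x y / B x x + B x z / B x x
          rw [map_add, add_div]
        map_smul' := fun c y => by
          apply PadicInt.ext
          change B x (c • y) / B x x = (c : ℚ_[p]) * (B x y / B x x)
          rw [map_smul, Algebra.smul_def, mul_div_assoc]
          rfl }
    have hf : ∀ y, (f y : ℚ_[p]) = B x y / B x x := fun y => rfl
    have hfx : f x = 1 := by
      apply PadicInt.ext
      rw [hf, div_self hx0, PadicInt.coe_one]
    have hker : ∀ y ∈ LinearMap.ker f, B x y = 0 := by
      intro y hy
      have := hf y
      rw [LinearMap.mem_ker.1 hy, PadicInt.coe_zero, eq_comm, div_eq_zero_iff,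
        or_iff_left hx0] at this
      exact this
    have hrank : Module.finrank ℤ_[p] (LinearMap.ker f) = n := by
      have h1 := (LinearMap.ker f).finrank_quotient_add_finrank
      rw [f.quotKerEquivRange.finrank_eq] at h1
      have h2 : LinearMap.range f = ⊤ := by
        rw [LinearMap.range_eq_top]
        intro c
        exact ⟨c • x, by rw [map_smul, hfx, smul_eq_mul, mul_one]⟩
      rw [h2, finrank_top, Module.finrank_self, hM] at h1
      omega
    obtain ⟨b', hb'⟩ := ih (LinearMap.ker f) hrank
      (B.compl₁₂ (LinearMap.ker f).subtype (LinearMap.ker f).subtype) (fun y z => hB _ _)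
    refine ⟨Module.Basis.mkFinCons x b' ?_ ?_, ?_⟩
    · intro c y hy h
      have := congrArg f h
      rw [map_add, map_smul, hfx, LinearMap.mem_ker.1 hy, map_zero] at this
      simpa using this
    · intro z
      refine ⟨-f z, ?_⟩
      rw [LinearMap.mem_ker, map_add, map_smul, hfx]
      simp
    · intro k l hkl
      rw [Module.Basis.coe_mkFinCons]
      induction k using Fin.cases with
      | zero =>
        induction l using Fin.cases with
        | zero => exact absurd rfl hkl
        | succ l => simpa using hker _ (b' l).2
      | succ k =>
        induction l using Fin.cases with
        | zero =>
          rw [hB]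
          simpa using hker _ (b' k).2
        | succ l =>
          have := hb' k l (fun h => hkl (by rw [h]))
          simpa using this

/-- A Lie lattice with a basis multiplied as in a diagonal lattice is a diagonal lattice. -/
theorem DiagLie.nonempty_equiv_of_basis {R L : Type*} [CommRing R] [LieRing L] [LieAlgebra R L]
    (b : Module.Basis (Fin 3) R L) (a : Fin 3 → R) (h₀ : ⁅b 1, b 2⁆ = a 0 • b 0)
    (h₁ : ⁅b 2, b 0⁆ = a 1 • b 1) (h₂ : ⁅b 0, b 1⁆ = a 2 • b 2) :
    Nonempty (L ≃ₗ⁅R⁆ DiagLie a) := by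
  have key : ∀ x y : L, b.equivFun ⁅x, y⁆ = bracket a (b.equivFun x) (b.equivFun y) := by
    intro x y
    rw [← LinearEquiv.eq_symm_apply, Module.Basis.equivFun_symm_apply]
    conv_lhs => rw [← b.sum_equivFun x, ← b.sum_equivFun y]
    have h₀' : ⁅b 2, b 1⁆ = -(a 0 • b 0) := by rw [← h₀, lie_skew]
    have h₁' : ⁅b 0, b 2⁆ = -(a 1 • b 1) := by rw [← h₁, lie_skew]
    have h₂' : ⁅b 1, b 0⁆ = -(a 2 • b 2) := by rw [← h₂, lie_skew]
    simp only [Fin.sum_univ_three, lie_add, add_lie, lie_smul, smul_lie, h₀, h₁, h₂, h₀', h₁', h₂',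
      lie_self, bracket_eq, Matrix.cons_val_zero, Matrix.cons_val_one, Matrix.cons_val]
    module
  exact ⟨{ (b.equivFun : L ≃ₗ[R] (Fin 3 → R)) with map_lie' := by intro x y; exact key x y }⟩

theorem LieAlgebra.SpecialLinear.eq_zero_of_trace_mul_eq_zero {K : Type*} [Field K] [CharZero K]
    (X : sl (Fin 2) K) (h : ∀ Y : sl (Fin 2) K, Matrix.trace (X.1 * Y.1) = 0) : X = 0 := by
  obtain ⟨m, hm⟩ := X
  have ht : m 0 0 + m 1 1 = 0 := by
    have : Matrix.trace m = 0 := hm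
    simpa [Matrix.trace, Fin.sum_univ_two] using this
  have hmem : ∀ x y z : K, !![x, y; z, -x] ∈ sl (Fin 2) K := by
    intro x y z
    change Matrix.trace !![x, y; z, -x] = 0
    simp [Matrix.trace, Fin.sum_univ_two]
  have e1 := h ⟨_, hmem 1 0 0⟩
  have e2 := h ⟨_, hmem 0 1 0⟩
  have e3 := h ⟨_, hmem 0 0 1⟩
  simp [Matrix.trace, Fin.sum_univ_two, Matrix.mul_apply] at e1 e2 e3
  apply Subtype.ext
  change m = 0
  have z0 : m 0 0 = 0 := by
    have : 2 * m 0 0 = 0 := by linear_combination ht + e1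
    simpa using this
  have z1 : m 1 1 = 0 := by linear_combination ht - z0
  ext i j
  fin_cases i <;> fin_cases j <;> simp [*]

namespace IsUnsolvableSl2Lattice

variable {p : ℕ} [Fact p.Prime]

/-- A Lie lattice with rational form `sl₂` is diagonalisable. -/
theorem exists_diagLie (hp : 3 ≤ p) {L : Type u} [LieRing L] [LieAlgebra ℤ_[p] L]
    (hL : IsUnsolvableSl2Lattice p L) :
    ∃ a : Fin 3 → ℤ_[p], (∀ i, a i ≠ 0) ∧ ‖a 1‖ ≤ ‖a 0‖ ∧ ‖a 2‖ ≤ ‖a 1‖ ∧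
      Nonempty (L ≃ₗ⁅ℤ_[p]⁆ DiagLie a) := by
  have := hL.free
  have hfin : Module.Finite ℤ_[p] L := Module.finite_of_finrank_pos (by rw [hL.finrank_eq]; norm_num)
  obtain ⟨f⟩ := hL.tensor_equiv
  let Θ : L → Matrix (Fin 2) (Fin 2) ℚ_[p] := fun x => (f (1 ⊗ₜ[ℤ_[p]] x)).1
  have Θ_add : ∀ x y, Θ (x + y) = Θ x + Θ y := by
    intro x y
    simp only [Θ, TensorProduct.tmul_add, map_add]
    rfl
  have Θ_smul : ∀ (c : ℤ_[p]) x, Θ (c • x) = (c : ℚ_[p]) • Θ x := by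
    intro c x
    have : (1 : ℚ_[p]) ⊗ₜ[ℤ_[p]] (c • x) = (c : ℚ_[p]) • (1 : ℚ_[p]) ⊗ₜ[ℤ_[p]] x := by
      rw [← TensorProduct.smul_tmul, TensorProduct.smul_tmul', Algebra.smul_def]
      rfl
    simp only [Θ, this, map_smul]
    rfl
  have Θ_lie : ∀ x y, Θ ⁅x, y⁆ = Θ x * Θ y - Θ y * Θ x := by
    intro x y
    have : (1 : ℚ_[p]) ⊗ₜ[ℤ_[p]] ⁅x, y⁆ = ⁅(1 : ℚ_[p]) ⊗ₜ[ℤ_[p]] x, (1 : ℚ_[p]) ⊗ₜ[ℤ_[p]] y⁆ := by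
      rw [LieAlgebra.ExtendScalars.bracket_tmul, mul_one]
    simp only [Θ]
    rw [this, ← sl_bracket]
    exact congrArg Subtype.val (LieEquiv.map_lie f _ _)
  -- The trace form need not be integral on L, which is why orthogonal bases are taken for forms
  -- with values in `ℚ_[p]`.
  let B : L →ₗ[ℤ_[p]] L →ₗ[ℤ_[p]] ℚ_[p] := LinearMap.mk₂ ℤ_[p] (fun x y => Matrix.trace (Θ x * Θ y))
    (fun x x' y => by rw [Θ_add, add_mul, Matrix.trace_add])
    (fun c x y => by rw [Θ_smul, Matrix.smul_mul, Matrix.trace_smul]; rfl)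
    (fun x y y' => by rw [Θ_add, mul_add, Matrix.trace_add])
    (fun c x y => by rw [Θ_smul, Matrix.mul_smul, Matrix.trace_smul]; rfl)
  have hBdef : ∀ x y, B x y = Matrix.trace (Θ x * Θ y) := fun x y => rfl
  have hBsymm : ∀ x y, B x y = B y x := fun x y =>
    Matrix.trace_mul_comm (Θ x) (Θ y)
  have hinv : ∀ x y z : L, B ⁅x, y⁆ z = B ⁅y, z⁆ x := by
    intro x y z
    simp only [hBdef, Θ_lie, sub_mul, Matrix.trace_sub]
    rw [mul_assoc (Θ x), Matrix.trace_mul_comm (Θ x), mul_assoc (Θ y) (Θ x),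
      Matrix.trace_mul_comm (Θ y) (Θ x * Θ z), mul_assoc (Θ x), Matrix.trace_mul_comm (Θ x)]
  have hself : ∀ x y : L, B ⁅x, y⁆ y = 0 := by
    intro x y
    rw [hinv, lie_self, map_zero, LinearMap.zero_apply]
  have hself' : ∀ x y : L, B ⁅x, y⁆ x = 0 := by
    intro x y
    rw [← hinv, lie_self, map_zero, LinearMap.zero_apply]
  obtain ⟨b₀, hb₀⟩ := exists_orthogonal_basis hp 3 L hL.finrank_eq B hBsymm
  -- The products aᵢ·B(bᵢ, bᵢ) will turn out to be independent of i, so increasing norms of B(bᵢ,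
  -- bᵢ) yield decreasing norms of the aᵢ.
  let σ := Tuple.sort fun i => ‖B (b₀ i) (b₀ i)‖
  have hσ := Tuple.monotone_sort fun i => ‖B (b₀ i) (b₀ i)‖
  let b := b₀.reindex σ.symm
  have hbσ : ∀ i, b i = b₀ (σ i) := fun i => by simp [b]
  have hb : ∀ i j, i ≠ j → B (b i) (b j) = 0 := by
    intro i j hij
    rw [hbσ, hbσ]
    exact hb₀ _ _ (fun h => hij (σ.injective h))
  have hmono : ∀ i j, i ≤ j → ‖B (b i) (b i)‖ ≤ ‖B (b j) (b j)‖ := by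
    intro i j hij
    rw [hbσ, hbσ]
    exact hσ hij
  have hexp : ∀ x i, B x (b i) = b.repr x i • B (b i) (b i) := by
    intro x i
    conv_lhs => rw [← b.sum_repr x]
    rw [map_sum, LinearMap.sum_apply, Finset.sum_eq_single i]
    · rw [map_smul, LinearMap.smul_apply]
    · intro j _ hj
      rw [map_smul, LinearMap.smul_apply, hb j i hj, smul_zero]
    · simp
  have hg : ∀ i, B (b i) (b i) ≠ 0 := by
    intro i hi
    have h1 : ∀ y, B (b i) y = 0 := by
      intro y
      rw [hBsymm, hexp, hi, smul_zero]
    have h2 : f (1 ⊗ₜ[ℤ_[p]] b i) = 0 := by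
      apply eq_zero_of_trace_mul_eq_zero
      intro Y
      obtain ⟨w, rfl⟩ := f.surjective Y
      induction w using TensorProduct.induction_on with
      | zero =>
        change Matrix.trace (_ * (f 0 : sl (Fin 2) ℚ_[p]).1) = 0
        rw [map_zero]; simp
      | add w w' hw hw' =>
        change Matrix.trace (_ * (f (w + w') : sl (Fin 2) ℚ_[p]).1) = 0
        have : (f (w + w') : sl (Fin 2) ℚ_[p]).1 = (f w).1 + (f w').1 := by rw [map_add]; rfl
        rw [this, mul_add, Matrix.trace_add]
        have hw1 : Matrix.trace ((f (1 ⊗ₜ[ℤ_[p]] b i)).1 * (f w).1) = 0 := hw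
        have hw2 : Matrix.trace ((f (1 ⊗ₜ[ℤ_[p]] b i)).1 * (f w').1) = 0 := hw'
        rw [hw1, hw2, add_zero]
      | tmul c y =>
        have e : (f (c ⊗ₜ[ℤ_[p]] y)).1 = c • Θ y := by
          have : c ⊗ₜ[ℤ_[p]] y = c • ((1 : ℚ_[p]) ⊗ₜ[ℤ_[p]] y) := by
            rw [TensorProduct.smul_tmul', smul_eq_mul, mul_one]
          rw [this, map_smul]
          rfl
        change Matrix.trace (Θ (b i) * (f (c ⊗ₜ[ℤ_[p]] y)).1) = 0
        rw [e, Matrix.mul_smul, Matrix.trace_smul]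
        have := h1 y
        rw [hBdef] at this
        rw [this, smul_zero]
    have h3 : (1 : ℚ_[p]) ⊗ₜ[ℤ_[p]] b i = 0 := by
      apply f.injective
      exact h2.trans (map_zero f).symm
    have h4 := (b.baseChange ℚ_[p]).ne_zero i
    rw [Module.Basis.baseChange_apply] at h4
    exact h4 h3
  have hcoord : ∀ x i, B x (b i) = 0 → b.repr x i = 0 := by
    intro x i h
    rw [hexp, Algebra.smul_def, mul_eq_zero, or_iff_left (hg i),
      FaithfulSMul.algebraMap_eq_zero_iff] at h
    exact h
  -- By invariance a bracket of two basis vectors is orthogonal to both, hence a multiple of the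
  -- third.
  let a : Fin 3 → ℤ_[p] := ![b.repr ⁅b 1, b 2⁆ 0, b.repr ⁅b 2, b 0⁆ 1, b.repr ⁅b 0, b 1⁆ 2]
  have e0 : ⁅b 1, b 2⁆ = a 0 • b 0 := by
    conv_lhs => rw [← b.sum_repr ⁅b 1, b 2⁆]
    rw [Fin.sum_univ_three, hcoord _ 1 (hself' _ _), hcoord _ 2 (hself _ _)]
    simp [a]
  have e1 : ⁅b 2, b 0⁆ = a 1 • b 1 := by
    conv_lhs => rw [← b.sum_repr ⁅b 2, b 0⁆]
    rw [Fin.sum_univ_three, hcoord _ 2 (hself' _ _), hcoord _ 0 (hself _ _)]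
    simp [a]
  have e2 : ⁅b 0, b 1⁆ = a 2 • b 2 := by
    conv_lhs => rw [← b.sum_repr ⁅b 0, b 1⁆]
    rw [Fin.sum_univ_three, hcoord _ 0 (hself' _ _), hcoord _ 1 (hself _ _)]
    simp [a]
  have τ0 : a 0 • B (b 0) (b 0) = B ⁅b 0, b 1⁆ (b 2) := by
    rw [hinv, e0, map_smul, LinearMap.smul_apply]
  have τ1 : a 1 • B (b 1) (b 1) = B ⁅b 0, b 1⁆ (b 2) := by
    rw [← hinv, e1, map_smul, LinearMap.smul_apply]
  have τ2 : a 2 • B (b 2) (b 2) = B ⁅b 0, b 1⁆ (b 2) := by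
    rw [e2, map_smul, LinearMap.smul_apply]
  have hτ : ∀ i, a i • B (b i) (b i) = B ⁅b 0, b 1⁆ (b 2) := by
    intro i
    fin_cases i
    · exact τ0
    · exact τ1
    · exact τ2
  -- The common value of aᵢ·B(bᵢ, bᵢ) vanishes as soon as one aᵢ does; then all of them vanish and L
  -- is abelian.
  have ha : ∀ i, a i ≠ 0 := by
    intro i hi
    apply hL.unsolvable
    have hz : B ⁅b 0, b 1⁆ (b 2) = 0 := by rw [← hτ i, hi, zero_smul]
    have ha0 : a = 0 := by
      funext j
      have := hτ j
      rw [hz, Algebra.smul_def, mul_eq_zero, or_iff_left (hg j),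
        FaithfulSMul.algebraMap_eq_zero_iff] at this
      exact this
    obtain ⟨e⟩ := DiagLie.nonempty_equiv_of_basis b a e0 e1 e2
    have : IsLieAbelian L := ⟨fun x y => by
      apply e.injective
      change e ⁅x, y⁆ = e 0
      rw [LieEquiv.map_lie, map_zero]
      funext j
      have hj : a j = 0 := congrFun ha0 j
      change a j * _ = 0
      rw [hj, zero_mul]⟩
    infer_instance
  have hnorm : ∀ i j, i ≤ j → ‖a j‖ ≤ ‖a i‖ := by
    intro i j hij
    have h1 := congrArg norm ((hτ i).trans (hτ j).symm)
    rw [Algebra.smul_def, Algebra.smul_def, norm_mul, norm_mul] at h1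
    have h2 := hmono i j hij
    have h3 : 0 < ‖B (b j) (b j)‖ := norm_pos_iff.2 (hg j)
    change ‖a i‖ * _ = ‖a j‖ * _ at h1
    refine le_of_mul_le_mul_right ?_ h3
    rw [← h1]
    exact mul_le_mul_of_nonneg_left h2 (norm_nonneg _)
  exact ⟨a, ha, hnorm 0 1 (by decide), hnorm 1 2 (by decide),
    DiagLie.nonempty_equiv_of_basis b a e0 e1 e2⟩

end IsUnsolvableSl2Lattice

/-! ### Isomorphisms modulo p and uniqueness of the table entry. -/

namespace DiagLie

section Ring

variable {R : Type*} [CommRing R] {a b : Fin 3 → R}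

/-- A linear map multiplying brackets by `c` satisfies the cofactor relations. -/
theorem toMatrix'_mul_eq (f : (Fin 3 → R) →ₗ[R] (Fin 3 → R)) (c : R)
    (hf : ∀ x y, c • f (bracket a x y) = bracket b (f x) (f y)) (i j : Fin 3) :
    c * (LinearMap.toMatrix' f i j * a j) = b i * (LinearMap.toMatrix' f).adjugate j i := by
  set U := LinearMap.toMatrix' f with hU
  have hUf : ∀ x, f x = U *ᵥ x := fun x => by rw [hU, LinearMap.toMatrix'_mulVec]
  have key : ∀ x y : Fin 3 → R, x ⨯₃ y = Pi.single j 1 →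
      c * (U i j * a j) = b i * U.adjugate j i := by
    intro x y hxy
    have e := congrFun (hf x y) i
    have e1 : bracket a x y = Pi.single j (a j) := by
      funext k
      rw [bracket, hxy]
      by_cases h : k = j
      · subst h; simp
      · simp [h]
    have e2 : bracket b (f x) (f y) i = b i * U.adjugate j i := by
      rw [bracket, hUf, hUf, mulVec_cross_mulVec, hxy]
      simp
    rw [e2, e1, hUf] at e
    rw [← e]
    simp
    ring
  fin_cases j
  · exact key ![0, 1, 0] ![0, 0, 1] (by funext k; fin_cases k <;> simp [cross_apply])
  · exact key ![0, 0, 1] ![1, 0, 0] (by funext k; fin_cases k <;> simp [cross_apply])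
  · exact key ![1, 0, 0] ![0, 1, 0] (by funext k; fin_cases k <;> simp [cross_apply])

theorem exists_matrix_of_equiv (e : DiagLie a ≃ₗ⁅R⁆ DiagLie b) :
    ∃ U : Matrix (Fin 3) (Fin 3) R, IsUnit U.det ∧ ∀ i j, U i j * a j = b i * U.adjugate j i := by
  let g : (Fin 3 → R) ≃ₗ[R] (Fin 3 → R) := (e.toLinearEquiv : DiagLie a ≃ₗ[R] DiagLie b)
  refine ⟨LinearMap.toMatrix' g.toLinearMap, ?_, fun i j => ?_⟩
  · exact LinearEquiv.isUnit_det g (Pi.basisFun R (Fin 3)) (Pi.basisFun R (Fin 3))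
  · have := toMatrix'_mul_eq (a := a) (b := b) g.toLinearMap 1
      (fun x y => by rw [one_smul]; exact LieEquiv.map_lie e x y) i j
    rwa [one_mul] at this

end Ring

section Padic

open PadicInt

variable {p : ℕ} [Fact p.Prime] {s t : Fin 3 → ℕ} {α β : Fin 3 → ℤ_[p]}

/-- The reduction of the matrix of an isomorphism of diagonal lattices. -/
theorem exists_residue_matrix (hα : ∀ i, IsUnit (α i))
    (e : DiagLie (fun i => (p : ℤ_[p]) ^ s i * α i) ≃ₗ⁅ℤ_[p]⁆
      DiagLie (fun i => (p : ℤ_[p]) ^ t i * β i)) :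
    ∃ U : Matrix (Fin 3) (Fin 3) (ZMod p), U.det ≠ 0 ∧ (∀ i j, s j < t i → U i j = 0) ∧
      ∀ i j, s j = t i → U i j * toZMod (α j) = toZMod (β i) * U.adjugate j i := by
  obtain ⟨U, hU, h⟩ := exists_matrix_of_equiv e
  refine ⟨U.map toZMod, ?_, fun i j hij => ?_, fun i j hij => ?_⟩
  · have : (U.map toZMod).det = toZMod U.det := (RingHom.map_det toZMod U).symm
    rw [this]
    exact (isUnit_iff_toZMod_ne_zero _).1 hU
  · obtain ⟨k, hk⟩ : ∃ k, t i = s j + 1 + k := ⟨t i - s j - 1, by omega⟩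
    have h1 : (p : ℤ_[p]) ^ s j * (U i j * α j) =
        (p : ℤ_[p]) ^ s j * (p * (p ^ k * β i * U.adjugate j i)) := by
      rw [← sub_eq_zero]
      have := h i j
      rw [hk] at this
      linear_combination this
    have h2 := mul_left_cancel₀ (pow_ne_zero _ p_ne_zero) h1
    have h3 : toZMod (U i j * α j) = 0 := by
      rw [toZMod_eq_zero_iff, h2]
      exact dvd_mul_right _ _
    rw [map_mul, mul_eq_zero, or_iff_left ((isUnit_iff_toZMod_ne_zero _).1 (hα j))] at h3
    exact h3
  · have h1 : (p : ℤ_[p]) ^ s j * (U i j * α j) = (p : ℤ_[p]) ^ s j * (β i * U.adjugate j i) := by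
      have := h i j
      rw [← hij] at this
      linear_combination this
    have h2 := congrArg toZMod (mul_left_cancel₀ (pow_ne_zero _ p_ne_zero) h1)
    rw [map_mul, map_mul] at h2
    have h3 : (U.map toZMod).adjugate = U.adjugate.map toZMod :=
      (RingHom.map_adjugate toZMod U).symm
    rw [h3]
    exact h2

/-- If `s i < t i`, the residue matrix vanishes on the rows from i on and the columns up to i. This
zero block has four rows and columns in total, too many for a nonsingular matrix of size three. -/
theorem exponents_le (hα : ∀ i, IsUnit (α i)) (hs : Monotone s) (ht : Monotone t)
    (e : DiagLie (fun i => (p : ℤ_[p]) ^ s i * α i) ≃ₗ⁅ℤ_[p]⁆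
      DiagLie (fun i => (p : ℤ_[p]) ^ t i * β i)) (i : Fin 3) : t i ≤ s i := by
  obtain ⟨U, hU, h, -⟩ := exists_residue_matrix hα e
  by_contra! hlt
  have h0 : ∀ k l, i ≤ k → l ≤ i → U k l = 0 := fun k l hk hl =>
    h k l (((hs hl).trans_lt hlt).trans_le (ht hk))
  apply hU
  rw [Matrix.det_fin_three]
  fin_cases i
  · rw [h0 0 0 (by decide) (by decide), h0 1 0 (by decide) (by decide),
      h0 2 0 (by decide) (by decide)]
    ring
  · rw [h0 1 0 (by decide) (by decide), h0 2 0 (by decide) (by decide),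
      h0 1 1 (by decide) (by decide), h0 2 1 (by decide) (by decide)]
    ring
  · rw [h0 2 0 (by decide) (by decide), h0 2 1 (by decide) (by decide),
      h0 2 2 (by decide) (by decide)]
    ring

theorem exponents_eq (hα : ∀ i, IsUnit (α i)) (hβ : ∀ i, IsUnit (β i)) (hs : Monotone s)
    (ht : Monotone t) (e : DiagLie (fun i => (p : ℤ_[p]) ^ s i * α i) ≃ₗ⁅ℤ_[p]⁆
      DiagLie (fun i => (p : ℤ_[p]) ^ t i * β i)) : s = t :=
  funext fun i => le_antisymm (exponents_le hβ ht hs e.symm i) (exponents_le hα hs ht e i)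

/-- The residue matrix is upper triangular. Its diagonal relations U₀₀ = U₁₁U₂₂ and α₁U₁₁ = β₁U₀₀U₂₂
combine to α₁U₁₁² = β₁U₀₀², and the last coefficient is treated likewise. -/
theorem isSquare_of_equiv_distinct (hα : ∀ i, IsUnit (α i)) (h01 : s 0 < s 1) (h12 : s 1 < s 2)
    (hα0 : α 0 = 1) (hβ0 : β 0 = 1) (e : DiagLie (fun i => (p : ℤ_[p]) ^ s i * α i) ≃ₗ⁅ℤ_[p]⁆
      DiagLie (fun i => (p : ℤ_[p]) ^ s i * β i)) :
    IsSquare (toZMod (α 1) * toZMod (β 1)) ∧ IsSquare (toZMod (α 2) * toZMod (β 2)) := by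
  obtain ⟨U, hU, h0, h⟩ := exists_residue_matrix hα e
  have e0 := h 0 0 rfl
  have e1 := h 1 1 rfl
  have e2 := h 2 2 rfl
  simp only [Matrix.adjugate_fin_three, hα0, hβ0, map_one, Matrix.det_fin_three,
    h0 1 0 h01, h0 2 0 (h01.trans h12), h0 2 1 h12, Matrix.of_apply, Matrix.cons_val_zero,
    Matrix.cons_val_one, Matrix.cons_val, mul_zero, zero_mul, sub_zero, one_mul, mul_one,
    add_zero, neg_zero] at e0 e1 e2 hU
  have h11 : U 1 1 ≠ 0 := by rintro h; simp [h] at hU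
  have h22 : U 2 2 ≠ 0 := by rintro h; simp [h] at hU
  constructor
  · refine ⟨toZMod (β 1) * U 0 0 / U 1 1, ?_⟩
    field_simp
    linear_combination toZMod (β 1) * U 1 1 * e1 - toZMod (β 1) ^ 2 * U 0 0 * e0
  · refine ⟨toZMod (β 2) * U 0 0 / U 2 2, ?_⟩
    field_simp
    linear_combination toZMod (β 2) * U 2 2 * e2 - toZMod (β 2) ^ 2 * U 0 0 * e0

/-- The lower 2×2 block D satisfies D·diag(α₁, α₂) = U₀₀·diag(β₁, β₂)·cof(D); comparing determinants
gives α₁α₂ = U₀₀²β₁β₂. -/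
theorem isSquare_of_equiv_last (hα : ∀ i, IsUnit (α i)) (h01 : s 0 < s 1) (h12 : s 1 = s 2)
    (e : DiagLie (fun i => (p : ℤ_[p]) ^ s i * α i) ≃ₗ⁅ℤ_[p]⁆
      DiagLie (fun i => (p : ℤ_[p]) ^ s i * β i)) :
    IsSquare (toZMod (α 1) * toZMod (α 2) * (toZMod (β 1) * toZMod (β 2))) := by
  obtain ⟨U, hU, h0, h⟩ := exists_residue_matrix hα e
  have e11 := h 1 1 rfl
  have e12 := h 1 2 h12.symm
  have e21 := h 2 1 h12
  have e22 := h 2 2 rfl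
  simp only [Matrix.adjugate_fin_three, Matrix.det_fin_three,
    h0 1 0 h01, h0 2 0 (h12 ▸ h01), Matrix.of_apply, Matrix.cons_val_zero,
    Matrix.cons_val_one, Matrix.cons_val, mul_zero, zero_mul, sub_zero,
    add_zero, neg_zero] at e11 e12 e21 e22 hU
  have hD : U 1 1 * U 2 2 - U 1 2 * U 2 1 ≠ 0 := by
    intro hD
    apply hU
    linear_combination U 0 0 * hD
  refine ⟨toZMod (β 1) * toZMod (β 2) * U 0 0, ?_⟩
  apply mul_right_cancel₀ hD
  linear_combination toZMod (β 1) * toZMod (β 2) * (toZMod (α 2) * U 2 2 * e11 +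
    toZMod (β 1) * U 0 0 * U 2 2 * e22 - toZMod (α 2) * U 1 2 * e21 +
    toZMod (β 2) * U 0 0 * U 1 2 * e12)

theorem isSquare_of_equiv_first (hα : ∀ i, IsUnit (α i)) (h01 : s 0 = s 1) (h12 : s 1 < s 2)
    (e : DiagLie (fun i => (p : ℤ_[p]) ^ s i * α i) ≃ₗ⁅ℤ_[p]⁆
      DiagLie (fun i => (p : ℤ_[p]) ^ s i * β i)) :
    IsSquare (toZMod (α 0) * toZMod (α 1) * (toZMod (β 0) * toZMod (β 1))) := by
  obtain ⟨U, hU, h0, h⟩ := exists_residue_matrix hα e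
  have e00 := h 0 0 rfl
  have e01 := h 0 1 h01.symm
  have e10 := h 1 0 h01
  have e11 := h 1 1 rfl
  simp only [Matrix.adjugate_fin_three, Matrix.det_fin_three,
    h0 2 0 (h01 ▸ h12), h0 2 1 h12, Matrix.of_apply, Matrix.cons_val_zero,
    Matrix.cons_val_one, mul_zero, sub_zero,
    add_zero, neg_zero] at e00 e01 e10 e11 hU
  have hD : U 0 0 * U 1 1 - U 0 1 * U 1 0 ≠ 0 := by
    intro hD
    apply hU
    linear_combination U 2 2 * hD
  refine ⟨toZMod (β 0) * toZMod (β 1) * U 2 2, ?_⟩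
  apply mul_right_cancel₀ hD
  linear_combination toZMod (β 0) * toZMod (β 1) * (toZMod (α 1) * U 1 1 * e00 +
    toZMod (β 0) * U 2 2 * U 1 1 * e11 - toZMod (α 1) * U 0 1 * e10 +
    toZMod (β 1) * U 2 2 * U 0 1 * e01)

end Padic

end DiagLie

namespace TableEntry

open PadicInt

/-- The exponents of the diagonal entries. -/
def exponents : TableEntry → Fin 3 → ℕ
  | line1 s₀ => ![s₀, s₀, s₀]
  | line2 s₀ s₁ => ![s₀, s₁, s₁]
  | line3 s₀ s₁ => ![s₀, s₁, s₁]
  | line4 s₀ s₂ => ![s₀, s₀, s₂]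
  | line5 s₀ s₂ => ![s₀, s₀, s₂]
  | line6 s₀ s₁ s₂ _ _ => ![s₀, s₁, s₂]
  | line7 s₀ s₁ s₂ _ _ => ![s₀, s₁, s₂]
  | line8 s₀ s₁ s₂ _ _ => ![s₀, s₁, s₂]
  | line9 s₀ s₁ s₂ _ _ => ![s₀, s₁, s₂]

theorem monotone_exponents {p : ℕ} {t : TableEntry} (ht : t.Valid p) : Monotone t.exponents := by
  rw [Fin.monotone_iff_le_succ]
  intro i
  cases t <;> fin_cases i <;> simp [exponents] <;> simp [Valid] at ht <;> omega

variable {p : ℕ} [Fact p.Prime]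

/-- The unit parts of the diagonal entries. -/
noncomputable def unitParts (ρ : ℤ_[p]) : TableEntry → Fin 3 → ℤ_[p]
  | line1 _ => ![1, 1, 1]
  | line2 _ _ => ![1, 1, -1]
  | line3 _ _ => ![1, 1, -ρ]
  | line4 _ _ => ![1, -1, 1]
  | line5 _ _ => ![1, -ρ, 1]
  | line6 _ _ _ ε₁ ε₂ => ![1, ρ ^ ε₁.val, ρ ^ ε₂.val]
  | line7 _ _ _ ε₁ ε₂ => ![1, ρ ^ ε₁.val, ρ ^ ε₂.val]
  | line8 _ _ _ ε₁ ε₂ => ![1, ρ ^ ε₁.val, ρ ^ ε₂.val]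
  | line9 _ _ _ ε₁ ε₂ => ![1, ρ ^ ε₁.val, ρ ^ ε₂.val]

theorem diag_eq (ρ : ℤ_[p]) (t : TableEntry) :
    t.diag ρ = fun i => (p : ℤ_[p]) ^ t.exponents i * t.unitParts ρ i := by
  funext i
  cases t <;> fin_cases i <;> simp [diag, exponents, unitParts, mul_comm]

theorem isUnit_unitParts {ρ : ℤ_[p]} (hρu : IsUnit ρ) (t : TableEntry) (i : Fin 3) :
    IsUnit (t.unitParts ρ i) := by
  cases t <;> fin_cases i <;> simp [unitParts, hρu, hρu.pow]

theorem unitParts_zero (ρ : ℤ_[p]) (t : TableEntry) : t.unitParts ρ 0 = 1 := by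
  cases t <;> rfl

theorem diag_ne_zero {ρ : ℤ_[p]} (hρu : IsUnit ρ) (t : TableEntry) (i : Fin 3) :
    t.diag ρ i ≠ 0 := by
  rw [diag_eq]
  exact mul_ne_zero (pow_ne_zero _ p_ne_zero) (isUnit_unitParts hρu t i).ne_zero

theorem eq_of_isSquare_pow_mul_pow {r : ZMod p} (hr : ¬ IsSquare r) {ε ε' : Fin 2}
    (h : IsSquare (r ^ ε.val * r ^ ε'.val)) : ε = ε' := by
  fin_cases ε <;> fin_cases ε' <;> simp at h ⊢ <;> exact hr h

/-- Isomorphic entries of the table coincide. -/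
theorem eq_of_equiv {ρ : ℤ_[p]} (hρu : IsUnit ρ) (hρ : ¬ IsSquare (toZMod ρ)) {t t' : TableEntry}
    (ht : t.Valid p) (ht' : t'.Valid p) (e : t.Lattice ρ ≃ₗ⁅ℤ_[p]⁆ t'.Lattice ρ) : t = t' := by
  unfold Lattice at e
  rw [diag_eq, diag_eq] at e
  have hs := DiagLie.exponents_eq (isUnit_unitParts hρu t) (isUnit_unitParts hρu t')
    (monotone_exponents ht) (monotone_exponents ht') e
  rw [← hs] at e
  have hu := isUnit_unitParts hρu t
  have hD := fun h1 h2 => DiagLie.isSquare_of_equiv_distinct hu h1 h2 (unitParts_zero ρ t)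
    (unitParts_zero ρ t') e
  have hL := fun h1 h2 => DiagLie.isSquare_of_equiv_last hu h1 h2 e
  have hF := fun h1 h2 => DiagLie.isSquare_of_equiv_first hu h1 h2 e
  clear e hu
  have s0 := congrFun hs 0
  have s1 := congrFun hs 1
  have s2 := congrFun hs 2
  clear hs
  have hdist : ∀ {s₀ s₁ s₂ : ℕ} {ε₁ ε₂ ε₁' ε₂' : Fin 2}, s₀ < s₁ → s₁ < s₂ →
      (s₀ < s₁ → s₁ < s₂ → IsSquare (toZMod (ρ ^ ε₁.val) * toZMod (ρ ^ ε₁'.val))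
      ∧ IsSquare (toZMod (ρ ^ ε₂.val) * toZMod (ρ ^ ε₂'.val))) →
      ε₁ = ε₁' ∧ ε₂ = ε₂' := by
    intro s₀ s₁ s₂ ε₁ ε₂ ε₁' ε₂' h1 h2 h
    have := h h1 h2
    simp only [map_pow] at this
    exact ⟨eq_of_isSquare_pow_mul_pow hρ this.1, eq_of_isSquare_pow_mul_pow hρ this.2⟩
  cases t <;> cases t' <;>
    simp only [exponents, unitParts, Valid, Nat.ModEq, Matrix.cons_val_zero, Matrix.cons_val_one,
      Matrix.cons_val, map_one, map_neg, one_mul, mul_neg, neg_mul, neg_neg, mul_one]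
      at s0 s1 s2 ht ht' hD hL hF <;>
    subst_vars
  all_goals first
    | rfl
    | exact absurd ht (by omega)
    | exact absurd ht' (by omega)
    | exact absurd (hL ht.1 trivial) hρ
    | exact absurd (hL ht trivial) hρ
    | exact absurd (hF trivial ht.1) hρ
    | exact absurd (hF trivial ht) hρ
    | (obtain ⟨rfl, rfl⟩ := hdist ht.1 ht.2.1 hD; rfl)

end TableEntry

/-! ### Simple virtual endomorphisms of hyperbolic sublattices: the upper bounds. -/

theorem AddSubgroup.index_le_of_ker_le {A B : Type*} [AddGroup A] [AddGroup B] [Finite B]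
    (f : A →+ B) (H : AddSubgroup A) (h : f.ker ≤ H) : H.index ≠ 0 ∧ H.index ≤ Nat.card B := by
  have h1 : f.ker.index = Nat.card f.range := AddSubgroup.index_ker f
  have h2 : Nat.card f.range ≤ Nat.card B :=
    Nat.card_le_card_of_injective _ (Subtype.val_injective)
  have h3 : f.ker.FiniteIndex := ⟨by rw [h1]; exact Nat.card_pos.ne'⟩
  have h4 : H.FiniteIndex := AddSubgroup.finiteIndex_of_le h
  exact ⟨h4.index_ne_zero, (AddSubgroup.index_antitone h).trans (h1 ▸ h2)⟩

theorem AddSubgroup.index_range_comp {A B C : Type*} [AddGroup A] [AddGroup B] [AddGroup C]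
    (f : A →+ B) (g : B →+ C) (hg : Function.Injective g) :
    (g.comp f).range.index = f.range.index * g.range.index := by
  rw [← AddMonoidHom.map_range, AddSubgroup.index_map_of_injective _ hg]

/-- The virtual endomorphism `ψ' ∘ ψ⁻¹` on the range of `ψ` is simple if it divides some vector
outside its domain by `p`. -/
theorem isSelfSimilarOfIndex_of_homs {p : ℕ} [Fact p.Prime] {K L : Type*} [LieRing K]
    [LieAlgebra ℤ_[p] K] [LieRing L] [LieAlgebra ℤ_[p] L] (ψ ψ' : K →ₗ⁅ℤ_[p]⁆ L)
    (hinj : Function.Injective ψ) (hrank : Module.finrank ℤ_[p] K = Module.finrank ℤ_[p] L)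
    (hidx : ((ψ : K →ₗ[ℤ_[p]] L) : K →+ L).range.index ≠ 0) {w : L} (hw : ∀ x, ψ x ≠ w) {k : K}
    (h1 : ψ k = (p : ℤ_[p]) • w) (h2 : ψ' k = w)
    (hI : ∀ I : LieIdeal ℤ_[p] L, I ≠ ⊥ → ∃ n : ℕ, (p : ℤ_[p]) ^ n • w ∈ I) :
    IsSelfSimilarOfIndex p L ((ψ : K →ₗ[ℤ_[p]] L) : K →+ L).range.index := by
  let E := LieEquiv.ofInjective ψ hinj
  refine ⟨Nat.one_le_iff_ne_zero.2 hidx, ⟨ψ.range, ?_, ψ'.comp E.symm.toLieHom⟩, ?_, ?_⟩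
  · rw [← hrank]
    exact E.toLinearEquiv.finrank_eq.symm
  · unfold VirtualEndomorphism.index
    congr 1
  · intro I hinv
    by_contra hbot
    have hE : ∀ (x : K) (h : ψ x ∈ ψ.range), E.symm ⟨ψ x, h⟩ = x := by
      intro x h
      have : E x = ⟨ψ x, h⟩ := rfl
      rw [← this, LieEquiv.symm_apply_apply]
    have hφ : ∀ x : K, ψ x ∈ I → ψ' x ∈ I := by
      intro x hx
      obtain ⟨hdom, hmem⟩ := hinv _ hx
      have e : ψ' (E.symm ⟨ψ x, hdom⟩) ∈ I := hmem
      rwa [hE] at e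
    -- The endomorphism sends pⁿ⁺¹w = ψ(pⁿk) to pⁿw, so an invariant ideal can be divided by p along
    -- w until it contains w, which is outside the domain.
    have hdesc : ∀ n : ℕ, (p : ℤ_[p]) ^ n • w ∈ I → w ∈ I := by
      intro n
      induction n with
      | zero => intro h; simpa using h
      | succ n ih =>
        intro h
        apply ih
        have e1 : ψ ((p : ℤ_[p]) ^ n • k) ∈ I := by
          rw [map_smul, h1, smul_smul, ← pow_succ]
          exact h
        have e2 := hφ _ e1
        rwa [map_smul, h2] at e2
    obtain ⟨n, hn⟩ := hI I hbot
    obtain ⟨⟨x, hx⟩, -⟩ := hinv w (hdesc n hn)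
    exact hw x hx

namespace DiagLie

variable {p : ℕ} [Fact p.Prime]

open PadicInt

/-- Bracketing with basis vectors isolates one nonzero coordinate and moves it to the first axis;
bracketing again reaches the other axes. Hence the submodule contains a nonzero multiple of the
whole lattice. -/
theorem exists_pow_smul_mem_submodule {a : Fin 3 → ℤ_[p]} (ha : ∀ i, a i ≠ 0)
    (S : Submodule ℤ_[p] (Fin 3 → ℤ_[p])) (hS : ∀ x y, y ∈ S → bracket a x y ∈ S) (hbot : S ≠ ⊥) :
    ∃ n : ℕ, ∀ v, (p : ℤ_[p]) ^ n • v ∈ S := by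
  obtain ⟨y, hy, hy0⟩ := Submodule.exists_mem_ne_zero_of_ne_bot hbot
  have h0 : ∃ c : ℤ_[p], c ≠ 0 ∧ ![c, 0, 0] ∈ S := by
    by_cases y1 : y 1 = 0
    · by_cases y2 : y 2 = 0
      · have y0 : y 0 ≠ 0 := by
          intro y0
          apply hy0
          funext i
          fin_cases i <;> assumption
        refine ⟨-(a 1 * a 2 * y 0 * a 0), by simp [ha, y0], ?_⟩
        have := hS ![0, 0, 1] _ (hS ![1, 0, 0] _ (hS ![0, 1, 0] y hy))
        convert this using 1
        funext i
        fin_cases i <;> simp [bracket_eq]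
        ring
      · refine ⟨a 0 * a 1 * y 2, by simp [ha, y2], ?_⟩
        have := hS ![0, 0, 1] _ (hS ![1, 0, 0] y hy)
        convert this using 1
        funext i
        fin_cases i <;> simp [bracket_eq]
        ring
    · refine ⟨a 0 * a 2 * y 1, by simp [ha, y1], ?_⟩
      have := hS ![0, 1, 0] _ (hS ![1, 0, 0] y hy)
      convert this using 1
      funext i
      fin_cases i <;> simp [bracket_eq]
      ring
  obtain ⟨c, hc, h⟩ := h0
  have hC : c * a 1 * a 2 ≠ 0 := by simp [hc, ha]
  have hall : ∀ v, (c * a 1 * a 2) • v ∈ S := by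
    intro v
    have e0 := S.smul_mem (v 0 * a 1 * a 2) h
    have e1 := S.smul_mem (v 1 * a 2) (hS ![0, 0, 1] _ h)
    have e2 := S.smul_mem (v 2 * a 1) (hS ![0, -1, 0] _ h)
    convert S.add_mem (S.add_mem e0 e1) e2 using 1
    funext i
    fin_cases i <;> simp [bracket_eq] <;> ring
  refine ⟨(c * a 1 * a 2).valuation, fun v => ?_⟩
  have hu := unitCoeff_spec hC
  have e := hall ((↑(unitCoeff hC)⁻¹ : ℤ_[p]) • v)
  have hi : (↑(unitCoeff hC) : ℤ_[p]) * ↑(unitCoeff hC)⁻¹ = 1 := Units.mul_inv _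
  have hp : c * a 1 * a 2 * ↑(unitCoeff hC)⁻¹ = (p : ℤ_[p]) ^ (c * a 1 * a 2).valuation := by
    linear_combination (↑(unitCoeff hC)⁻¹ : ℤ_[p]) * hu +
      (p : ℤ_[p]) ^ (c * a 1 * a 2).valuation * hi
  rwa [smul_smul, hp] at e

theorem exists_pow_smul_mem {L : Type*} [LieRing L] [LieAlgebra ℤ_[p] L] {a : Fin 3 → ℤ_[p]}
    (ha : ∀ i, a i ≠ 0) (e : L ≃ₗ⁅ℤ_[p]⁆ DiagLie a) (I : LieIdeal ℤ_[p] L) (hI : I ≠ ⊥) :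
    ∃ n : ℕ, ∀ w, (p : ℤ_[p]) ^ n • w ∈ I := by
  let g : (Fin 3 → ℤ_[p]) ≃ₗ[ℤ_[p]] L := (e.symm.toLinearEquiv : DiagLie a ≃ₗ[ℤ_[p]] L)
  have hg : ∀ x y, g (bracket a x y) = ⁅g x, g y⁆ := fun x y => LieEquiv.map_lie e.symm x y
  obtain ⟨n, hn⟩ := exists_pow_smul_mem_submodule ha (I.toSubmodule.comap g.toLinearMap)
    (fun x y hy => by
      change g (bracket a x y) ∈ I
      rw [hg]
      exact lie_mem_right ℤ_[p] L I _ _ hy)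
    (fun h => hI (by
      rw [LieSubmodule.eq_bot_iff]
      intro x hx
      have : g.symm x ∈ I.toSubmodule.comap g.toLinearMap := by
        change g (g.symm x) ∈ I
        rwa [LinearEquiv.apply_symm_apply]
      rw [h, Submodule.mem_bot] at this
      simpa using this))
  refine ⟨n, fun w => ?_⟩
  have : g ((p : ℤ_[p]) ^ n • g.symm w) ∈ I := hn (g.symm w)
  rwa [map_smul, LinearEquiv.apply_symm_apply] at this

/-- The first of two embeddings of a sublattice of index `p` in a hyperbolic lattice. -/
noncomputable def hyperbolicHom (b c q : ℤ_[p]) (hq : (p : ℤ_[p]) = 2 * q + 1) :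
    DiagLie ![p * b, c, -c] →ₗ⁅ℤ_[p]⁆ DiagLie ![b, c, -c] :=
  -- The matrix fixes x₁ + x₂ and multiplies x₁ - x₂ by 2q + 1 = p; the matrix of `hyperbolicHom'`
  -- exchanges these roles.
  homOfMatrix _ _ !![1, 0, 0; 0, q + 1, -q; 0, -q, q + 1] (by
    intro i j
    rw [Matrix.adjugate_fin_three]
    fin_cases i <;> fin_cases j <;> simp [hq] <;> ring)

/-- The second of two embeddings of a sublattice of index `p` in a hyperbolic lattice. -/
noncomputable def hyperbolicHom' (b c q : ℤ_[p]) (hq : (p : ℤ_[p]) = 2 * q + 1) :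
    DiagLie ![p * b, c, -c] →ₗ⁅ℤ_[p]⁆ DiagLie ![b, c, -c] :=
  homOfMatrix _ _ !![1, 0, 0; 0, q + 1, q; 0, q, q + 1] (by
    intro i j
    rw [Matrix.adjugate_fin_three]
    fin_cases i <;> fin_cases j <;> simp [hq] <;> ring)

theorem hyperbolicHom_apply (b c q : ℤ_[p]) (hq : (p : ℤ_[p]) = 2 * q + 1) (x : Fin 3 → ℤ_[p]) :
    (hyperbolicHom b c q hq x : Fin 3 → ℤ_[p]) =
      ![x 0, (q + 1) * x 1 - q * x 2, (q + 1) * x 2 - q * x 1] := by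
  refine (homOfMatrix_apply _ _ _ _ x).trans ?_
  funext i
  fin_cases i <;> simp [Matrix.mulVec, dotProduct, Fin.sum_univ_three] <;> ring

theorem hyperbolicHom'_apply (b c q : ℤ_[p]) (hq : (p : ℤ_[p]) = 2 * q + 1) (x : Fin 3 → ℤ_[p]) :
    (hyperbolicHom' b c q hq x : Fin 3 → ℤ_[p]) =
      ![x 0, (q + 1) * x 1 + q * x 2, (q + 1) * x 2 + q * x 1] := by
  refine (homOfMatrix_apply _ _ _ _ x).trans ?_
  funext i
  fin_cases i <;> simp [Matrix.mulVec, dotProduct, Fin.sum_univ_three]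
  ring

theorem hyperbolicHom_injective (b c q : ℤ_[p]) (hq : (p : ℤ_[p]) = 2 * q + 1) :
    Function.Injective (hyperbolicHom b c q hq) := by
  rw [injective_iff_map_eq_zero]
  intro x hx
  have h := hyperbolicHom_apply b c q hq x
  have hx' : (hyperbolicHom b c q hq x : Fin 3 → ℤ_[p]) = 0 := hx
  rw [hx'] at h
  have e0 : 0 = x 0 := congrFun h 0
  have e1 : 0 = (q + 1) * x 1 - q * x 2 := congrFun h 1
  have e2 : 0 = (q + 1) * x 2 - q * x 1 := congrFun h 2
  have z1 : x 1 = 0 := by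
    have : (p : ℤ_[p]) * x 1 = 0 := by
      rw [hq]
      linear_combination -(q + 1) * e1 - q * e2
    exact (mul_eq_zero.1 this).resolve_left p_ne_zero
  have z2 : x 2 = 0 := by
    have : (p : ℤ_[p]) * x 2 = 0 := by
      rw [hq]
      linear_combination -(q + 1) * e2 - q * e1
    exact (mul_eq_zero.1 this).resolve_left p_ne_zero
  funext i
  fin_cases i
  · exact e0.symm
  · exact z1
  · exact z2

/-- The image contains every vector whose last two coordinates are congruent modulo p; the inverse
matrix is integral on such vectors. -/
theorem index_range_hyperbolicHom (b c q : ℤ_[p]) (hq : (p : ℤ_[p]) = 2 * q + 1) :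
    ((hyperbolicHom b c q hq : DiagLie ![p * b, c, -c] →ₗ[ℤ_[p]] DiagLie ![b, c, -c]) :
      DiagLie ![p * b, c, -c] →+ DiagLie ![b, c, -c]).range.index ≠ 0 ∧
    ((hyperbolicHom b c q hq : DiagLie ![p * b, c, -c] →ₗ[ℤ_[p]] DiagLie ![b, c, -c]) :
      DiagLie ![p * b, c, -c] →+ DiagLie ![b, c, -c]).range.index ≤ p := by
  let f : DiagLie ![b, c, -c] →+ ZMod p :=
    { toFun := fun x => toZMod ((x : Fin 3 → ℤ_[p]) 1 - (x : Fin 3 → ℤ_[p]) 2)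
      map_zero' := by
        change toZMod ((0 : Fin 3 → ℤ_[p]) 1 - (0 : Fin 3 → ℤ_[p]) 2) = 0
        simp
      map_add' := fun x y => by
        change toZMod ((x : Fin 3 → ℤ_[p]) 1 + (y : Fin 3 → ℤ_[p]) 1 -
          ((x : Fin 3 → ℤ_[p]) 2 + (y : Fin 3 → ℤ_[p]) 2)) = _
        rw [← map_add]
        congr 1
        ring }
  have := AddSubgroup.index_le_of_ker_le f
    ((hyperbolicHom b c q hq : DiagLie ![p * b, c, -c] →ₗ[ℤ_[p]] DiagLie ![b, c, -c]) :
      DiagLie ![p * b, c, -c] →+ DiagLie ![b, c, -c]).range (by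
    intro x hx
    have hx' : toZMod ((x : Fin 3 → ℤ_[p]) 1 - (x : Fin 3 → ℤ_[p]) 2) = 0 := hx
    obtain ⟨t, ht⟩ := (toZMod_eq_zero_iff _).1 hx'
    refine ⟨(![x 0, x 2 + (q + 1) * t, x 1 - (q + 1) * t] : Fin 3 → ℤ_[p]), ?_⟩
    refine (hyperbolicHom_apply b c q hq _).trans ?_
    rw [hq] at ht
    funext i
    fin_cases i
    · simp
    · simp
      linear_combination -(q + 1) * ht
    · simp
      linear_combination (q + 1) * ht)
  rwa [Nat.card_zmod] at this

/-- The embedding of diagonal lattices along the coordinate axes. -/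
noncomputable def axisHom (a b : Fin 3 → ℤ_[p]) (m₀ m₁ m₂ : ℕ)
    (h₀ : (p : ℤ_[p]) ^ m₀ * b 0 = a 0 * p ^ (m₁ + m₂))
    (h₁ : (p : ℤ_[p]) ^ m₁ * b 1 = a 1 * p ^ (m₀ + m₂))
    (h₂ : (p : ℤ_[p]) ^ m₂ * b 2 = a 2 * p ^ (m₀ + m₁)) : DiagLie b →ₗ⁅ℤ_[p]⁆ DiagLie a :=
  homOfMatrix _ _ !![(p : ℤ_[p]) ^ m₀, 0, 0; 0, p ^ m₁, 0; 0, 0, p ^ m₂] (by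
    intro i j
    rw [Matrix.adjugate_fin_three]
    fin_cases i <;> fin_cases j <;> simp [h₀, h₁, h₂, pow_add])

section axisHom

variable (a b : Fin 3 → ℤ_[p]) (m₀ m₁ m₂ : ℕ)
    (h₀ : (p : ℤ_[p]) ^ m₀ * b 0 = a 0 * p ^ (m₁ + m₂))
    (h₁ : (p : ℤ_[p]) ^ m₁ * b 1 = a 1 * p ^ (m₀ + m₂))
    (h₂ : (p : ℤ_[p]) ^ m₂ * b 2 = a 2 * p ^ (m₀ + m₁))

theorem axisHom_apply (x : Fin 3 → ℤ_[p]) :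
    (axisHom a b m₀ m₁ m₂ h₀ h₁ h₂ x : Fin 3 → ℤ_[p]) =
      ![p ^ m₀ * x 0, p ^ m₁ * x 1, p ^ m₂ * x 2] := by
  refine (homOfMatrix_apply _ _ _ _ x).trans ?_
  funext i
  fin_cases i <;> simp [Matrix.mulVec, dotProduct, Fin.sum_univ_three]

theorem axisHom_injective : Function.Injective (axisHom a b m₀ m₁ m₂ h₀ h₁ h₂) := by
  rw [injective_iff_map_eq_zero]
  intro x hx
  have h := axisHom_apply a b m₀ m₁ m₂ h₀ h₁ h₂ x
  have hx' : (axisHom a b m₀ m₁ m₂ h₀ h₁ h₂ x : Fin 3 → ℤ_[p]) = 0 := hx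
  rw [hx'] at h
  have e0 : 0 = p ^ m₀ * x 0 := congrFun h 0
  have e1 : 0 = p ^ m₁ * x 1 := congrFun h 1
  have e2 : 0 = p ^ m₂ * x 2 := congrFun h 2
  funext i
  fin_cases i
  · exact (mul_eq_zero.1 e0.symm).resolve_left (pow_ne_zero _ p_ne_zero)
  · exact (mul_eq_zero.1 e1.symm).resolve_left (pow_ne_zero _ p_ne_zero)
  · exact (mul_eq_zero.1 e2.symm).resolve_left (pow_ne_zero _ p_ne_zero)

theorem index_range_axisHom :
    ((axisHom a b m₀ m₁ m₂ h₀ h₁ h₂ : DiagLie b →ₗ[ℤ_[p]] DiagLie a) :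
      DiagLie b →+ DiagLie a).range.index ≠ 0 ∧
    ((axisHom a b m₀ m₁ m₂ h₀ h₁ h₂ : DiagLie b →ₗ[ℤ_[p]] DiagLie a) :
      DiagLie b →+ DiagLie a).range.index ≤ p ^ m₀ * (p ^ m₁ * p ^ m₂) := by
  let f : DiagLie a →+ ZMod (p ^ m₀) × ZMod (p ^ m₁) × ZMod (p ^ m₂) :=
    { toFun := fun x => (toZModPow m₀ ((x : Fin 3 → ℤ_[p]) 0),
        toZModPow m₁ ((x : Fin 3 → ℤ_[p]) 1), toZModPow m₂ ((x : Fin 3 → ℤ_[p]) 2))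
      map_zero' := by
        change (toZModPow m₀ ((0 : Fin 3 → ℤ_[p]) 0), toZModPow m₁ ((0 : Fin 3 → ℤ_[p]) 1),
          toZModPow m₂ ((0 : Fin 3 → ℤ_[p]) 2)) = 0
        simp
      map_add' := fun x y => by
        change (toZModPow m₀ ((x : Fin 3 → ℤ_[p]) 0 + (y : Fin 3 → ℤ_[p]) 0),
          toZModPow m₁ ((x : Fin 3 → ℤ_[p]) 1 + (y : Fin 3 → ℤ_[p]) 1),
          toZModPow m₂ ((x : Fin 3 → ℤ_[p]) 2 + (y : Fin 3 → ℤ_[p]) 2)) = _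
        simp only [map_add]
        rfl }
  have : ∀ m, NeZero (p ^ m) := fun m => ⟨pow_ne_zero m (Fact.out : p.Prime).ne_zero⟩
  have hdvd : ∀ m (z : ℤ_[p]), toZModPow m z = 0 → ∃ t, z = p ^ m * t := by
    intro m z hz
    have : z ∈ RingHom.ker (toZModPow m : ℤ_[p] →+* ZMod (p ^ m)) := hz
    rw [ker_toZModPow, Ideal.mem_span_singleton] at this
    exact this
  have := AddSubgroup.index_le_of_ker_le f
    ((axisHom a b m₀ m₁ m₂ h₀ h₁ h₂ : DiagLie b →ₗ[ℤ_[p]] DiagLie a) :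
      DiagLie b →+ DiagLie a).range (by
    intro x hx
    have hx' : (toZModPow m₀ ((x : Fin 3 → ℤ_[p]) 0),
        toZModPow m₁ ((x : Fin 3 → ℤ_[p]) 1), toZModPow m₂ ((x : Fin 3 → ℤ_[p]) 2)) = 0 := hx
    rw [Prod.mk_eq_zero, Prod.mk_eq_zero] at hx'
    obtain ⟨t₀, e0⟩ := hdvd _ _ hx'.1
    obtain ⟨t₁, e1⟩ := hdvd _ _ hx'.2.1
    obtain ⟨t₂, e2⟩ := hdvd _ _ hx'.2.2
    refine ⟨(![t₀, t₁, t₂] : Fin 3 → ℤ_[p]), ?_⟩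
    refine (axisHom_apply a b m₀ m₁ m₂ h₀ h₁ h₂ _).trans ?_
    funext i
    fin_cases i
    · exact e0.symm
    · exact e1.symm
    · exact e2.symm)
  simpa only [Nat.card_prod, Nat.card_zmod] using this

end axisHom

theorem finrank_eq (a : Fin 3 → ℤ_[p]) : Module.finrank ℤ_[p] (DiagLie a) = 3 :=
  (Module.finrank_fin_fun ℤ_[p] : Module.finrank ℤ_[p] (Fin 3 → ℤ_[p]) = 3)

/-- A lattice with a hyperbolic sublattice spanned by multiples of its diagonal basis has a simple
virtual endomorphism of controlled index. -/
theorem exists_isSelfSimilarOfIndex_le (hp : 3 ≤ p) {L : Type*} [LieRing L] [LieAlgebra ℤ_[p] L]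
    (a b : Fin 3 → ℤ_[p]) (ha : ∀ i, a i ≠ 0) (e : L ≃ₗ⁅ℤ_[p]⁆ DiagLie a) (m₀ m₁ m₂ : ℕ)
    (h₀ : (p : ℤ_[p]) ^ m₀ * b 0 = a 0 * p ^ (m₁ + m₂))
    (h₁ : (p : ℤ_[p]) ^ m₁ * b 1 = a 1 * p ^ (m₀ + m₂))
    (h₂ : (p : ℤ_[p]) ^ m₂ * b 2 = a 2 * p ^ (m₀ + m₁)) (c d : ℤ_[p])
    (hb : Nonempty (DiagLie ![c, d, -d] ≃ₗ⁅ℤ_[p]⁆ DiagLie b)) :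
    ∃ n ≤ p ^ (m₀ + m₁ + m₂ + 1), IsSelfSimilarOfIndex p L n := by
  obtain ⟨e'⟩ := hb
  obtain ⟨q, hq⟩ : ∃ q : ℤ_[p], (p : ℤ_[p]) = 2 * q + 1 := by
    have hodd : p = 2 * (p / 2) + 1 := by
      rcases (Fact.out : p.Prime).eq_two_or_odd with h | h <;> omega
    refine ⟨((p / 2 : ℕ) : ℤ_[p]), ?_⟩
    have := congrArg (Nat.cast : ℕ → ℤ_[p]) hodd
    simpa only [Nat.cast_add, Nat.cast_mul, Nat.cast_ofNat, Nat.cast_one] using this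
  let g : DiagLie ![c, d, -d] →ₗ⁅ℤ_[p]⁆ L :=
    e.symm.toLieHom.comp ((axisHom a b m₀ m₁ m₂ h₀ h₁ h₂).comp e'.toLieHom)
  have hg : Function.Injective g :=
    e.symm.injective.comp ((axisHom_injective a b m₀ m₁ m₂ h₀ h₁ h₂).comp e'.injective)
  let ψ := hyperbolicHom c d q hq
  let ψ' := hyperbolicHom' c d q hq
  have hidx : ((g.comp ψ : DiagLie ![p * c, d, -d] →ₗ[ℤ_[p]] L) :
      DiagLie ![p * c, d, -d] →+ L).range.index ≠ 0 ∧
      ((g.comp ψ : DiagLie ![p * c, d, -d] →ₗ[ℤ_[p]] L) :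
      DiagLie ![p * c, d, -d] →+ L).range.index ≤ p ^ (m₀ + m₁ + m₂ + 1) := by
    have i1 := index_range_hyperbolicHom c d q hq
    have i2 := index_range_axisHom a b m₀ m₁ m₂ h₀ h₁ h₂
    set A1 : DiagLie ![p * c, d, -d] →+ DiagLie ![c, d, -d] :=
      ((hyperbolicHom c d q hq : DiagLie ![p * c, d, -d] →ₗ[ℤ_[p]] DiagLie ![c, d, -d]) :
      DiagLie ![p * c, d, -d] →+ DiagLie ![c, d, -d])
    set A2 : DiagLie b →+ DiagLie a :=
      ((axisHom a b m₀ m₁ m₂ h₀ h₁ h₂ : DiagLie b →ₗ[ℤ_[p]] DiagLie a) : DiagLie b →+ DiagLie a)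
      with hA2
    let A3 : DiagLie ![c, d, -d] →+ DiagLie b := e'.toLinearEquiv.toLinearMap.toAddMonoidHom
    let A4 : DiagLie a →+ L := e.symm.toLinearEquiv.toLinearMap.toAddMonoidHom
    have hA3 : A3.range = ⊤ := AddMonoidHom.range_eq_top.2 e'.surjective
    have hA4 : A4.range = ⊤ := AddMonoidHom.range_eq_top.2 e.symm.surjective
    have hcomp : ((g.comp ψ : DiagLie ![p * c, d, -d] →ₗ[ℤ_[p]] L) :
      DiagLie ![p * c, d, -d] →+ L) = A4.comp (A2.comp (A3.comp A1)) := rfl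
    rw [hcomp, AddSubgroup.index_range_comp _ _ e.symm.injective, AddSubgroup.index_range_comp _ _
      (axisHom_injective a b m₀ m₁ m₂ h₀ h₁ h₂), AddSubgroup.index_range_comp _ _ e'.injective, hA3,
      hA4, AddSubgroup.index_top, AddSubgroup.index_top, mul_one, mul_one]
    refine ⟨mul_ne_zero i1.1 i2.1, (Nat.mul_le_mul i1.2 i2.2).trans_eq ?_⟩
    ring
  -- The isotropic vector x₁ - x₂ is an eigenvector of both maps, with eigenvalue p for `ψ` and 1
  -- for `ψ'`.
  let v : DiagLie ![c, d, -d] := (![0, 1, -1] : Fin 3 → ℤ_[p])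
  let k : DiagLie ![p * c, d, -d] := (![0, 1, -1] : Fin 3 → ℤ_[p])
  have hk : ψ k = (p : ℤ_[p]) • v := by
    refine (hyperbolicHom_apply c d q hq (![0, 1, -1] : Fin 3 → ℤ_[p])).trans ?_
    change _ = (p : ℤ_[p]) • (![0, 1, -1] : Fin 3 → ℤ_[p])
    rw [hq]
    funext i
    fin_cases i <;> simp <;> ring
  have hk' : ψ' k = v := by
    refine (hyperbolicHom'_apply c d q hq (![0, 1, -1] : Fin 3 → ℤ_[p])).trans ?_
    change _ = (![0, 1, -1] : Fin 3 → ℤ_[p])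
    funext i
    fin_cases i <;> simp
  refine ⟨_, hidx.2, isSelfSimilarOfIndex_of_homs (g.comp ψ) (g.comp ψ') ?_ ?_ hidx.1 (w := g v)
    ?_ (k := k) ?_ ?_ ?_⟩
  · exact hg.comp (hyperbolicHom_injective c d q hq)
  · rw [finrank_eq, e.toLinearEquiv.finrank_eq, finrank_eq]
  · intro x hx
    have h3 : ψ x = v := hg hx
    have h4 : (![x 0, (q + 1) * x 1 - q * x 2, (q + 1) * x 2 - q * x 1] : Fin 3 → ℤ_[p]) =
      ![0, 1, -1] := (hyperbolicHom_apply c d q hq x).symm.trans h3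
    have h5 := congrFun h4 1
    have h6 := congrFun h4 2
    simp at h5 h6
    -- Vectors in the image of `ψ` have last two coordinates congruent modulo p, whereas those of v
    -- differ by the unit 2.
    have h7 : (2 : ℤ_[p]) = p * (x 1 - x 2) := by
      rw [hq]
      linear_combination h6 - h5
    have h8 : toZMod (2 : ℤ_[p]) = 0 := (toZMod_eq_zero_iff _).2 ⟨_, h7⟩
    exact (isUnit_iff_toZMod_ne_zero _).1 (isUnit_two hp) h8
  · change g (ψ k) = _
    rw [hk, map_smul]
  · change g (ψ' k) = _
    rw [hk']
  · intro I hI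
    obtain ⟨n, hn⟩ := exists_pow_smul_mem ha e I hI
    exact ⟨n, hn _⟩

end DiagLie

namespace DiagLie

variable {p : ℕ} [Fact p.Prime]

open PadicInt

theorem nonempty_equiv_hyperbolic_plane (hp : 3 ≤ p) (a q : ℤ_[p]) {β γ : ℤ_[p]} (hβ : IsUnit β)
    (hγ : IsUnit γ) (h : IsSquare (toZMod (-(β * γ)))) :
    Nonempty (DiagLie ![a, q, -q] ≃ₗ⁅ℤ_[p]⁆ DiagLie ![a, q * β, q * γ]) := by
  obtain ⟨v, hv, hv2⟩ := exists_sq_eq_of_isSquare hp (hβ.mul hγ).neg h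
  refine nonempty_equiv_trans (nonempty_equiv_scale _ isUnit_one isUnit_one isUnit_one hv) ?_
  refine nonempty_equiv_trans (nonempty_equiv_of_eq ?_)
    (nonempty_equiv_symm (nonempty_equiv_plane_of_isUnit hp a q hβ hγ))
  funext i
  fin_cases i
  · simp
  · simp
  · simp
    linear_combination q * hv2

/-- A hyperbolic plane arises in two ways: three equal exponents make the form similar to a multiple
of (1, 1, -1), and two equal exponents with -αᵢαⱼ a square modulo p split off a hyperbolic plane. -/
theorem exists_hyperbolic_equiv (hp : 3 ≤ p) (r : Fin 3 → ℕ) (α : Fin 3 → ℤ_[p])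
    (hα : ∀ i, IsUnit (α i))
    (h : (r 0 = r 1 ∧ r 1 = r 2) ∨ (r 0 = r 1 ∧ IsSquare (toZMod (-(α 0 * α 1)))) ∨
      (r 1 = r 2 ∧ IsSquare (toZMod (-(α 1 * α 2)))) ∨
      (r 0 = r 2 ∧ IsSquare (toZMod (-(α 0 * α 2))))) :
    ∃ c d : ℤ_[p], c ≠ 0 ∧ d ≠ 0 ∧
      Nonempty (DiagLie ![c, d, -d] ≃ₗ⁅ℤ_[p]⁆ DiagLie fun i => (p : ℤ_[p]) ^ r i * α i) := by
  have hne : ∀ i, (p : ℤ_[p]) ^ r i * α i ≠ 0 := fun i =>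
    mul_ne_zero (pow_ne_zero _ p_ne_zero) (hα i).ne_zero
  have hv : (fun i => (p : ℤ_[p]) ^ r i * α i) =
      ![(p : ℤ_[p]) ^ r 0 * α 0, (p : ℤ_[p]) ^ r 1 * α 1, (p : ℤ_[p]) ^ r 2 * α 2] := by
    funext i
    fin_cases i <;> rfl
  rw [hv]
  rcases h with ⟨h, h'⟩ | ⟨h, hs⟩ | ⟨h, hs⟩ | ⟨h, hs⟩
  · refine ⟨(p : ℤ_[p]) ^ r 0, (p : ℤ_[p]) ^ r 0, pow_ne_zero _ p_ne_zero,
      pow_ne_zero _ p_ne_zero, ?_⟩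
    rw [← h', ← h]
    refine nonempty_equiv_trans (nonempty_equiv_of_eq ?_) (nonempty_equiv_trans
      (nonempty_equiv_homogeneous hp ((p : ℤ_[p]) ^ r 0) isUnit_one isUnit_one isUnit_one.neg)
      (nonempty_equiv_symm (nonempty_equiv_homogeneous hp _ (hα 0) (hα 1) (hα 2))))
    simp
  · refine ⟨_, (p : ℤ_[p]) ^ r 0, hne 2, pow_ne_zero _ p_ne_zero, nonempty_equiv_trans
      (nonempty_equiv_hyperbolic_plane hp _ _ (hα 0) (hα 1) hs) ?_⟩
    rw [← h]
    exact nonempty_equiv_rotate _ _ _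
  · refine ⟨_, (p : ℤ_[p]) ^ r 1, hne 0, pow_ne_zero _ p_ne_zero, ?_⟩
    rw [← h]
    exact nonempty_equiv_hyperbolic_plane hp _ _ (hα 1) (hα 2) hs
  · refine ⟨_, (p : ℤ_[p]) ^ r 0, hne 1, pow_ne_zero _ p_ne_zero, nonempty_equiv_trans
      (nonempty_equiv_hyperbolic_plane hp _ _ (hα 2) (hα 0) (by rwa [mul_comm])) ?_⟩
    rw [← h]
    exact nonempty_equiv_symm (nonempty_equiv_rotate _ _ _)

end DiagLie

namespace TableEntry

open PadicInt DiagLie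

variable {p : ℕ} [Fact p.Prime]

/-- The exponent of `p` in the upper estimate for the self-similarity index. -/
def upperExponent : TableEntry → ℕ
  | line1 _ => 1
  | line2 _ _ => 1
  | line3 s₀ s₁ => s₁ - s₀ + 1
  | line4 _ _ => 1
  | line5 s₀ s₂ => (s₂ - s₀) / 2 + 1
  | line6 s₀ s₁ s₂ _ _ => (s₁ - s₀) / 2 + (s₂ - s₀) / 2 + 1
  | line7 s₀ s₁ _ _ _ => (s₁ - s₀) / 2 + 1
  | line8 _ s₁ s₂ _ _ => (s₂ - s₁) / 2 + 1
  | line9 s₀ _ s₂ _ _ => (s₂ - s₀) / 2 + 1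

/-- The sublattice spanned by p^mᵢ xᵢ has exponents rᵢ = sᵢ + mⱼ + mₖ - mᵢ. The m are chosen to
equalise all three exponents, or only the two whose units then give a hyperbolic plane; their sum
contributes to the index. -/
theorem Valid.exists_exponents (hp : 3 ≤ p) {ρ : ℤ_[p]} (hρ : ¬ IsSquare (toZMod ρ))
    {t : TableEntry} (ht : t.Valid p) : ∃ (m r : Fin 3 → ℕ),
      (m 0 + r 0 = t.exponents 0 + (m 1 + m 2) ∧ m 1 + r 1 = t.exponents 1 + (m 0 + m 2) ∧
        m 2 + r 2 = t.exponents 2 + (m 0 + m 1)) ∧ m 0 + m 1 + m 2 + 1 = t.upperExponent ∧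
      ((r 0 = r 1 ∧ r 1 = r 2) ∨
        (r 0 = r 1 ∧ IsSquare (toZMod (-(t.unitParts ρ 0 * t.unitParts ρ 1)))) ∨
        (r 1 = r 2 ∧ IsSquare (toZMod (-(t.unitParts ρ 1 * t.unitParts ρ 2)))) ∨
        (r 0 = r 2 ∧ IsSquare (toZMod (-(t.unitParts ρ 0 * t.unitParts ρ 2))))) := by
  have hsq := fun n => (isSquare_neg_pow_iff hp hρ n).2
  cases t with
  | line1 s₀ =>
    exact ⟨![0, 0, 0], ![s₀, s₀, s₀], by simp [exponents], by simp [upperExponent],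
      Or.inl (by simp)⟩
  | line2 s₀ s₁ =>
    exact ⟨![0, 0, 0], ![s₀, s₁, s₁], by simp [exponents], by simp [upperExponent],
      Or.inr (Or.inr (Or.inl (by simp [unitParts])))⟩
  | line3 s₀ s₁ =>
    obtain ⟨k, hk⟩ : ∃ k, s₁ = s₀ + 2 * k := ⟨(s₁ - s₀) / 2, by simp [Valid, Nat.ModEq] at ht; omega⟩
    refine ⟨![0, k, k], ![s₀ + 2 * k, s₀ + 2 * k, s₀ + 2 * k], ?_, ?_, Or.inl (by simp)⟩
    · simp [exponents]
      omega
    · simp [upperExponent]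
      omega
  | line4 s₀ s₂ =>
    exact ⟨![0, 0, 0], ![s₀, s₀, s₂], by simp [exponents], by simp [upperExponent],
      Or.inr (Or.inl (by simp [unitParts]))⟩
  | line5 s₀ s₂ =>
    obtain ⟨k, hk⟩ : ∃ k, s₂ = s₀ + 2 * k := ⟨(s₂ - s₀) / 2, by simp [Valid, Nat.ModEq] at ht; omega⟩
    refine ⟨![0, 0, k], ![s₀ + k, s₀ + k, s₀ + k], ?_, ?_, Or.inl (by simp)⟩
    · simp [exponents]
      omega
    · simp [upperExponent]
      omega
  | line6 s₀ s₁ s₂ ε₁ ε₂ =>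
    obtain ⟨k, hk⟩ : ∃ k, s₁ = s₀ + 2 * k := ⟨(s₁ - s₀) / 2, by simp [Valid, Nat.ModEq] at ht; omega⟩
    obtain ⟨l, hl⟩ : ∃ k, s₂ = s₀ + 2 * k := ⟨(s₂ - s₀) / 2, by simp [Valid, Nat.ModEq] at ht; omega⟩
    refine ⟨![0, k, l], ![s₀ + k + l, s₀ + k + l, s₀ + k + l], ?_, ?_, Or.inl (by simp)⟩
    · simp [exponents]
      omega
    · simp [upperExponent]
      omega
  | line7 s₀ s₁ s₂ ε₁ ε₂ =>
    obtain ⟨k, hk⟩ : ∃ k, s₁ = s₀ + 2 * k := ⟨(s₁ - s₀) / 2, by simp [Valid, Nat.ModEq] at ht; omega⟩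
    refine ⟨![0, k, 0], ![s₀ + k, s₀ + k, s₂ + k], ?_, ?_, Or.inr (Or.inl ⟨rfl, ?_⟩)⟩
    · simp [exponents]
      omega
    · simp [upperExponent]
      omega
    · simpa [unitParts] using hsq ε₁ ht.2.2.2.2
  | line8 s₀ s₁ s₂ ε₁ ε₂ =>
    obtain ⟨k, hk⟩ : ∃ k, s₂ = s₁ + 2 * k := ⟨(s₂ - s₁) / 2, by simp [Valid, Nat.ModEq] at ht; omega⟩
    refine ⟨![0, 0, k], ![s₀ + k, s₁ + k, s₁ + k], ?_, ?_, Or.inr (Or.inr (Or.inl ⟨rfl, ?_⟩))⟩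
    · simp [exponents]
      omega
    · simp [upperExponent]
      omega
    · simpa [unitParts, pow_add] using hsq (ε₁ + ε₂) ht.2.2.2.2
  | line9 s₀ s₁ s₂ ε₁ ε₂ =>
    obtain ⟨k, hk⟩ : ∃ k, s₂ = s₀ + 2 * k := ⟨(s₂ - s₀) / 2, by simp [Valid, Nat.ModEq] at ht; omega⟩
    refine ⟨![0, 0, k], ![s₀ + k, s₁ + k, s₀ + k], ?_, ?_, Or.inr (Or.inr (Or.inr ⟨rfl, ?_⟩))⟩
    · simp [exponents]
      omega
    · simp [upperExponent]
      omega
    · simpa [unitParts] using hsq ε₂ ht.2.2.2.2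

theorem Valid.exists_hyperbolic (hp : 3 ≤ p) {ρ : ℤ_[p]} (hρu : IsUnit ρ)
    (hρ : ¬ IsSquare (toZMod ρ)) {t : TableEntry} (ht : t.Valid p) :
    ∃ (m : Fin 3 → ℕ) (b : Fin 3 → ℤ_[p]) (c d : ℤ_[p]),
      (p : ℤ_[p]) ^ m 0 * b 0 = t.diag ρ 0 * p ^ (m 1 + m 2) ∧
      (p : ℤ_[p]) ^ m 1 * b 1 = t.diag ρ 1 * p ^ (m 0 + m 2) ∧
      (p : ℤ_[p]) ^ m 2 * b 2 = t.diag ρ 2 * p ^ (m 0 + m 1) ∧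
      m 0 + m 1 + m 2 + 1 = t.upperExponent ∧ c ≠ 0 ∧ d ≠ 0 ∧
      Nonempty (DiagLie ![c, d, -d] ≃ₗ⁅ℤ_[p]⁆ DiagLie b) := by
  obtain ⟨m, r, ⟨h0, h1, h2⟩, hup, h⟩ := ht.exists_exponents hp hρ
  obtain ⟨c, d, hc, hd, e⟩ := exists_hyperbolic_equiv hp r _ (isUnit_unitParts hρu t) h
  refine ⟨m, _, c, d, ?_, ?_, ?_, hup, hc, hd, e⟩ <;> rw [diag_eq] <;>
    rw [← mul_assoc, ← pow_add, mul_right_comm, ← pow_add]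
  · rw [h0]
  · rw [h1]
  · rw [h2]

theorem Valid.exists_isSelfSimilarOfIndex_le (hp : 3 ≤ p) {ρ : ℤ_[p]} (hρu : IsUnit ρ)
    (hρ : ¬ IsSquare (toZMod ρ)) {t : TableEntry} (ht : t.Valid p) {L : Type*} [LieRing L]
    [LieAlgebra ℤ_[p] L] (e : L ≃ₗ⁅ℤ_[p]⁆ t.Lattice ρ) :
    ∃ n ≤ p ^ t.upperExponent, IsSelfSimilarOfIndex p L n := by
  obtain ⟨m, b, c, d, h0, h1, h2, hup, -, -, h⟩ := ht.exists_hyperbolic hp hρu hρ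
  rw [← hup]
  exact DiagLie.exists_isSelfSimilarOfIndex_le hp _ b (diag_ne_zero hρu t) e _ _ _ h0 h1 h2 c d h

theorem Valid.isUnsolvableSl2Lattice (hp : 3 ≤ p) {ρ : ℤ_[p]} (hρu : IsUnit ρ)
    (hρ : ¬ IsSquare (toZMod ρ)) {t : TableEntry} (ht : t.Valid p) :
    IsUnsolvableSl2Lattice p (t.Lattice ρ) := by
  obtain ⟨m, b, c, d, h0, h1, h2, -, hc, hd, ⟨e⟩⟩ := ht.exists_hyperbolic hp hρu hρ
  have hcd : IsUnsolvableSl2Lattice p (DiagLie ![c, d, -d]) := by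
    rw [DiagLie.isUnsolvableSl2Lattice_iff]
    · exact ⟨![0, 1, 1], fun h => one_ne_zero (congrFun h 1), by simp⟩
    · intro i
      fin_cases i <;> simp [hc, hd]
  have hP : ∀ n, (p : ℤ_[p]) ^ n ≠ 0 := fun n => pow_ne_zero n p_ne_zero
  have hb : ∀ i, b i ≠ 0 := by
    have hz := diag_ne_zero hρu t
    intro i hi
    fin_cases i
    · simp only [Fin.zero_eta] at hi
      rw [hi, mul_zero] at h0
      exact mul_ne_zero (hz 0) (hP _) h0.symm
    · simp only [Fin.mk_one] at hi
      rw [hi, mul_zero] at h1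
      exact mul_ne_zero (hz 1) (hP _) h1.symm
    · simp only [Fin.reduceFinMk] at hi
      rw [hi, mul_zero] at h2
      exact mul_ne_zero (hz 2) (hP _) h2.symm
  obtain ⟨y, hy, h⟩ := (DiagLie.isUnsolvableSl2Lattice_iff b hb).1 (hcd.of_equiv e)
  refine (DiagLie.isUnsolvableSl2Lattice_iff _ (diag_ne_zero hρu t)).2
    -- With this scaling the value of the form of the lattice is p^(m₀ + m₁ + m₂) times the value of
    -- the form `b` at `y`.
    ⟨![p ^ (m 1 + m 2) * y 0, p ^ (m 0 + m 2) * y 1, p ^ (m 0 + m 1) * y 2], fun h => hy ?_, ?_⟩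
  · have hq : ∀ n, (p : ℚ_[p]) ^ n ≠ 0 := fun n => pow_ne_zero n coe_p_ne_zero
    funext i
    have := congrFun h i
    fin_cases i
    · exact (mul_eq_zero.1 this).resolve_left (hq _)
    · exact (mul_eq_zero.1 this).resolve_left (hq _)
    · exact (mul_eq_zero.1 this).resolve_left (hq _)
  · have h0' := congrArg (fun z : ℤ_[p] => (z : ℚ_[p])) h0
    have h1' := congrArg (fun z : ℤ_[p] => (z : ℚ_[p])) h1
    have h2' := congrArg (fun z : ℤ_[p] => (z : ℚ_[p])) h2
    push_cast at h0' h1' h2'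
    simp only [Matrix.cons_val_zero, Matrix.cons_val_one, Matrix.cons_val]
    simp only [pow_add] at h0' h1' h2' ⊢
    linear_combination (p : ℚ_[p]) ^ m 0 * p ^ m 1 * p ^ m 2 * h
      - (p : ℚ_[p]) ^ m 1 * p ^ m 2 * y 0 ^ 2 * h0' - (p : ℚ_[p]) ^ m 0 * p ^ m 2 * y 1 ^ 2 * h1'
      - (p : ℚ_[p]) ^ m 0 * p ^ m 1 * y 2 ^ 2 * h2'

end TableEntry

/-! ### Endomorphisms of index p: the lower bounds. -/

namespace VirtualEndomorphism

variable {p : ℕ} [Fact p.Prime] {L : Type*} [LieRing L] [LieAlgebra ℤ_[p] L]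

/-- The multiples of `p` form a nonzero ideal. -/
theorem exists_ideal_smul [Nontrivial L] [Module.IsTorsionFree ℤ_[p] L] :
    ∃ I : LieIdeal ℤ_[p] L, I ≠ ⊥ ∧ ∀ x, x ∈ I ↔ ∃ y, (p : ℤ_[p]) • y = x := by
  let I : LieIdeal ℤ_[p] L :=
    { (LinearMap.range ((p : ℤ_[p]) • (LinearMap.id : L →ₗ[ℤ_[p]] L))) with
      lie_mem := by
        rintro x _ ⟨y, rfl⟩
        exact ⟨⁅x, y⁆, (lie_smul _ _ _).symm⟩ }
  refine ⟨I, fun h => ?_, fun x => Iff.rfl⟩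
  obtain ⟨y, hy⟩ := exists_ne (0 : L)
  have : (p : ℤ_[p]) • y ∈ I := ⟨y, rfl⟩
  rw [h, LieSubmodule.mem_bot] at this
  exact hy ((smul_eq_zero.1 this).resolve_left PadicInt.p_ne_zero)

/-- An endomorphism defined on all of L leaves the ideal pL invariant. -/
theorem IsSimple.index_ne_one [Nontrivial L] [Module.IsTorsionFree ℤ_[p] L]
    {φ : VirtualEndomorphism p L} (hφ : φ.IsSimple) : φ.index ≠ 1 := by
  intro h1
  have hdom : ∀ x, x ∈ φ.domain := by
    intro x
    have : x ∈ φ.domain.toSubmodule.toAddSubgroup := by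
      rw [AddSubgroup.index_eq_one.1 h1]
      trivial
    exact this
  obtain ⟨I, hI, hmem⟩ := exists_ideal_smul (p := p) (L := L)
  refine hI (hφ I fun x hx => ⟨hdom x, ?_⟩)
  obtain ⟨y, rfl⟩ := (hmem x).1 hx
  refine (hmem _).2 ⟨φ.toHom ⟨y, hdom y⟩, ?_⟩
  rw [← map_smul]
  rfl

/-- By Cauchy the quotient has an element of order q; but a prime other than p is invertible in
`ℤ_[p]` and acts injectively on it. -/
theorem eq_of_prime_dvd_index (φ : VirtualEndomorphism p L) (h0 : φ.index ≠ 0) {q : ℕ}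
    (hq : q.Prime) (hdvd : q ∣ φ.index) : q = p := by
  by_contra hne
  have : Fact q.Prime := ⟨hq⟩
  let S := φ.domain.toSubmodule
  have hfin : Finite (L ⧸ S.toAddSubgroup) := Nat.finite_of_card_ne_zero h0
  obtain ⟨x, hx⟩ := exists_prime_addOrderOf_dvd_card' (G := L ⧸ S.toAddSubgroup) q hdvd
  obtain ⟨y, rfl⟩ := QuotientAddGroup.mk_surjective x
  have h2 : q • y ∈ S.toAddSubgroup := by
    rw [← QuotientAddGroup.eq_zero_iff, QuotientAddGroup.mk_nsmul, ← hx]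
    exact addOrderOf_nsmul_eq_zero _
  have h3 : (q : ℤ_[p]) • y ∈ S := by
    rw [Nat.cast_smul_eq_nsmul]
    exact h2
  have hu : IsUnit (q : ℤ_[p]) := by
    rw [PadicInt.isUnit_iff_toZMod_ne_zero, map_natCast, Ne, ZMod.natCast_eq_zero_iff]
    intro h
    exact hne ((Nat.prime_dvd_prime_iff_eq Fact.out hq).1 h).symm
  have h4 : y ∈ S := by
    obtain ⟨u, hu⟩ := hu
    have := S.smul_mem (↑u⁻¹ : ℤ_[p]) h3
    rwa [smul_smul, ← hu, Units.inv_mul, one_smul] at this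
  have h5 : (y : L ⧸ S.toAddSubgroup) = 0 := (QuotientAddGroup.eq_zero_iff _).2 h4
  rw [h5, addOrderOf_zero] at hx
  exact hq.one_lt.ne hx

theorem IsSimple.index_eq_or_le [Nontrivial L] [Module.IsTorsionFree ℤ_[p] L]
    {φ : VirtualEndomorphism p L} (hφ : φ.IsSimple) (h0 : φ.index ≠ 0) :
    φ.index = p ∨ p ^ 2 ≤ φ.index := by
  have h := Nat.eq_prime_pow_of_unique_prime_dvd h0
    (fun hq hdvd => φ.eq_of_prime_dvd_index h0 hq hdvd)
  have h1 := hφ.index_ne_one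
  generalize φ.index.primeFactorsList.length = k at h
  rcases k with _ | _ | k
  · exact absurd h h1
  · exact Or.inl (by simpa using h)
  · right
    rw [h]
    exact Nat.pow_le_pow_right (Fact.out : p.Prime).pos (by omega)

theorem smul_mem_domain {φ : VirtualEndomorphism p L} (h : φ.index = p) (x : L) :
    (p : ℤ_[p]) • x ∈ φ.domain := by
  have := AddSubgroup.nsmul_index_mem φ.domain.toSubmodule.toAddSubgroup x
  have h' : φ.domain.toSubmodule.toAddSubgroup.index = p := h
  rw [h', ← Nat.cast_smul_eq_nsmul ℤ_[p]] at this
  exact this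

theorem exists_nsmul_sub_mem_domain {φ : VirtualEndomorphism p L} (h : φ.index = p) {z : L}
    (hz : z ∉ φ.domain) (x : L) : ∃ n : ℤ, x - (n : ℤ_[p]) • z ∈ φ.domain := by
  let S := φ.domain.toSubmodule.toAddSubgroup
  have hz' : (z : L ⧸ S) ≠ 0 := fun h => hz ((QuotientAddGroup.eq_zero_iff z).1 h)
  obtain ⟨n, hn⟩ := AddSubgroup.mem_zmultiples_iff.1
    (mem_zmultiples_of_prime_card (G := L ⧸ S) (p := p) h hz' (g' := (x : L ⧸ S)))
  refine ⟨n, ?_⟩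
  have : x - n • z ∈ S := by
    rw [← QuotientAddGroup.eq_zero_iff, QuotientAddGroup.mk_sub, QuotientAddGroup.mk_zsmul, hn,
      sub_self]
  rw [Int.cast_smul_eq_zsmul]
  exact this

end VirtualEndomorphism

namespace DiagLie

variable {p : ℕ} [Fact p.Prime]

open PadicInt

/-- A nonzero matrix of a map multiplying brackets by `p` has determinant `p ^ 3`. -/
theorem det_eq_of_ne_zero {a : Fin 3 → ℤ_[p]} (ha : ∀ i, a i ≠ 0)
    {W : Matrix (Fin 3) (Fin 3) ℤ_[p]}
    (h : ∀ i j, p * (W i j * a j) = a i * W.adjugate j i) (hW : W ≠ 0) :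
    W.det = (p : ℤ_[p]) ^ 3 := by
  have hD : (Matrix.diagonal a).det ≠ 0 := by
    rw [Matrix.det_diagonal]
    exact Finset.prod_ne_zero_iff.2 fun i _ => ha i
  have hM : W.adjugate * Matrix.diagonal a = (p : ℤ_[p]) • (Matrix.diagonal a * Wᵀ) := by
    ext j i
    rw [Matrix.mul_diagonal, Matrix.smul_apply, Matrix.diagonal_mul, Matrix.transpose_apply,
      smul_eq_mul, mul_comm, ← h]
    ring
  -- Determinants of the relation `hM`: the adjugate contributes (det W)², the scalar p contributes
  -- p³.
  have h1 : W.det * (W.det - (p : ℤ_[p]) ^ 3) * (Matrix.diagonal a).det = 0 := by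
    have := congrArg Matrix.det hM
    rw [Matrix.det_mul, Matrix.det_smul, Matrix.det_mul, Matrix.det_adjugate,
      Matrix.det_transpose] at this
    simp only [Fintype.card_fin, Nat.add_one_sub_one] at this
    linear_combination this
  rcases mul_eq_zero.1 ((mul_eq_zero.1 h1).resolve_right hD) with h2 | h2
  · exfalso
    -- If det W = 0 the double adjugate vanishes. Applying the adjugate to `hM` then gives adj W =
    -- 0, and the original relation gives W = 0.
    have h3 : (W.adjugate * Matrix.diagonal a).adjugate = 0 := by
      rw [Matrix.adjugate_mul_distrib, Matrix.adjugate_adjugate', h2]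
      simp
    rw [hM, Matrix.adjugate_smul, Matrix.adjugate_mul_distrib] at h3
    have h4 := (smul_eq_zero.1 h3).resolve_left (pow_ne_zero _ p_ne_zero)
    have h5 := congrArg (· * Matrix.diagonal a) h4
    simp only [zero_mul] at h5
    rw [mul_assoc, Matrix.adjugate_mul, Matrix.mul_smul, mul_one] at h5
    have h6 := (smul_eq_zero.1 h5).resolve_left hD
    apply hW
    ext i j
    have h7 : W.adjugate j i = 0 := by
      have := congrFun (congrFun h6 i) j
      rwa [← Matrix.adjugate_transpose] at this
    have h8 := h i j
    rw [h7, mul_zero, mul_eq_zero, mul_eq_zero] at h8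
    exact (h8.resolve_left p_ne_zero).resolve_right (ha j)
  · exact sub_eq_zero.1 h2

/-- In valuations, 2v + 1 ≥ 2n forces v ≥ n. The spare factor p absorbs the odd part of sⱼ - s₀
later on. -/
theorem pow_dvd_of_dvd_sq_mul {x : ℤ_[p]} {n : ℕ} (h : (p : ℤ_[p]) ^ (2 * n) ∣ x ^ 2 * p) :
    (p : ℤ_[p]) ^ n ∣ x := by
  by_cases hx : x = 0
  · simp [hx]
  have hu := unitCoeff_spec hx
  set v := x.valuation
  by_contra hn
  have hlt : v < n := by
    by_contra! hle
    apply hn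
    rw [hu]
    exact Dvd.dvd.mul_left (pow_dvd_pow _ hle) _
  have h1 : (p : ℤ_[p]) ^ (2 * v + 2) ∣ x ^ 2 * p :=
    (pow_dvd_pow _ (by omega)).trans h
  obtain ⟨t, ht⟩ := h1
  have h2 : (p : ℤ_[p]) ^ (2 * v + 1) * (unitCoeff hx : ℤ_[p]) ^ 2 =
      (p : ℤ_[p]) ^ (2 * v + 1) * (p * t) := by
    rw [hu] at ht
    linear_combination ht
  have h3 := mul_left_cancel₀ (pow_ne_zero _ p_ne_zero) h2
  have h4 : IsUnit (p * t) := h3 ▸ (unitCoeff hx).isUnit.pow 2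
  exact prime_p.not_isUnit (isUnit_of_mul_isUnit_left h4)

theorem pow_dvd_of_not_isSquare (hp : 3 ≤ p) {a b x y : ℤ_[p]} (ha : a ≠ 0) (hb : b ≠ 0)
    (hab : ¬ IsSquare (-((a : ℚ_[p]) * b))) {n : ℕ}
    (h : (p : ℤ_[p]) ^ n ∣ a * x ^ 2 + b * y ^ 2) :
    (p : ℤ_[p]) ^ n ∣ a * x ^ 2 ∧ (p : ℤ_[p]) ^ n ∣ b * y ^ 2 := by
  have hm := Padic.norm_binary_eq_max hp (PadicInt.coe_ne_zero.2 ha) (PadicInt.coe_ne_zero.2 hb)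
    hab (x : ℚ_[p]) y
  have hm' : ‖a * x ^ 2 + b * y ^ 2‖ = max ‖a * x ^ 2‖ ‖b * y ^ 2‖ := by
    simp only [norm_def]
    push_cast
    exact hm
  simp only [← Ideal.mem_span_singleton, ← norm_le_pow_iff_mem_span_pow] at h ⊢
  rw [hm'] at h
  exact ⟨(le_max_left _ _).trans h, (le_max_right _ _).trans h⟩

section lower

variable {s : Fin 3 → ℕ} {α : Fin 3 → ℤ_[p]} {W : Matrix (Fin 3) (Fin 3) ℤ_[p]}

/-- Since p divides the adjugate, it cancels from the cofactor relation and leaves p^sᵢ dividing W i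
j · p^sⱼ. -/
theorem pow_dvd_of_adjugate (hα : ∀ i, IsUnit (α i))
    (h : ∀ i j, p * (W i j * (p ^ s j * α j)) = p ^ s i * α i * W.adjugate j i)
    (hadj : ∀ i j, (p : ℤ_[p]) ∣ W.adjugate i j) {i j : Fin 3} {m n : ℕ}
    (hle : n + s j ≤ m + s i) : (p : ℤ_[p]) ^ n ∣ W i j * p ^ m := by
  obtain ⟨t, ht⟩ := hadj j i
  obtain ⟨u, hu⟩ := hα j
  obtain ⟨k, hk⟩ : ∃ k, m + s i = n + s j + k := ⟨m + s i - (n + s j), by omega⟩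
  have h1 := h i j
  rw [ht] at h1
  have h2 : W i j * p ^ s j * ↑u = p ^ s i * α i * t := by
    apply mul_left_cancel₀ (p_ne_zero (p := p))
    rw [hu]
    linear_combination h1
  have hui : (u : ℤ_[p]) * ↑u⁻¹ = 1 := Units.mul_inv u
  have hk' : (p : ℤ_[p]) ^ m * p ^ s i = p ^ n * p ^ s j * p ^ k := by
    rw [← pow_add, hk, pow_add, pow_add]
  refine ⟨p ^ k * α i * t * ↑u⁻¹, ?_⟩
  apply mul_left_cancel₀ (pow_ne_zero (s j) (p_ne_zero (p := p)))
  linear_combination (p : ℤ_[p]) ^ m * ↑u⁻¹ * h2 - (p : ℤ_[p]) ^ m * W i j * p ^ s j * hui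
    + α i * t * ↑u⁻¹ * hk'

/-- These are the diagonal entries of W·diag(a)·Wᵀ = p²·diag(a): W/p is an isometry. They follow by
pairing the cofactor relation with a row of W. The indices l, l + 1, l + 2 run cyclically, so that
any term can be singled out. -/
theorem row_eq {a : Fin 3 → ℤ_[p]} (h : ∀ i j, p * (W i j * a j) = a i * W.adjugate j i)
    (hdet : W.det = (p : ℤ_[p]) ^ 3) (i l : Fin 3) :
    a l * W i l ^ 2 + (a (l + 1) * W i (l + 1) ^ 2 + a (l + 2) * W i (l + 2) ^ 2) =
      p ^ 2 * a i := by
  have h1 : ∑ j, W i j * W.adjugate j i = (p : ℤ_[p]) ^ 3 := by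
    have := congrFun (congrFun (Matrix.mul_adjugate W) i) i
    rwa [Matrix.mul_apply, Matrix.smul_apply, Matrix.one_apply_eq, smul_eq_mul, mul_one,
      hdet] at this
  rw [Fin.sum_univ_three] at h1
  apply mul_left_cancel₀ (p_ne_zero (p := p))
  have e : a l * W i l ^ 2 + (a (l + 1) * W i (l + 1) ^ 2 + a (l + 2) * W i (l + 2) ^ 2) =
      a 0 * W i 0 ^ 2 + a 1 * W i 1 ^ 2 + a 2 * W i 2 ^ 2 := by
    fin_cases l <;> simp <;> ring
  rw [e]
  linear_combination W i 0 * h i 0 + W i 1 * h i 1 + W i 2 * h i 2 + a i * h1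

/-- The integrality of all the rescaled entries of the matrix. -/
theorem pow_dvd_entries (hp : 3 ≤ p) (hα : ∀ i, IsUnit (α i)) (hs : ∀ i, s 0 ≤ s i)
    (h : ∀ i j, p * (W i j * (p ^ s j * α j)) = p ^ s i * α i * W.adjugate j i)
    (hdet : W.det = (p : ℤ_[p]) ^ 3) (hadj : ∀ i j, (p : ℤ_[p]) ∣ W.adjugate i j)
    {m : Fin 3 → ℕ} (hm : ∀ i, m i = (s i - s 0) / 2) {i l : Fin 3}
    (hl : m i < m l ∨ m i + 1 + s l ≤ m l + s i)
    (hc : (m i < m (l + 1) ∨ m i + 1 + s (l + 1) ≤ m (l + 1) + s i) ∨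
      (m i < m (l + 2) ∨ m i + 1 + s (l + 2) ≤ m (l + 2) + s i) ∨
      ¬ IsSquare (-((p : ℚ_[p]) ^ s (l + 1) * α (l + 1) * (p ^ s (l + 2) * α (l + 2)))))
    (j : Fin 3) : (p : ℤ_[p]) ^ (m i + 1) ∣ W i j * p ^ m j := by
  -- Two easy cases: the factor p^mⱼ suffices by itself, or the divisibility of the adjugate does.
  have hcov : ∀ j, (m i < m j ∨ m i + 1 + s j ≤ m j + s i) →
      (p : ℤ_[p]) ^ (m i + 1) ∣ W i j * p ^ m j := by
    rintro j (hlt | hle)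
    · exact Dvd.dvd.mul_left (pow_dvd_pow _ hlt) _
    · exact pow_dvd_of_adjugate hα h hadj hle
  have hr : ∀ j, ∃ r, r ≤ 1 ∧ s j = s 0 + 2 * m j + r := fun j =>
    ⟨(s j - s 0) % 2, by omega, by have := hs j; have := hm j; omega⟩
  -- Divisibility of the rescaled entry is equivalent to divisibility of its term in the row
  -- equation by p^(s₀ + 2mᵢ + 2). For the converse, `hun`, the remainder r ≤ 1 of sⱼ - s₀ modulo 2
  -- is harmless by `pow_dvd_of_dvd_sq_mul`.
  have hsq : ∀ j, (p : ℤ_[p]) ^ (m i + 1) ∣ W i j * p ^ m j →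
      (p : ℤ_[p]) ^ (s 0 + 2 * (m i + 1)) ∣ p ^ s j * α j * W i j ^ 2 := by
    rintro j ⟨t, ht⟩
    obtain ⟨r, -, hr⟩ := hr j
    refine ⟨p ^ r * α j * t ^ 2, ?_⟩
    have e : (p : ℤ_[p]) ^ s j = p ^ s 0 * p ^ m j * p ^ m j * p ^ r := by
      rw [← pow_add, ← pow_add, ← pow_add, hr]
      congr 1
      ring
    have e' : (p : ℤ_[p]) ^ (s 0 + 2 * (m i + 1)) = p ^ s 0 * p ^ (m i + 1) * p ^ (m i + 1) := by
      rw [← pow_add, ← pow_add]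
      congr 1
      ring
    rw [e, e']
    linear_combination p ^ s 0 * p ^ r * α j * (W i j * p ^ m j + p ^ (m i + 1) * t) * ht
  have hun : ∀ j, (p : ℤ_[p]) ^ (s 0 + 2 * (m i + 1)) ∣ p ^ s j * α j * W i j ^ 2 →
      (p : ℤ_[p]) ^ (m i + 1) ∣ W i j * p ^ m j := by
    rintro j ⟨t, ht⟩
    obtain ⟨r, hr1, hr⟩ := hr j
    obtain ⟨u, hu⟩ := hα j
    apply pow_dvd_of_dvd_sq_mul
    refine ⟨p ^ (1 - r) * ↑u⁻¹ * t, ?_⟩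
    have e : (p : ℤ_[p]) ^ s j * p ^ (1 - r) = p ^ s 0 * p ^ m j * p ^ m j * p := by
      rw [← pow_add, ← pow_add, ← pow_add, ← pow_succ, hr]
      congr 1
      omega
    have hui : (u : ℤ_[p]) * ↑u⁻¹ = 1 := Units.mul_inv u
    rw [← hu, pow_add] at ht
    apply mul_left_cancel₀ (pow_ne_zero (s 0) (p_ne_zero (p := p)))
    linear_combination (p : ℤ_[p]) ^ (1 - r) * ↑u⁻¹ * ht - W i j ^ 2 * e
      - p ^ s j * p ^ (1 - r) * W i j ^ 2 * hui
  have hrow := row_eq (a := fun i => (p : ℤ_[p]) ^ s i * α i) h hdet i l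
  have hi : (p : ℤ_[p]) ^ (s 0 + 2 * (m i + 1)) ∣ p ^ 2 * (p ^ s i * α i) := by
    rw [← mul_assoc, ← pow_add]
    refine Dvd.dvd.mul_right (pow_dvd_pow _ ?_) _
    obtain ⟨r, -, hr⟩ := hr i
    omega
  have hsum := (dvd_add_right (hsq l (hcov l hl))).1 (hrow ▸ hi)
  have hne : ∀ j, (p : ℤ_[p]) ^ s j * α j ≠ 0 := fun j =>
    mul_ne_zero (pow_ne_zero _ p_ne_zero) (hα j).ne_zero
  -- The sum of the two remaining terms is divisible. Either one of them is known and gives the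
  -- other, or the binary form is anisotropic and its terms cannot cancel.
  have hall : (p : ℤ_[p]) ^ (m i + 1) ∣ W i (l + 1) * p ^ m (l + 1) ∧
      (p : ℤ_[p]) ^ (m i + 1) ∣ W i (l + 2) * p ^ m (l + 2) := by
    rcases hc with hc | hc | hc
    · exact ⟨hcov _ hc, hun _ ((dvd_add_right (hsq _ (hcov _ hc))).1 hsum)⟩
    · exact ⟨hun _ ((dvd_add_left (hsq _ (hcov _ hc))).1 hsum), hcov _ hc⟩
    · have := pow_dvd_of_not_isSquare hp (hne _) (hne _) (by push_cast; exact hc) hsum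
      exact ⟨hun _ this.1, hun _ this.2⟩
  have hj : j = l ∨ j = l + 1 ∨ j = l + 2 := by
    fin_cases j <;> fin_cases l <;> simp
  rcases hj with rfl | rfl | rfl
  · exact hcov _ hl
  · exact hall.1
  · exact hall.2

end lower

end DiagLie

namespace DiagLie

variable {p : ℕ} [Fact p.Prime]

open PadicInt

section

variable {L : Type*} [LieRing L] [LieAlgebra ℤ_[p] L] {a : Fin 3 → ℤ_[p]}
  (e : L ≃ₗ⁅ℤ_[p]⁆ DiagLie a)

/-- The inverse of an isomorphism with a diagonal lattice, on coordinate vectors. -/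
noncomputable def ofCoord : (Fin 3 → ℤ_[p]) ≃ₗ[ℤ_[p]] L :=
  (e.symm.toLinearEquiv : DiagLie a ≃ₗ[ℤ_[p]] L)

theorem ofCoord_bracket (x y : Fin 3 → ℤ_[p]) :
    ofCoord e (bracket a x y) = ⁅ofCoord e x, ofCoord e y⁆ :=
  LieEquiv.map_lie e.symm x y

theorem isTorsionFree_of_equiv (e : L ≃ₗ⁅ℤ_[p]⁆ DiagLie a) : Module.IsTorsionFree ℤ_[p] L :=
  (ofCoord e).symm.injective.moduleIsTorsionFree _ (map_smul _)

theorem nontrivial_of_equiv (e : L ≃ₗ⁅ℤ_[p]⁆ DiagLie a) : Nontrivial L :=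
  (ofCoord e).injective.nontrivial

/-- The composition of multiplication by `p` with a virtual endomorphism, in coordinates. -/
noncomputable def smulHom (φ : VirtualEndomorphism p L) (h : φ.index = p) :
    (Fin 3 → ℤ_[p]) →ₗ[ℤ_[p]] (Fin 3 → ℤ_[p]) :=
  (ofCoord e).symm.toLinearMap ∘ₗ (φ.toHom : φ.domain →ₗ[ℤ_[p]] L) ∘ₗ
    LinearMap.codRestrict φ.domain.toSubmodule ((p : ℤ_[p]) • (ofCoord e).toLinearMap)
      (fun x => φ.smul_mem_domain h (ofCoord e x))

variable (φ : VirtualEndomorphism p L) (h : φ.index = p)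

theorem ofCoord_smulHom (x : Fin 3 → ℤ_[p]) : ofCoord e (smulHom e φ h x) =
    φ.toHom ⟨(p : ℤ_[p]) • ofCoord e x, φ.smul_mem_domain h _⟩ :=
  (ofCoord e).apply_symm_apply _

theorem smul_smulHom_bracket (x y : Fin 3 → ℤ_[p]) :
    (p : ℤ_[p]) • smulHom e φ h (bracket a x y) =
      bracket a (smulHom e φ h x) (smulHom e φ h y) := by
  apply (ofCoord e).injective
  rw [ofCoord_bracket, map_smul, ofCoord_smulHom, ofCoord_smulHom, ofCoord_smulHom,
    ← LieHom.map_lie, ← map_smul]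
  congr 1
  apply Subtype.ext
  change (p : ℤ_[p]) • (p : ℤ_[p]) • _ = ⁅(p : ℤ_[p]) • _, (p : ℤ_[p]) • _⁆
  rw [ofCoord_bracket, lie_smul, smul_lie]

theorem smulHom_of_mem {x : Fin 3 → ℤ_[p]} (hx : ofCoord e x ∈ φ.domain) :
    smulHom e φ h x = (p : ℤ_[p]) • (ofCoord e).symm (φ.toHom ⟨ofCoord e x, hx⟩) := by
  apply (ofCoord e).injective
  rw [ofCoord_smulHom, map_smul, LinearEquiv.apply_symm_apply]
  exact map_smul φ.toHom (p : ℤ_[p]) (⟨ofCoord e x, hx⟩ : φ.domain)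

/-- Multiplication by p followed by φ maps the domain into pL, and the domain has cyclic quotient of
order p. So modulo p all columns of the matrix are multiples of one vector and its 2×2 minors
vanish. -/
theorem dvd_adjugate_smulHom (i j : Fin 3) :
    (p : ℤ_[p]) ∣ (LinearMap.toMatrix' (smulHom e φ h)).adjugate i j := by
  obtain ⟨z, hz⟩ : ∃ z, z ∉ φ.domain := by
    by_contra! hall
    have h1 : φ.index = 1 := AddSubgroup.index_eq_one.2 (by
      rw [AddSubgroup.eq_top_iff']
      exact hall)
    exact (Fact.out : p.Prime).one_lt.ne (h1.symm.trans h)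
  obtain ⟨z, rfl⟩ := (ofCoord e).surjective z
  have key : ∀ j : Fin 3, ∃ n : ℤ, ∀ i, toZMod (LinearMap.toMatrix' (smulHom e φ h) i j) =
      n * toZMod (smulHom e φ h z i) := by
    intro j
    obtain ⟨n, hn⟩ := VirtualEndomorphism.exists_nsmul_sub_mem_domain h hz
      (ofCoord e (Pi.single j 1))
    refine ⟨n, fun i => ?_⟩
    rw [← map_smul, ← map_sub] at hn
    have h1 := smulHom_of_mem e φ h hn
    have h2 := congrFun h1 i
    rw [map_sub, map_smul] at h2
    rw [LinearMap.toMatrix'_apply, ← map_intCast (toZMod : ℤ_[p] →+* ZMod p), ← map_mul,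
      ← sub_eq_zero, ← map_sub, toZMod_eq_zero_iff]
    exact ⟨_, h2⟩
  choose n hn using key
  generalize LinearMap.toMatrix' (smulHom e φ h) = W at hn ⊢
  rw [← toZMod_eq_zero_iff, Matrix.adjugate_fin_three]
  fin_cases i <;> fin_cases j <;> simp [hn] <;> ring

/-- A virtual endomorphism of index `p` is not simple if the rescaled entries are integral. -/
theorem not_isSimple_of_pow_dvd (ha : ∀ i, a i ≠ 0) {m : Fin 3 → ℕ}
    (hm : ∀ i, (p : ℤ_[p]) ^ m i ∣ a i)
    (hdvd : (∀ i j, p * (LinearMap.toMatrix' (smulHom e φ h) i j * a j) =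
        a i * (LinearMap.toMatrix' (smulHom e φ h)).adjugate j i) →
      (LinearMap.toMatrix' (smulHom e φ h)).det = (p : ℤ_[p]) ^ 3 →
      (∀ i j, (p : ℤ_[p]) ∣ (LinearMap.toMatrix' (smulHom e φ h)).adjugate i j) →
      ∀ i j, (p : ℤ_[p]) ^ (m i + 1) ∣ LinearMap.toMatrix' (smulHom e φ h) i j * p ^ m j) :
    ¬ φ.IsSimple := by
  intro hsimple
  set W := LinearMap.toMatrix' (smulHom e φ h) with hW
  have hWx : ∀ x i, smulHom e φ h x i = W i 0 * x 0 + W i 1 * x 1 + W i 2 * x 2 := by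
    intro x i
    rw [← LinearMap.toMatrix'_mulVec, Matrix.mulVec, dotProduct, Fin.sum_univ_three]
  have hentries : ∀ i j, (p : ℤ_[p]) ^ (m i + 1) ∣ W i j * p ^ m j := by
    have h1 := toMatrix'_mul_eq _ _ (smul_smulHom_bracket e φ h)
    by_cases hW0 : W = 0
    · simp [hW0]
    · exact hdvd h1 (det_eq_of_ne_zero ha h1 hW0) (dvd_adjugate_smulHom e φ h)
  -- This is p times the rescaled lattice. The extra factor p places it in pL, hence in the domain,
  -- and, with p^mᵢ dividing aᵢ, makes it an ideal.
  let S : Submodule ℤ_[p] (Fin 3 → ℤ_[p]) :=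
    { carrier := {x | ∀ i, (p : ℤ_[p]) ^ (m i + 1) ∣ x i}
      add_mem' := fun hx hy i => dvd_add (hx i) (hy i)
      zero_mem' := fun i => dvd_zero _
      smul_mem' := fun c x hx i => Dvd.dvd.mul_left (hx i) c }
  have hp1 : ∀ {x}, x ∈ S → ∀ i, (p : ℤ_[p]) ∣ x i := fun hx i =>
    (dvd_pow_self _ (Nat.succ_ne_zero _)).trans (hx i)
  have hS : ∀ x y, y ∈ S → bracket a x y ∈ S := by
    intro x y hy i
    rw [pow_succ]
    apply mul_dvd_mul (hm i)
    have h1 := hp1 hy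
    rw [cross_apply]
    fin_cases i
    · exact dvd_sub (Dvd.dvd.mul_left (h1 _) _) (Dvd.dvd.mul_left (h1 _) _)
    · exact dvd_sub (Dvd.dvd.mul_left (h1 _) _) (Dvd.dvd.mul_left (h1 _) _)
    · exact dvd_sub (Dvd.dvd.mul_left (h1 _) _) (Dvd.dvd.mul_left (h1 _) _)
  let I : LieIdeal ℤ_[p] L :=
    { S.map (ofCoord e).toLinearMap with
      lie_mem := by
        rintro x _ ⟨y, hy, rfl⟩
        refine ⟨bracket a ((ofCoord e).symm x) y, hS _ _ hy, ?_⟩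
        change ofCoord e _ = ⁅x, ofCoord e y⁆
        rw [ofCoord_bracket, LinearEquiv.apply_symm_apply] }
  have hI : ∀ x, x ∈ S → ofCoord e x ∈ I := fun x hx => ⟨x, hx, rfl⟩
  have hbot : I = ⊥ := by
    apply hsimple
    rintro _ ⟨x, hx, rfl⟩
    have h1 := hp1 hx
    choose y hy using h1
    have hxy : x = (p : ℤ_[p]) • y := funext hy
    have hmem : ofCoord e x ∈ φ.domain := by
      rw [hxy, map_smul]
      exact φ.smul_mem_domain h _
    refine ⟨hmem, ?_⟩
    -- As x = p·y, the value φ(x) is W·y, and the divisibility of the rescaled entries applies.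
    have h2 : φ.toHom ⟨ofCoord e x, hmem⟩ = ofCoord e (smulHom e φ h y) := by
      rw [ofCoord_smulHom]
      congr 1
      apply Subtype.ext
      change ofCoord e x = (p : ℤ_[p]) • ofCoord e y
      rw [hxy, map_smul]
    have h3 : ∀ j, (p : ℤ_[p]) ^ m j ∣ y j := by
      intro j
      have := hx j
      rw [hy, pow_succ'] at this
      exact (mul_dvd_mul_iff_left p_ne_zero).1 this
    have h4 : ∀ i j, (p : ℤ_[p]) ^ (m i + 1) ∣ W i j * y j := fun i j =>
      (hentries i j).trans (mul_dvd_mul_left _ (h3 j))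
    change φ.toHom ⟨ofCoord e x, hmem⟩ ∈ I
    rw [h2]
    refine hI _ fun i => ?_
    rw [hWx]
    exact dvd_add (dvd_add (h4 i 0) (h4 i 1)) (h4 i 2)
  have h5 : (fun i => (p : ℤ_[p]) ^ (m i + 1)) ∈ S := fun i => dvd_refl _
  have h6 := hI _ h5
  rw [hbot, LieSubmodule.mem_bot, map_eq_zero_iff _ (ofCoord e).injective] at h6
  exact pow_ne_zero _ p_ne_zero (congrFun h6 0)

end

/-- A criterion for a lattice not to be self-similar of index `p`. -/
theorem sq_le_of_isSelfSimilarOfIndex (hp : 3 ≤ p) {L : Type*} [LieRing L] [LieAlgebra ℤ_[p] L]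
    {s : Fin 3 → ℕ} {α : Fin 3 → ℤ_[p]} (hα : ∀ i, IsUnit (α i)) (hs : ∀ i, s 0 ≤ s i)
    (e : L ≃ₗ⁅ℤ_[p]⁆ DiagLie fun i => (p : ℤ_[p]) ^ s i * α i) {m : Fin 3 → ℕ}
    (hm : ∀ i, m i = (s i - s 0) / 2)
    (hc : ∀ i, ∃ l, (m i < m l ∨ m i + 1 + s l ≤ m l + s i) ∧
      ((m i < m (l + 1) ∨ m i + 1 + s (l + 1) ≤ m (l + 1) + s i) ∨
      (m i < m (l + 2) ∨ m i + 1 + s (l + 2) ≤ m (l + 2) + s i) ∨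
      ¬ IsSquare (-((p : ℚ_[p]) ^ s (l + 1) * α (l + 1) * (p ^ s (l + 2) * α (l + 2))))))
    {d : ℕ} (hd : IsSelfSimilarOfIndex p L d) : p ^ 2 ≤ d := by
  obtain ⟨h1, φ, rfl, hφ⟩ := hd
  have := isTorsionFree_of_equiv e
  have := nontrivial_of_equiv e
  refine (hφ.index_eq_or_le (by omega)).resolve_left fun hidx => ?_
  refine not_isSimple_of_pow_dvd e φ hidx
    (fun i => mul_ne_zero (pow_ne_zero _ p_ne_zero) (hα i).ne_zero) (m := m) ?_ ?_ hφ
  · intro i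
    refine Dvd.dvd.mul_right (pow_dvd_pow _ ?_) _
    rw [hm]
    omega
  · intro h2 h3 h4 i j
    obtain ⟨l, hl, hlc⟩ := hc i
    exact pow_dvd_entries hp hα hs h2 h3 h4 hm hl hlc j

end DiagLie

/-! ### Consequences of isotropy for parities and square classes. -/

namespace Padic

variable {p : ℕ} [Fact p.Prime]

open PadicInt

theorem not_isSquare_neg_mul (hp : 3 ≤ p) {α β : ℤ_[p]} (hα : IsUnit α) (hβ : IsUnit β) {s t : ℕ}
    (h : ¬ (s % 2 = t % 2 ∧ IsSquare (toZMod (-(α * β))))) :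
    ¬ IsSquare (-((p : ℚ_[p]) ^ s * α * (p ^ t * β))) := by
  have e : -((p : ℚ_[p]) ^ s * α * (p ^ t * β)) = p ^ (s + t) * ((-(α * β) : ℤ_[p]) : ℚ_[p]) := by
    push_cast
    ring
  rw [e, isSquare_pow_mul_iff hp (hα.mul hβ).neg]
  exact fun ⟨h1, h2⟩ => h ⟨by omega, h2⟩

theorem mod_two_eq_of_norm_eq {α β : ℤ_[p]} (hα : IsUnit α) (hβ : IsUnit β) {s t : ℕ}
    {x y : ℚ_[p]} (hx : x ≠ 0) (hy : y ≠ 0)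
    (h : ‖(p : ℚ_[p]) ^ s * α * x ^ 2‖ = ‖(p : ℚ_[p]) ^ t * β * y ^ 2‖) : s % 2 = t % 2 := by
  have hval : ∀ (n : ℕ) (z : ℚ_[p]), z ≠ 0 → ‖(p : ℚ_[p]) ^ n * z ^ 2‖ =
      (p : ℝ) ^ (-(n + 2 * z.valuation)) := by
    intro n z hz
    rw [Padic.norm_eq_zpow_neg_valuation
      (mul_ne_zero (pow_ne_zero _ coe_p_ne_zero) (pow_ne_zero _ hz)),
      Padic.valuation_mul (pow_ne_zero _ coe_p_ne_zero) (pow_ne_zero _ hz), Padic.valuation_pow,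
      Padic.valuation_pow, Padic.valuation_p]
    simp
  have h1 : ‖(p : ℚ_[p]) ^ s * x ^ 2‖ = ‖(p : ℚ_[p]) ^ t * y ^ 2‖ := by
    have : ∀ (n : ℕ) (u : ℤ_[p]) (z : ℚ_[p]), IsUnit u →
        ‖(p : ℚ_[p]) ^ n * u * z ^ 2‖ = ‖(p : ℚ_[p]) ^ n * z ^ 2‖ := by
      intro n u z hu
      rw [norm_mul, norm_mul, norm_mul, coe_unit_norm hu, mul_one]
    rwa [this _ _ _ hα, this _ _ _ hβ] at h
  rw [hval _ _ hx, hval _ _ hy] at h1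
  have h2 := zpow_right_injective₀ (a := (p : ℝ))
    (by exact_mod_cast (Fact.out : p.Prime).pos)
    (by exact_mod_cast (Fact.out : p.Prime).one_lt.ne') h1
  omega

/-- The parity and square class conditions imposed by the isotropy of a diagonal ternary form. -/
theorem mod_two_eq_or_isSquare_of_isotropic (hp : 3 ≤ p) {s : Fin 3 → ℕ} {α : Fin 3 → ℤ_[p]}
    (hα : ∀ i, IsUnit (α i)) {y : Fin 3 → ℚ_[p]} (hy : y ≠ 0)
    (h : (p : ℚ_[p]) ^ s 0 * α 0 * y 0 ^ 2 + p ^ s 1 * α 1 * y 1 ^ 2 +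
      p ^ s 2 * α 2 * y 2 ^ 2 = 0) :
    (s 0 % 2 = s 1 % 2 ∧ s 1 % 2 = s 2 % 2) ∨
      (s 0 % 2 = s 1 % 2 ∧ IsSquare (toZMod (-(α 0 * α 1)))) ∨
      (s 1 % 2 = s 2 % 2 ∧ IsSquare (toZMod (-(α 1 * α 2)))) ∨
      (s 0 % 2 = s 2 % 2 ∧ IsSquare (toZMod (-(α 0 * α 2)))) := by
  by_contra! hcon
  obtain ⟨hall, h01, h12, h02⟩ := hcon
  have hne : ∀ i, (p : ℚ_[p]) ^ s i * α i ≠ 0 := fun i =>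
    mul_ne_zero (pow_ne_zero _ coe_p_ne_zero) (coe_unit_ne_zero (hα i))
  have n01 := norm_binary_eq_max hp (hne 0) (hne 1)
    (not_isSquare_neg_mul hp (hα 0) (hα 1) fun h => h01 h.1 h.2) (y 0) (y 1)
  have n12 := norm_binary_eq_max hp (hne 1) (hne 2)
    (not_isSquare_neg_mul hp (hα 1) (hα 2) fun h => h12 h.1 h.2) (y 1) (y 2)
  have n02 := norm_binary_eq_max hp (hne 0) (hne 2)
    (not_isSquare_neg_mul hp (hα 0) (hα 2) fun h => h02 h.1 h.2) (y 0) (y 2)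
  rw [eq_neg_of_add_eq_zero_left h, norm_neg] at n01
  rw [show (p : ℚ_[p]) ^ s 1 * α 1 * y 1 ^ 2 + p ^ s 2 * α 2 * y 2 ^ 2 =
    -(p ^ s 0 * α 0 * y 0 ^ 2) by linear_combination h, norm_neg] at n12
  have l0 := (le_max_left _ _).trans n01.ge
  have l1 := (le_max_right _ _).trans n01.ge
  have l2 := (le_max_left _ _).trans n12.ge
  have l3 := (le_max_right _ _).trans n12.ge
  rw [show (p : ℚ_[p]) ^ s 0 * α 0 * y 0 ^ 2 + p ^ s 2 * α 2 * y 2 ^ 2 =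
    -(p ^ s 1 * α 1 * y 1 ^ 2) by linear_combination h, norm_neg] at n02
  have l4 := (le_max_left _ _).trans n02.ge
  -- Without cancellation in any pair, each term of the vanishing sum dominates the other two. All
  -- three norms are then equal, so the three exponents have the same parity.
  have e01 := le_antisymm l4 l2
  have e02 := le_antisymm l0 l3
  have hy0 : y 0 ≠ 0 := by
    intro h0
    apply hy
    have z0 : ‖(p : ℚ_[p]) ^ s 0 * α 0 * y 0 ^ 2‖ = 0 := by simp [h0]
    have hz : ∀ i, ‖(p : ℚ_[p]) ^ s i * α i * y i ^ 2‖ = 0 → y i = 0 := fun i hi =>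
      pow_eq_zero_iff two_ne_zero |>.1
        ((mul_eq_zero.1 (norm_eq_zero.1 hi)).resolve_left (hne i))
    funext i
    fin_cases i
    · exact h0
    · exact hz 1 (e01 ▸ z0)
    · exact hz 2 (e02 ▸ z0)
  have hy' : ∀ i, ‖(p : ℚ_[p]) ^ s 0 * α 0 * y 0 ^ 2‖ = ‖(p : ℚ_[p]) ^ s i * α i * y i ^ 2‖ →
      y i ≠ 0 := by
    intro i hi h0
    rw [h0, zero_pow two_ne_zero, mul_zero, norm_zero, norm_eq_zero] at hi
    exact mul_ne_zero (hne 0) (pow_ne_zero 2 hy0) hi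
  have m1 := mod_two_eq_of_norm_eq (hα 0) (hα 1) hy0 (hy' 1 e01) e01
  have m2 := mod_two_eq_of_norm_eq (hα 0) (hα 2) hy0 (hy' 2 e02) e02
  exact hall m1 (m1.symm.trans m2)

end Padic

/-! ### The estimates for each line and the completeness of the table. -/

namespace TableEntry

open PadicInt

variable {p : ℕ} [Fact p.Prime]

/-- The exponent of `p` in the lower estimate for the self-similarity index. -/
def lowerExponent : TableEntry → ℕ
  | line1 _ => 1
  | line2 _ _ => 1
  | line4 _ _ => 1
  | _ => 2

/-- Where p² is claimed, each row i needs a pivot l with an entry covered for free; then either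
another entry of the row is covered as well, or the other two coefficients form an anisotropic pair,
by opposite parities or because ρ is not a square modulo p. -/
theorem Valid.pow_le_of_isSelfSimilarOfIndex (hp : 3 ≤ p) {ρ : ℤ_[p]} (hρu : IsUnit ρ)
    (hρ : ¬ IsSquare (toZMod ρ)) {t : TableEntry} (ht : t.Valid p) {L : Type*} [LieRing L]
    [LieAlgebra ℤ_[p] L] (e : L ≃ₗ⁅ℤ_[p]⁆ t.Lattice ρ) {d : ℕ} (hd : IsSelfSimilarOfIndex p L d) :
    p ^ t.lowerExponent ≤ d := by
  have hone : p ^ 1 ≤ d := by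
    obtain ⟨h1, φ, rfl, hφ⟩ := hd
    have := DiagLie.isTorsionFree_of_equiv e
    have := DiagLie.nontrivial_of_equiv e
    rcases hφ.index_eq_or_le (by omega) with h | h
    · rw [h, pow_one]
    · exact (Nat.pow_le_pow_right (by omega) (by omega)).trans h
  have hmono := monotone_exponents ht
  have key := fun e' => DiagLie.sq_le_of_isSelfSimilarOfIndex (L := L) (d := d) hp (isUnit_unitParts hρu t)
    (fun i => hmono (Fin.zero_le i)) e' (m := fun i => (t.exponents i - t.exponents 0) / 2)
    (fun i => rfl)
  have hns := fun i j => Padic.not_isSquare_neg_mul hp (isUnit_unitParts hρu t i)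
    (isUnit_unitParts hρu t j) (s := t.exponents i) (t := t.exponents j)
  unfold Lattice at e
  rw [diag_eq] at e
  cases t with
  | line1 => exact hone
  | line2 => exact hone
  | line4 => exact hone
  | line3 s₀ s₁ =>
    refine key e (fun i => ?_) hd
    have hn := hns 1 2 (fun h => hρ (by simpa [unitParts] using h.2))
    simp only [Valid, Nat.ModEq] at ht
    fin_cases i
    · refine ⟨1, ?_, Or.inl ?_⟩ <;> simp [exponents] <;> omega
    · exact ⟨0, by simp [exponents]; omega, Or.inr (Or.inr hn)⟩
    · exact ⟨0, by simp [exponents]; omega, Or.inr (Or.inr hn)⟩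
  | line5 s₀ s₂ =>
    refine key e (fun i => ?_) hd
    have hn := hns 0 1 (fun h => hρ (by simpa [unitParts] using h.2))
    simp only [Valid, Nat.ModEq] at ht
    fin_cases i
    · exact ⟨2, by simp [exponents]; omega, Or.inr (Or.inr hn)⟩
    · exact ⟨2, by simp [exponents]; omega, Or.inr (Or.inr hn)⟩
    · refine ⟨0, ?_, Or.inl ?_⟩ <;> simp [exponents] <;> omega
  | line6 s₀ s₁ s₂ ε₁ ε₂ =>
    refine key e (fun i => ?_) hd
    simp only [Valid, Nat.ModEq] at ht
    fin_cases i
    · refine ⟨1, ?_, Or.inl ?_⟩ <;> simp [exponents] <;> omega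
    · refine ⟨0, ?_, Or.inr (Or.inl ?_)⟩ <;> simp [exponents] <;> omega
    · refine ⟨0, ?_, Or.inl ?_⟩ <;> simp [exponents] <;> omega
  | line7 s₀ s₁ s₂ ε₁ ε₂ =>
    refine key e (fun i => ?_) hd
    have hn := hns 1 2 (fun h => ht.2.2.2.1 h.1)
    simp only [Valid, Nat.ModEq] at ht
    fin_cases i
    · refine ⟨1, ?_, Or.inl ?_⟩ <;> simp [exponents] <;> omega
    · exact ⟨0, by simp [exponents]; omega, Or.inr (Or.inr hn)⟩
    · refine ⟨0, ?_, Or.inl ?_⟩ <;> simp [exponents] <;> omega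
  | line8 s₀ s₁ s₂ ε₁ ε₂ =>
    refine key e (fun i => ?_) hd
    have hn := hns 0 1 (fun h => ht.2.2.2.1 (ht.2.2.1.symm.trans h.1.symm))
    simp only [Valid, Nat.ModEq] at ht
    fin_cases i
    · exact ⟨2, by simp [exponents]; omega, Or.inr (Or.inr hn)⟩
    · refine ⟨0, ?_, Or.inr (Or.inl ?_)⟩ <;> simp [exponents] <;> omega
    · refine ⟨0, ?_, Or.inl ?_⟩ <;> simp [exponents] <;> omega
  | line9 s₀ s₁ s₂ ε₁ ε₂ =>
    refine key e (fun i => ?_) hd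
    have hn := hns 0 1 (fun h => ht.2.2.2.1 (ht.2.2.1.symm.trans h.1))
    have hn' := hns 1 2 (fun h => ht.2.2.2.1 h.1.symm)
    simp only [Valid, Nat.ModEq] at ht
    fin_cases i
    · exact ⟨2, by simp [exponents]; omega, Or.inr (Or.inr hn)⟩
    · refine ⟨0, ?_, Or.inr (Or.inl ?_)⟩ <;> simp [exponents] <;> omega
    · exact ⟨0, by simp [exponents]; omega, Or.inr (Or.inr hn')⟩

theorem Valid.estimate (hp : 3 ≤ p) {ρ : ℤ_[p]} (hρu : IsUnit ρ) (hρ : ¬ IsSquare (toZMod ρ))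
    {t : TableEntry} (ht : t.Valid p) {L : Type*} [LieRing L] [LieAlgebra ℤ_[p] L]
    (e : L ≃ₗ⁅ℤ_[p]⁆ t.Lattice ρ) : t.Estimate p (selfSimilarityIndex p L) := by
  have hup : selfSimilarityIndex p L ≤ (p : ℕ∞) ^ t.upperExponent := by
    obtain ⟨n, hn, h⟩ := ht.exists_isSelfSimilarOfIndex_le hp hρu hρ e
    refine (sInf_le ⟨n, h, rfl⟩ : selfSimilarityIndex p L ≤ (n : ℕ∞)).trans ?_
    exact_mod_cast hn
  have hlow : (p : ℕ∞) ^ t.lowerExponent ≤ selfSimilarityIndex p L := by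
    refine le_sInf ?_
    rintro _ ⟨d, hd, rfl⟩
    exact_mod_cast ht.pow_le_of_isSelfSimilarOfIndex hp hρu hρ e hd
  cases t with
  | line1 => exact le_antisymm (hup.trans_eq (pow_one _)) ((pow_one _).symm.trans_le hlow)
  | line2 => exact le_antisymm (hup.trans_eq (pow_one _)) ((pow_one _).symm.trans_le hlow)
  | line4 => exact le_antisymm (hup.trans_eq (pow_one _)) ((pow_one _).symm.trans_le hlow)
  | _ => exact ⟨hlow, hup⟩

theorem mod_two_eq_or_isSquare (hp : 3 ≤ p) {ρ : ℤ_[p]} (hρu : IsUnit ρ) (t : TableEntry)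
    (h : IsUnsolvableSl2Lattice p (t.Lattice ρ)) :
    (t.exponents 0 % 2 = t.exponents 1 % 2 ∧ t.exponents 1 % 2 = t.exponents 2 % 2) ∨
      (t.exponents 0 % 2 = t.exponents 1 % 2 ∧
        IsSquare (toZMod (-(t.unitParts ρ 0 * t.unitParts ρ 1)))) ∨
      (t.exponents 1 % 2 = t.exponents 2 % 2 ∧
        IsSquare (toZMod (-(t.unitParts ρ 1 * t.unitParts ρ 2)))) ∨
      (t.exponents 0 % 2 = t.exponents 2 % 2 ∧
        IsSquare (toZMod (-(t.unitParts ρ 0 * t.unitParts ρ 2)))) := by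
  obtain ⟨y, hy, h⟩ := (DiagLie.isUnsolvableSl2Lattice_iff _ (diag_ne_zero hρu t)).1 h
  refine Padic.mod_two_eq_or_isSquare_of_isotropic hp (isUnit_unitParts hρu t) hy ?_
  rw [diag_eq] at h
  push_cast at h
  exact h

/-- The normal form gives the shape of the diagonal; isotropy then supplies the parity and square
conditions. For three distinct exponents of mixed parity, the alternative of
`mod_two_eq_or_isSquare` that holds decides between `line7`, `line8` and `line9`. -/
theorem exists_valid_equiv (hp : 3 ≤ p) {ρ : ℤ_[p]} (hρu : IsUnit ρ) (hρ : ¬ IsSquare (toZMod ρ))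
    {L : Type u} [LieRing L] [LieAlgebra ℤ_[p] L] (hL : IsUnsolvableSl2Lattice p L) :
    ∃ t : TableEntry, t.Valid p ∧ Nonempty (L ≃ₗ⁅ℤ_[p]⁆ t.Lattice ρ) := by
  obtain ⟨a, ha, h10, h21, ⟨e⟩⟩ := hL.exists_diagLie hp
  have hval : ∀ i j, ‖a i‖ ≤ ‖a j‖ → (a j).valuation ≤ (a i).valuation := by
    intro i j hij
    rw [norm_eq_zpow_neg_valuation (ha i), norm_eq_zpow_neg_valuation (ha j),
      zpow_le_zpow_iff_right₀ (by exact_mod_cast (Fact.out : p.Prime).one_lt)] at hij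
    omega
  have hspec : ∀ i, a i = (p : ℤ_[p]) ^ (a i).valuation * unitCoeff (ha i) := fun i => by
    rw [mul_comm]
    exact unitCoeff_spec (ha i)
  obtain ⟨t, ⟨e'⟩, ht⟩ := DiagLie.exists_normalForm hp hρu hρ (hval 1 0 h10) (hval 2 1 h21)
    (unitCoeff (ha 0)).isUnit (unitCoeff (ha 1)).isUnit (unitCoeff (ha 2)).isUnit (b := a) (by
      funext i
      fin_cases i
      · exact hspec 0
      · exact hspec 1
      · exact hspec 2)
  have hcond := mod_two_eq_or_isSquare hp hρu t (hL.of_equiv (e.trans e'))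
  have hsq := fun n => (isSquare_neg_pow_iff hp hρ n).1
  have e := e.trans e'
  rcases ht with ⟨s₀, rfl⟩ | ⟨s₀, s₁, hlt, rfl | rfl | rfl | rfl⟩ | ⟨s₀, s₁, s₂, ε₁, ε₂, h₁, h₂, rfl⟩
  · exact ⟨.line1 s₀, trivial, ⟨e⟩⟩
  · exact ⟨.line2 s₀ s₁, hlt, ⟨e⟩⟩
  · refine ⟨.line3 s₀ s₁, ⟨hlt, ?_⟩, ⟨e⟩⟩
    rcases hcond with h | h | h | h
    · exact h.1
    · exact h.1
    -- For the plane (1, -ρ) the negative of the product of the units is ρ itself.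
    · exact absurd (by simpa [unitParts] using h.2) hρ
    · exact h.1
  · exact ⟨.line4 s₀ s₁, hlt, ⟨e⟩⟩
  · refine ⟨.line5 s₀ s₁, ⟨hlt, ?_⟩, ⟨e⟩⟩
    rcases hcond with h | h | h | h
    · exact h.2
    · exact absurd (by simpa [unitParts] using h.2) hρ
    · exact h.1
    · exact h.1
  · by_cases hall : s₀ ≡ s₁ [MOD 2] ∧ s₁ ≡ s₂ [MOD 2]
    · exact ⟨.line6 s₀ s₁ s₂ ε₁ ε₂, ⟨h₁, h₂, hall.1, hall.2⟩, ⟨e⟩⟩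
    · rcases hcond with h | ⟨h, h'⟩ | ⟨h, h'⟩ | ⟨h, h'⟩
      · exact absurd h hall
      · exact ⟨.line7 s₀ s₁ s₂ ε₁ ε₂, ⟨h₁, h₂, h, fun h'' => hall ⟨h, h''⟩,
          hsq ε₁ (by simpa [unitParts] using h')⟩, ⟨e⟩⟩
      · exact ⟨.line8 s₀ s₁ s₂ ε₁ ε₂, ⟨h₁, h₂, h, fun h'' => hall ⟨(h.trans h'').symm, h⟩,
          hsq (ε₁ + ε₂) (by simpa [unitParts, pow_add] using h')⟩, ⟨e⟩⟩
      · exact ⟨.line9 s₀ s₁ s₂ ε₁ ε₂, ⟨h₁, h₂, h, fun h'' => hall ⟨Nat.ModEq.trans h h'', h''.symm⟩,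
          hsq ε₂ (by simpa [unitParts] using h')⟩, ⟨e⟩⟩

end TableEntry

theorem mainTheorem6 (p : ℕ) [Fact p.Prime] (hp : 3 ≤ p)
    (ρ : ℤ_[p]) (hρ_unit : IsUnit ρ) (hρ : ¬ IsSquare (PadicInt.toZMod ρ)) :
    (∀ (L : Type u) [LieRing L] [LieAlgebra ℤ_[p] L], IsUnsolvableSl2Lattice p L →
      IsSelfSimilar p L ∧
      (∃! t : TableEntry, t.Valid p ∧ Nonempty (L ≃ₗ⁅ℤ_[p]⁆ t.Lattice ρ)) ∧
      ∀ t : TableEntry, t.Valid p → Nonempty (L ≃ₗ⁅ℤ_[p]⁆ t.Lattice ρ) →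
        t.Estimate p (selfSimilarityIndex p L)) ∧
    (∀ t : TableEntry, t.Valid p → IsUnsolvableSl2Lattice p (t.Lattice ρ)) := by
  refine ⟨fun L _ _ hL => ?_, fun t ht => ht.isUnsolvableSl2Lattice hp hρ_unit hρ⟩
  obtain ⟨t, ht, ⟨e⟩⟩ := TableEntry.exists_valid_equiv hp hρ_unit hρ hL
  obtain ⟨n, -, hn⟩ := ht.exists_isSelfSimilarOfIndex_le hp hρ_unit hρ e
  refine ⟨⟨n, hn⟩, ⟨t, ⟨ht, ⟨e⟩⟩, ?_⟩, fun t' ht' ⟨e'⟩ => ht'.estimate hp hρ_unit hρ e'⟩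
  rintro t' ⟨ht', ⟨e'⟩⟩
  exact TableEntry.eq_of_equiv hρ_unit hρ ht' ht (e'.symm.trans e)
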